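/- **Theorem ($H^m$ regularity for the Liouville equation).** Let $n,m\ge 0$ be integers, let $V\in C^1(\mathbb R^n;\mathbb R)$, write $\langle f,g\rangle=\int \overline f\,g\,dx\,dk$ and $\|f\|_{H^m(\mathbb R^{2n})}=\sum_{|A|+|B|\le m}\|\partial_x^A\partial_k^Bf\|_{L^2(\mathbb R^{2n})}$ (weak derivatives; the norm is $\infty$ if $f\notin H^m$), and $\widehat f(S)=\int e^{-2\pi i S\cdot x}f(x)\,dx$ (in the sense of tempered distributions). For $T>0$ and $\rho_0\in L^2(\mathbb R^{2n};\mathbb C)$ let $\rho\in C([0,T];L^2(\mathbb R^{2n};\mathbb C))$ be a distributional solution of the Liouville equation $$\rho_t+2\pi k\cdot\partial_x\rho-\tfrac1{2\pi}\,\partial_xV(x)\cdot\partial_k\rho=0,\qquad \rho(0)=\rho_0 .$$ We say that *the pairings are finite* if for all $t\in[0,T]$ and all multi-indices with $|A|+|B|\le m$ the weak derivative $w=\partial_x^A\partial_k^B\rho(t)$ is in $L^2$, $k\cdot\partial_xw$ and $\partial_xV\cdot\partial_kw$ are (weakly) locally integrable functions, and the integrals $$\langle w,\;k\cdot\partial_x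 w\rangle,\qquad \langle w,\;\partial_xV\cdot\partial_k w\rangle$$ converge absolutely. (1) *Estimate.* Suppose that $\widehat V$ is a function on $\mathbb R^n\setminus\{0\}$ with $\big\|\widehat V(S)|S|^{m+1}\big\|_{L^1}<\infty$; more precisely, $\int V\,\widehat\varphi=\int\widehat V\,\varphi$, with both integrals absolutely convergent, for every Schwartz function $\varphi$ with $\varphi(0)=0$ (so $\widehat V$ may blow up at $0$ as long as $|S|\widehat V(S)$ is integrable there, and $V$ matters only up to a constant). If $m=0$, suppose also that $\partial_xV$ is locally Lipschitz (for $m\ge1$ this is automatic). Then there is a constant $C>0$, depending only on $n,m,V$, such that for all $T>0$, all $\rho_0$ and all $\rho$ as above for which the pairings are finite, $$\|\rho(t)\|_{H^m}\le e^{tC}\,\|\rho_0\|_{H^m}\qquad\text{for all }t\in[0,T].$$ (2) *First sufficient condition.* The pairings are finite if the flow of $\dot x=2\pi k$, $\dot k=-\frac1{2\pi}\partial_xV(x)$ is complete (trajectories do not reach infinity in finite time), $\partial_x^aV\in L^\infty_{loc}(\mathbb R^n)$ for every $|a|\le m+2$, and $\rho_0\in H^{m+1}$ has compact support. (3) *Second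 sufficient condition.* The pairings are finite if $\partial_x^aV\in L^\infty(\mathbb R^n)$ for every $|a|\le m+2$, $\rho_0\in H^{m+1}$, and $k\cdot\partial_x\,\partial_x^A\partial_k^B\rho_0\in L^2$ for every $|A|+|B|\le m$. -/

import Mathlib

open MeasureTheory
open scoped FourierTransform ContDiff ENNReal SchwartzMap

noncomputable section

namespace Liouville

/-- Configuration space `ℝⁿ` with its Euclidean norm. -/
abbrev Conf (n : ℕ) : Type := EuclideanSpace ℝ (Fin n)

/-- Phase space `ℝ²ⁿ`, with points `z = (x, k)` and Lebesgue measure `volume`. -/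
abbrev Phase (n : ℕ) : Type := Conf n × Conf n

/-! ### Test functions and weak derivatives -/

/-- `φ ∈ C_c^∞(F; ℝ)`. -/
def IsTest {F : Type*} [NormedAddCommGroup F] [NormedSpace ℝ F] (φ : F → ℝ) : Prop :=
  ContDiff ℝ ∞ φ ∧ HasCompactSupport φ

/-- The classical mixed partial derivative `∂₀^{a 0} ⋯ ∂_{d-1}^{a (d-1)} φ`, where `∂ᵢ` is the
derivative in the direction `e i`. -/
def mixedPartial {F : Type*} [NormedAddCommGroup F] [NormedSpace ℝ F] {d : ℕ}
    (e : Fin d → F) (a : Fin d → ℕ) (φ : F → ℝ) : F → ℝ :=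
  (List.finRange d).foldr (fun i f => (fun (g : F → ℝ) z => fderiv ℝ g z (e i))^[a i] f) φ

/-- The weak form of `L f = g`, where `L` is a linear differential operator given through its
formal adjoint `D`: both functions are locally integrable and
`∫ (D φ) f = ∫ φ g` for every test function `φ`. -/
def WeakEq {F G : Type*} [NormedAddCommGroup F] [NormedSpace ℝ F] [MeasureSpace F]
    [NormedAddCommGroup G] [NormedSpace ℝ G]
    (D : (F → ℝ) → F → ℝ) (f g : F → G) : Prop :=
  LocallyIntegrable f ∧ LocallyIntegrable g ∧
    ∀ φ : F → ℝ, IsTest φ → ∫ z, D φ z • f z = ∫ z, φ z • g z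

/-- The standard basis of `ℝⁿ`. -/
def ebasis (n : ℕ) (i : Fin n) : Conf n := EuclideanSpace.single i 1

/-- `g` is the weak derivative `∂ₓ^a U` of a function `U` on `ℝⁿ`. -/
def IsWeakDerivConf {n : ℕ} (a : Fin n → ℕ) (U g : Conf n → ℝ) : Prop :=
  WeakEq (fun φ x => (-1) ^ (∑ i, a i) * mixedPartial (ebasis n) a φ x) U g

/-- `g` is the weak derivative `∂ₓ^A ∂ₖ^B f` of a function `f` on phase space. -/
def IsWeakDeriv {n : ℕ} (A B : Fin n → ℕ) (f g : Phase n → ℂ) : Prop :=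
  WeakEq (fun φ z => (-1) ^ (∑ i, A i + ∑ i, B i) *
    mixedPartial (fun i => ((ebasis n i, 0) : Phase n)) A
      (mixedPartial (fun i => ((0, ebasis n i) : Phase n)) B φ) z) f g

/-- `g = k · ∂ₓ f` weakly (the vector field `(k, 0)` is divergence free). -/
def IsWeakKdx {n : ℕ} (f g : Phase n → ℂ) : Prop :=
  WeakEq (fun φ z => -fderiv ℝ φ z (z.2, 0)) f g

/-- `g = ∂ₓV · ∂ₖ f` weakly (the vector field `(0, ∂ₓV(x))` is divergence free). -/
def IsWeakForce {n : ℕ} (V : Conf n → ℝ) (f g : Phase n → ℂ) : Prop :=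
  WeakEq (fun φ z => -fderiv ℝ φ z (0, gradient V z.1)) f g

/-! ### Sobolev norms -/

/-- The finite set of pairs of multi-indices with `|A| + |B| ≤ m`. -/
def multiIdx (n m : ℕ) : Finset ((Fin n → ℕ) × (Fin n → ℕ)) :=
  ((Fintype.piFinset fun _ => Finset.range (m + 1)) ×ˢ
    (Fintype.piFinset fun _ => Finset.range (m + 1))).filter
      fun p => ∑ i, p.1 i + ∑ i, p.2 i ≤ m

theorem mem_multiIdx {n m : ℕ} (p : (Fin n → ℕ) × (Fin n → ℕ)) :
    p ∈ multiIdx n m ↔ ∑ i, p.1 i + ∑ i, p.2 i ≤ m := by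
  simp only [multiIdx, Finset.mem_filter, Finset.mem_product, Fintype.mem_piFinset,
    Finset.mem_range, and_iff_right_iff_imp]
  intro h
  refine ⟨fun i => ?_, fun i => ?_⟩
  · have := Finset.single_le_sum (f := p.1) (fun j _ => Nat.zero_le _) (Finset.mem_univ i)
    omega
  · have := Finset.single_le_sum (f := p.2) (fun j _ => Nat.zero_le _) (Finset.mem_univ i)
    omega

/-- `‖∂ₓ^A ∂ₖ^B f‖_{L²}`, which is `∞` if the weak derivative does not exist or is not in `L²`.
(Weak derivatives are unique almost everywhere, so the infimum is over at most one value.) -/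
def derivL2 {n : ℕ} (A B : Fin n → ℕ) (f : Phase n → ℂ) : ℝ≥0∞ :=
  ⨅ (g : Phase n → ℂ) (_ : IsWeakDeriv A B f g), eLpNorm g 2 volume

/-- `‖f‖_{H^m} = ∑_{|A|+|B| ≤ m} ‖∂ₓ^A ∂ₖ^B f‖_{L²}`; finite exactly when `f ∈ H^m`. -/
def sobolevNorm {n : ℕ} (m : ℕ) (f : Phase n → ℂ) : ℝ≥0∞ :=
  ∑ p ∈ multiIdx n m, derivL2 p.1 p.2 f

/-! ### The Fourier transform of the potential -/

/-- `Vhat` is the Fourier transform of `V` (with kernel `e^{-2πi S·x}`), as a function of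
`S ≠ 0`: the identity of tempered distributions `∫ V 𝓕φ = ∫ Vhat φ` holds against all Schwartz
functions `φ` that vanish at the origin. So `V` may be changed by a constant and `Vhat` need not
be integrable at the origin; if `Vhat` is the Fourier transform of `V` in the usual sense
then this holds. -/
def IsFourierOf {n : ℕ} (V : Conf n → ℝ) (Vhat : Conf n → ℂ) : Prop :=
  ∀ φ : 𝓢(Conf n, ℂ), φ 0 = 0 →
    Integrable (fun x => (V x : ℂ) * 𝓕 (φ : Conf n → ℂ) x) ∧
    Integrable (fun S => Vhat S * φ S) ∧
    ∫ x, (V x : ℂ) * 𝓕 (φ : Conf n → ℂ) x = ∫ S, Vhat S * φ S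

/-! ### The Liouville equation -/

/-- The vector field `(2πk, -∂ₓV(x)/(2π))` whose characteristics carry the Liouville equation. -/
def field {n : ℕ} (V : Conf n → ℝ) (z : Phase n) : Phase n :=
  ((2 * Real.pi) • z.2, -((1 / (2 * Real.pi)) • gradient V z.1))

/-- `ρ ∈ C([0,T]; L²)` is the (distributional) solution of
`ρ_t + 2πk·∂ₓρ - (1/2π) ∂ₓV·∂ₖρ = 0`, `ρ(0) = ρ₀`. The vector field is divergence free, so
the equation, tested against `φ(x,k)` and integrated in time, is the identity `weak`. -/
structure IsSolution {n : ℕ} (V : Conf n → ℝ) (T : ℝ)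
    (ρ₀ : Lp ℂ 2 (volume : Measure (Phase n)))
    (ρ : ℝ → Lp ℂ 2 (volume : Measure (Phase n))) : Prop where
  continuousOn : ContinuousOn ρ (Set.Icc 0 T)
  initial : ρ 0 = ρ₀
  weak : ∀ φ : Phase n → ℝ, IsTest φ → ∀ t ∈ Set.Icc 0 T,
    (∫ z, φ z • ρ t z) - ∫ z, φ z • ρ₀ z =
      ∫ s in (0 : ℝ)..t, ∫ z, fderiv ℝ φ z (field V z) • ρ s z

/-- For all `t ∈ [0,T]` and `|A| + |B| ≤ m`, with `w = ∂ₓ^A ∂ₖ^B ρ(t) ∈ L²`, the pairings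
`⟨w, k·∂ₓ w⟩` and `⟨w, ∂ₓV·∂ₖ w⟩` are finite, i.e. given by convergent integrals. -/
def PairingsFinite {n : ℕ} (V : Conf n → ℝ) (m : ℕ) (T : ℝ)
    (ρ : ℝ → Lp ℂ 2 (volume : Measure (Phase n))) : Prop :=
  ∀ t ∈ Set.Icc 0 T, ∀ A B : Fin n → ℕ, ∑ i, A i + ∑ i, B i ≤ m →
    ∃ w : Phase n → ℂ, IsWeakDeriv A B (ρ t) w ∧ MemLp w 2 volume ∧
      (∃ g, IsWeakKdx w g ∧ Integrable (fun z => starRingEnd ℂ (w z) * g z)) ∧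
      (∃ g, IsWeakForce V w g ∧ Integrable (fun z => starRingEnd ℂ (w z) * g z))

/-- The flow of the characteristic equations is complete: through every point of phase space
there is a trajectory defined for all times. -/
def CompleteFlow {n : ℕ} (V : Conf n → ℝ) : Prop :=
  ∀ z : Phase n, ∃ γ : ℝ → Phase n, γ 0 = z ∧ ∀ t, HasDerivAt γ (field V (γ t)) t

/-- `∂ₓ^a V ∈ L^∞_loc(ℝⁿ)` for all `|a| ≤ r`. -/
def DerivsLocallyBounded {n : ℕ} (V : Conf n → ℝ) (r : ℕ) : Prop :=
  ∀ a : Fin n → ℕ, ∑ i, a i ≤ r → ∃ g, IsWeakDerivConf a V g ∧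
    ∀ K : Set (Conf n), IsCompact K → MemLp g ∞ (volume.restrict K)

/-- `∂ₓ^a V ∈ L^∞(ℝⁿ)` for all `|a| ≤ r`. -/
def DerivsBounded {n : ℕ} (V : Conf n → ℝ) (r : ℕ) : Prop :=
  ∀ a : Fin n → ℕ, ∑ i, a i ≤ r → ∃ g, IsWeakDerivConf a V g ∧ MemLp g ∞ volume

/-- `ρ₀` is of compact support. -/
def CompactlySupported {n : ℕ} (ρ₀ : Lp ℂ 2 (volume : Measure (Phase n))) : Prop :=
  ∃ K : Set (Phase n), IsCompact K ∧ ∀ᵐ z, z ∉ K → ρ₀ z = 0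

/-- `k·∂ₓ ∂ₓ^A ∂ₖ^B ρ₀ ∈ L²` for all `|A| + |B| ≤ m`. -/
def KdxDerivsL2 {n : ℕ} (m : ℕ) (ρ₀ : Lp ℂ 2 (volume : Measure (Phase n))) : Prop :=
  ∀ A B : Fin n → ℕ, ∑ i, A i + ∑ i, B i ≤ m →
    ∃ w g, IsWeakDeriv A B ρ₀ w ∧ IsWeakKdx w g ∧ MemLp g 2 volume

end Liouville

end

noncomputable section

namespace Liouville

/-! ### Iterated directional derivatives along words -/

section Words

variable {F : Type*} [NormedAddCommGroup F] [NormedSpace ℝ F] {ι : Type*}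

/-- The iterated directional derivative along the word `w`. -/
def pd (e : ι → F) : List ι → (F → ℝ) → F → ℝ
  | [], φ => φ
  | i :: w, φ => fun z => fderiv ℝ (pd e w φ) z (e i)

theorem contDiff_fderiv_apply {φ : F → ℝ} (h : ContDiff ℝ ∞ φ) (v : F) :
    ContDiff ℝ ∞ fun z => fderiv ℝ φ z v :=
  (h.fderiv_right (m := ∞) (by simp)).clm_apply contDiff_const

theorem contDiff_pd (e : ι → F) (w : List ι) {φ : F → ℝ} (h : ContDiff ℝ ∞ φ) :
    ContDiff ℝ ∞ (pd e w φ) := by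
  induction w with
  | nil => exact h
  | cons i w ih => exact contDiff_fderiv_apply ih _

theorem pd_append (e : ι → F) (w w' : List ι) (φ : F → ℝ) :
    pd e (w ++ w') φ = pd e w (pd e w' φ) := by
  induction w with
  | nil => rfl
  | cons i w ih => simp [pd, ih]

theorem fderiv_fderiv_comm {φ : F → ℝ} (h : ContDiff ℝ ∞ φ) (u v : F) (z : F) :
    fderiv ℝ (fun y => fderiv ℝ φ y u) z v = fderiv ℝ (fun y => fderiv ℝ φ y v) z u := by
  have hd : DifferentiableAt ℝ (fderiv ℝ φ) z :=
    ((h.fderiv_right (m := ∞) (by simp)).differentiable (by simp)).differentiableAt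
  have key : ∀ a b : F, fderiv ℝ (fun y => fderiv ℝ φ y a) z b =
      fderiv ℝ (fderiv ℝ φ) z b a := by
    intro a b
    rw [fderiv_clm_apply hd (differentiableAt_const a)]
    simp
  rw [key, key]
  have hs : IsSymmSndFDerivAt ℝ φ z := (h.contDiffAt).isSymmSndFDerivAt
    (by simpa using (WithTop.coe_le_coe.2 le_top : ((2 : ℕ∞) : WithTop ℕ∞) ≤ ((⊤ : ℕ∞) : WithTop ℕ∞)))
  exact hs v u

theorem pd_perm (e : ι → F) {w w' : List ι} (hw : w.Perm w') {φ : F → ℝ}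
    (h : ContDiff ℝ ∞ φ) : pd e w φ = pd e w' φ := by
  induction hw with
  | nil => rfl
  | cons i _ ih => simp [pd, ih]
  | swap i j l =>
    funext z
    exact fderiv_fderiv_comm (contDiff_pd e l h) _ _ z
  | trans _ _ h1 h2 => rw [h1, h2]

theorem IsTest.fderiv_apply {φ : F → ℝ} (h : IsTest φ) (v : F) :
    IsTest fun z => fderiv ℝ φ z v :=
  ⟨contDiff_fderiv_apply h.1 v, h.2.fderiv_apply (𝕜 := ℝ) v⟩

theorem IsTest.pd {φ : F → ℝ} (h : IsTest φ) (e : ι → F) (w : List ι) :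
    IsTest (pd e w φ) := by
  induction w with
  | nil => exact h
  | cons i w ih => exact ih.fderiv_apply _

theorem pd_replicate (e : ι → F) (r : ℕ) (i : ι) (φ : F → ℝ) :
    pd e (List.replicate r i) φ = (fun (g : F → ℝ) z => fderiv ℝ g z (e i))^[r] φ := by
  induction r with
  | zero => rfl
  | succ r ih => rw [Function.iterate_succ_apply', ← ih]; rfl

/-- The canonical word with letter counts `a`. -/
def canon {d : ℕ} (a : Fin d → ℕ) : List (Fin d) :=
  (List.finRange d).flatMap fun i => List.replicate (a i) i

theorem mixedPartial_eq_pd {d : ℕ} (e : Fin d → F) (a : Fin d → ℕ) (φ : F → ℝ) :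
    mixedPartial e a φ = pd e (canon a) φ := by
  unfold mixedPartial canon
  induction List.finRange d with
  | nil => rfl
  | cons i l ih =>
    rw [List.foldr_cons, ih, List.flatMap_cons, pd_append, pd_replicate]

theorem count_canon {d : ℕ} (a : Fin d → ℕ) (i : Fin d) : (canon a).count i = a i := by
  unfold canon
  rw [List.count_flatMap]
  have : (List.count i ∘ fun j => List.replicate (a j) j) = fun j => if j = i then a i else 0 := by
    funext j
    simp only [Function.comp, List.count_replicate]
    by_cases h : j = i <;> simp [h]
  rw [this, ← Fin.sum_univ_def]
  simp

theorem length_canon {d : ℕ} (a : Fin d → ℕ) : (canon a).length = ∑ i, a i := by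
  unfold canon
  rw [List.length_flatMap]
  simp [Fin.sum_univ_def]

theorem pd_map {κ : Type*} (e : ι → F) (f : κ → ι) (w : List κ) (φ : F → ℝ) :
    pd e (w.map f) φ = pd (fun i => e (f i)) w φ := by
  induction w with
  | nil => rfl
  | cons i w ih => simp [pd, ih]

theorem IsTest.comp_neg_sub {η : F → ℝ} (h : IsTest η) (x : F) :
    IsTest fun y => η (x - y) := by
  refine ⟨h.1.comp (contDiff_const.sub contDiff_id), ?_⟩
  exact h.2.comp_homeomorph (Homeomorph.subLeft x)

theorem pd_comp_sub (e : ι → F) (w : List ι) {η : F → ℝ} (h : ContDiff ℝ ∞ η) (x y : F) :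
    pd e w (fun y => η (x - y)) y = (-1) ^ w.length * pd e w η (x - y) := by
  induction w generalizing y with
  | nil => simp [pd]
  | cons i w ih =>
    simp only [pd, List.length_cons]
    have : pd e w (fun y => η (x - y)) = fun y => (-1) ^ w.length * pd e w η (x - y) := by
      funext y; exact ih y
    rw [this]
    have hd : HasFDerivAt (pd e w η) (fderiv ℝ (pd e w η) (x - y)) (x - y) :=
      ((contDiff_pd e w h).differentiable (by simp)).differentiableAt.hasFDerivAt
    have h2 : HasFDerivAt (fun y : F => x - y) (-ContinuousLinearMap.id ℝ F) y :=
      (hasFDerivAt_id y).const_sub x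
    have h3 : HasFDerivAt (fun y => (-1) ^ w.length * pd e w η (x - y)) _ y :=
      (hd.comp y h2).const_mul ((-1 : ℝ) ^ w.length)
    rw [h3.fderiv]
    simp [pow_succ]

end Words

instance lawfulBEq_fin_sum (n : ℕ) : LawfulBEq (Fin n ⊕ Fin n) where
  eq_of_beq {a b} h := by
    rcases a with a | a <;> rcases b with b | b <;> first
      | exact congrArg _ (eq_of_beq (α := Fin n) h)
      | cases h
  rfl {a} := by
    rcases a with a | a <;> exact beq_self_eq_true a

/-- The coordinate directions of phase space. -/
def dir (n : ℕ) : Fin n ⊕ Fin n → Phase n :=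
  Sum.elim (fun i => (ebasis n i, 0)) (fun i => (0, ebasis n i))

/-- `g` is the weak derivative of `f` along the word `w`. -/
def IsWD {n : ℕ} (w : List (Fin n ⊕ Fin n)) (f g : Phase n → ℂ) : Prop :=
  WeakEq (fun φ z => (-1) ^ w.length * pd (dir n) w φ z) f g

def canon₂ {n : ℕ} (A B : Fin n → ℕ) : List (Fin n ⊕ Fin n) :=
  (canon A).map Sum.inl ++ (canon B).map Sum.inr

theorem length_canon₂ {n : ℕ} (A B : Fin n → ℕ) :
    (canon₂ A B).length = ∑ i, A i + ∑ i, B i := by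
  simp [canon₂, length_canon]

theorem isWeakDeriv_iff_isWD {n : ℕ} (A B : Fin n → ℕ) (f g : Phase n → ℂ) :
    IsWeakDeriv A B f g ↔ IsWD (canon₂ A B) f g := by
  unfold IsWeakDeriv IsWD
  have : ∀ φ : Phase n → ℝ, mixedPartial (fun i => ((ebasis n i, 0) : Phase n)) A
      (mixedPartial (fun i => ((0, ebasis n i) : Phase n)) B φ) = pd (dir n) (canon₂ A B) φ := by
    intro φ
    rw [canon₂, pd_append, pd_map, pd_map, mixedPartial_eq_pd, mixedPartial_eq_pd]
    rfl
  simp only [this, length_canon₂]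

theorem IsWD.perm {n : ℕ} {w w' : List (Fin n ⊕ Fin n)} {f g : Phase n → ℂ} (h : IsWD w f g)
    (hw : w.Perm w') : IsWD w' f g := by
  refine ⟨h.1, h.2.1, fun φ hφ => ?_⟩
  rw [← h.2.2 φ hφ]
  simp only [pd_perm _ hw hφ.1, hw.length_eq]

/-- The letter counts of a word. -/
def cnt {n : ℕ} (w : List (Fin n ⊕ Fin n)) : (Fin n → ℕ) × (Fin n → ℕ) :=
  (fun i => w.count (Sum.inl i), fun i => w.count (Sum.inr i))

theorem canon₂_cnt_perm {n : ℕ} (w : List (Fin n ⊕ Fin n)) :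
    (canon₂ (cnt w).1 (cnt w).2).Perm w := by
  rw [List.perm_iff_count]
  rintro (i | i)
  · rw [canon₂, List.count_append, List.count_map_of_injective _ _ Sum.inl_injective, count_canon,
      List.count_eq_zero_of_not_mem (by simp)]
    rfl
  · rw [canon₂, List.count_append, List.count_map_of_injective _ _ Sum.inr_injective, count_canon,
      List.count_eq_zero_of_not_mem (by simp), zero_add]
    rfl

theorem cnt_mem_multiIdx {n m : ℕ} {w : List (Fin n ⊕ Fin n)} :
    cnt w ∈ multiIdx n m ↔ w.length ≤ m := by
  rw [mem_multiIdx, ← length_canon₂, (canon₂_cnt_perm w).length_eq]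

theorem isWeakDeriv_cnt {n : ℕ} (w : List (Fin n ⊕ Fin n)) (f g : Phase n → ℂ) :
    IsWeakDeriv (cnt w).1 (cnt w).2 f g ↔ IsWD w f g := by
  rw [isWeakDeriv_iff_isWD]
  exact ⟨fun h => h.perm (canon₂_cnt_perm w), fun h => h.perm (canon₂_cnt_perm w).symm⟩

end Liouville

end

noncomputable section

namespace Liouville

/-! ### Calculus of weak derivatives -/

/-- The letters of words: one for each coordinate direction of phase space. -/
abbrev Ix (n : ℕ) : Type := Fin n ⊕ Fin n

theorem IsTest.continuous {F : Type*} [NormedAddCommGroup F] [NormedSpace ℝ F] {φ : F → ℝ}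
    (h : IsTest φ) : Continuous φ := h.1.continuous

theorem IsTest.integrable_smul {F G : Type*} [NormedAddCommGroup F] [NormedSpace ℝ F]
    [NormedAddCommGroup G] [NormedSpace ℝ G] [MeasurableSpace F] [BorelSpace F] {μ : Measure F}
    {φ : F → ℝ} (h : IsTest φ) {f : F → G} (hf : LocallyIntegrable f μ) :
    Integrable (fun z => φ z • f z) μ :=
  hf.integrable_smul_left_of_hasCompactSupport h.continuous h.2

theorem IsTest.mul_left {F : Type*} [NormedAddCommGroup F] [NormedSpace ℝ F] {φ c : F → ℝ}
    (h : IsTest φ) (hc : ContDiff ℝ ∞ c) : IsTest fun z => c z * φ z :=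
  ⟨hc.mul h.1, h.2.mul_left⟩

theorem memLp_locInt {n : ℕ} {f : Phase n → ℂ} (hf : MemLp f 2 volume) :
    LocallyIntegrable f volume :=
  hf.locallyIntegrable (by norm_num)

section WeakEq

variable {F G : Type*} [NormedAddCommGroup F] [NormedSpace ℝ F] [MeasureSpace F]
  [NormedAddCommGroup G] [NormedSpace ℝ G] {D : (F → ℝ) → F → ℝ}

theorem WeakEq.congr {f f' g g' : F → G} (h : WeakEq D f g) (hf : f =ᵐ[volume] f')
    (hg : g =ᵐ[volume] g') : WeakEq D f' g' := by
  refine ⟨h.1.congr hf, h.2.1.congr hg, fun φ hφ => ?_⟩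
  rw [integral_congr_ae (g := fun z => D φ z • f z), h.2.2 φ hφ]
  · apply integral_congr_ae
    filter_upwards [hg] with z hz
    rw [hz]
  · filter_upwards [hf] with z hz
    rw [hz]

theorem WeakEq.ae_unique [BorelSpace F] [FiniteDimensional ℝ F] [CompleteSpace G] {f f' g g' : F → G}
    (h : WeakEq D f g) (h' : WeakEq D f' g') (hf : f =ᵐ[volume] f') : g =ᵐ[volume] g' := by
  have h1 := h.congr hf (Filter.EventuallyEq.refl _ g)
  apply ae_eq_of_integral_contDiff_smul_eq h.2.1 h'.2.1
  intro φ h1' h2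
  rw [← h1.2.2 φ ⟨h1', h2⟩, ← h'.2.2 φ ⟨h1', h2⟩]

theorem WeakEq.add [BorelSpace F] (hD : ∀ φ, IsTest φ → Continuous (D φ) ∧ HasCompactSupport (D φ))
    {f f' g g' : F → G} (h : WeakEq D f g)
    (h' : WeakEq D f' g') : WeakEq D (fun z => f z + f' z) (fun z => g z + g' z) := by
  refine ⟨h.1.add h'.1, h.2.1.add h'.2.1, fun φ hφ => ?_⟩
  obtain ⟨h1, h2⟩ := hD φ hφ
  simp only [smul_add]
  rw [integral_add (h.1.integrable_smul_left_of_hasCompactSupport h1 h2)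
    (h'.1.integrable_smul_left_of_hasCompactSupport h1 h2),
    integral_add (hφ.integrable_smul h.2.1) (hφ.integrable_smul h'.2.1), h.2.2 φ hφ, h'.2.2 φ hφ]

theorem WeakEq.smul {f g : F → G} (h : WeakEq D f g) (c : ℝ) :
    WeakEq D (fun z => c • f z) (fun z => c • g z) := by
  refine ⟨h.1.smul c, h.2.1.smul c, fun φ hφ => ?_⟩
  simp only [smul_comm _ c]
  rw [integral_smul, integral_smul, h.2.2 φ hφ]

theorem WeakEq.zero : WeakEq D (fun _ => (0 : G)) (fun _ => 0) :=
  ⟨locallyIntegrable_zero, locallyIntegrable_zero, fun φ _ => by simp⟩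

end WeakEq

variable {n : ℕ}

theorem isTest_wd (w : List (Ix n)) {φ : Phase n → ℝ} (h : IsTest φ) :
    IsTest fun z => (-1) ^ w.length * pd (dir n) w φ z :=
  (h.pd _ w).mul_left contDiff_const

theorem IsWD.add {w : List (Ix n)} {f f' g g' : Phase n → ℂ} (h : IsWD w f g)
    (h' : IsWD w f' g') : IsWD w (fun z => f z + f' z) (fun z => g z + g' z) :=
  WeakEq.add (fun _ hφ => ⟨(isTest_wd w hφ).continuous, (isTest_wd w hφ).2⟩) h h'

theorem IsWD.smul {w : List (Ix n)} {f g : Phase n → ℂ} (h : IsWD w f g) (c : ℝ) :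
    IsWD w (fun z => c • f z) (fun z => c • g z) := WeakEq.smul h c

theorem IsWD.congr {w : List (Ix n)} {f f' g g' : Phase n → ℂ} (h : IsWD w f g)
    (hf : f =ᵐ[volume] f') (hg : g =ᵐ[volume] g') : IsWD w f' g' := WeakEq.congr h hf hg

theorem isWD_zero (w : List (Ix n)) : IsWD w (fun _ => 0) (fun _ => 0) := WeakEq.zero

theorem isWD_nil {f : Phase n → ℂ} (hf : LocallyIntegrable f volume) : IsWD [] f f :=
  ⟨hf, hf, fun φ _ => by simp [pd]⟩

theorem isWD_sum {κ : Type*} (s : Finset κ) {w : List (Ix n)} {f g : κ → Phase n → ℂ}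
    (h : ∀ i ∈ s, IsWD w (f i) (g i)) :
    IsWD w (fun z => ∑ i ∈ s, f i z) (fun z => ∑ i ∈ s, g i z) := by
  classical
  induction s using Finset.induction_on with
  | empty => simpa using isWD_zero w
  | insert a s ha ih =>
    simp only [Finset.sum_insert ha]
    exact (h a (by simp)).add (ih fun i hi => h i (by simp [hi]))

theorem pd_cons_comm (w : List (Ix n)) (σ : Ix n) {φ : Phase n → ℝ} (h : IsTest φ) :
    pd (dir n) (σ :: w) φ = pd (dir n) w (fun z => fderiv ℝ φ z (dir n σ)) := by
  rw [pd_perm (dir n) (w' := w ++ [σ]) (by simpa using (List.perm_append_singleton σ w).symm) h.1,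
    pd_append]
  rfl

theorem IsWD.cons {w : List (Ix n)} {σ : Ix n} {v G H : Phase n → ℂ} (h : IsWD w v G)
    (h' : IsWD [σ] G H) : IsWD (σ :: w) v H := by
  refine ⟨h.1, h'.2.1, fun φ hφ => ?_⟩
  have h1 := h.2.2 _ (hφ.fderiv_apply (dir n σ))
  have h2 := h'.2.2 φ hφ
  simp only [List.length_singleton, pow_one, pd, neg_one_mul, neg_smul, integral_neg] at h2
  rw [← h2, ← h1]
  simp only [pd_cons_comm w σ hφ, List.length_cons, pow_succ, mul_neg_one, neg_mul, neg_smul,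
    integral_neg]

theorem IsWD.of_cons {w : List (Ix n)} {σ : Ix n} {v G H : Phase n → ℂ} (h : IsWD w v G)
    (h' : IsWD (σ :: w) v H) : IsWD [σ] G H := by
  refine ⟨h.2.1, h'.2.1, fun φ hφ => ?_⟩
  have h1 := h.2.2 _ (hφ.fderiv_apply (dir n σ))
  rw [← h'.2.2 φ hφ]
  simp only [List.length_singleton, pow_one, pd, neg_one_mul, neg_smul, integral_neg]
  rw [← h1]
  have hc : ∀ z, fderiv ℝ (pd (dir n) w φ) z (dir n σ) =
      pd (dir n) w (fun z => fderiv ℝ φ z (dir n σ)) z := fun z =>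
    congrFun (pd_cons_comm w σ hφ) z
  simp only [hc, List.length_cons, pow_succ, mul_neg_one, neg_mul, neg_smul,
    integral_neg]

theorem isWD_singleton_iff {σ : Ix n} {f g : Phase n → ℂ} :
    IsWD [σ] f g ↔ LocallyIntegrable f volume ∧ LocallyIntegrable g volume ∧
      ∀ φ : Phase n → ℝ, IsTest φ →
        ∫ z, fderiv ℝ φ z (dir n σ) • f z = -∫ z, φ z • g z := by
  unfold IsWD WeakEq
  simp only [List.length_singleton, pow_one, pd, neg_one_mul, neg_smul, integral_neg,
    neg_eq_iff_eq_neg]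

theorem IsWD.mul {σ : Ix n} {f g : Phase n → ℂ} (h : IsWD [σ] f g) {c : Phase n → ℝ}
    (hc : ContDiff ℝ ∞ c) :
    IsWD [σ] (fun z => c z • f z) (fun z => fderiv ℝ c z (dir n σ) • f z + c z • g z) := by
  rw [isWD_singleton_iff] at h ⊢
  obtain ⟨hf, hg, h⟩ := h
  have hc' := contDiff_fderiv_apply hc (dir n σ)
  refine ⟨hf.continuous_smul hc.continuous, (hf.continuous_smul hc'.continuous).add
    (hg.continuous_smul hc.continuous), fun φ hφ => ?_⟩
  have h1 := h _ (hφ.mul_left hc)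
  have e1 : ∀ z, fderiv ℝ (fun z => c z * φ z) z (dir n σ) • f z =
      (fderiv ℝ φ z (dir n σ) * c z) • f z + (φ z * fderiv ℝ c z (dir n σ)) • f z := by
    intro z
    rw [fderiv_fun_mul (hc.differentiable (by simp)).differentiableAt
      (hφ.1.differentiable (by simp)).differentiableAt, ← add_smul]
    congr 1
    simp
    ring
  simp only [e1] at h1
  rw [integral_add] at h1
  · simp only [smul_add, smul_smul]
    rw [integral_add]
    · rw [eq_sub_of_add_eq h1]
      simp only [mul_comm (c _)]
      ring
    · simpa only [mul_comm] using (hφ.mul_left hc').integrable_smul hf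
    · simpa only [mul_comm] using (hφ.mul_left hc).integrable_smul hg
  · simpa only [mul_comm] using ((hφ.fderiv_apply (dir n σ)).mul_left hc).integrable_smul hf
  · simpa only [mul_comm] using (hφ.mul_left hc').integrable_smul hf

/-- The coordinates of phase space. -/
def coord (n : ℕ) : Ix n → Phase n → ℝ :=
  Sum.elim (fun i z => z.1 i) (fun i z => z.2 i)

theorem conf_sum (x : Conf n) : ∑ i, x i • ebasis n i = x := by
  have := (EuclideanSpace.basisFun (Fin n) ℝ).sum_repr x
  simpa [ebasis] using this

theorem sum_coord_smul_dir (z : Phase n) : ∑ τ, coord n τ z • dir n τ = z := by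
  rw [Fintype.sum_sum_type]
  ext1
  · simp [coord, dir, Prod.fst_sum, conf_sum]
  · simp [coord, dir, Prod.snd_sum, conf_sum]

/-- A vector field `Y`, constant along its own lines, such that `z ↦ z + sY(z)` is a measure
preserving shear. -/
structure IsShear (Y : Phase n → Phase n) : Prop where
  smooth : ContDiff ℝ ∞ Y
  inv : ∀ (s : ℝ) z, Y (z + s • Y z) = Y z
  mp : ∀ s : ℝ, MeasurePreserving (fun z => z + s • Y z) volume volume
  fderiv_inv : ∀ (s : ℝ) z, fderiv ℝ Y (z + s • Y z) = fderiv ℝ Y z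
  div : ∀ σ τ z, fderiv ℝ (fun z => coord n τ (fderiv ℝ Y z (dir n σ))) z (dir n τ) = 0

/-- The coefficients `∂_σ Y_τ`. -/
def coef (Y : Phase n → Phase n) (σ τ : Ix n) (z : Phase n) : ℝ :=
  coord n τ (fderiv ℝ Y z (dir n σ))

theorem contDiff_coord (τ : Ix n) : ContDiff ℝ ∞ (coord n τ) := by
  rcases τ with i | i
  · exact (contDiff_euclidean.1 contDiff_fst i)
  · exact (contDiff_euclidean.1 contDiff_snd i)

namespace IsShear

variable {Y : Phase n → Phase n}

/-- The shear as a homeomorphism. -/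
def homeo (hY : IsShear Y) (s : ℝ) : Phase n ≃ₜ Phase n where
  toFun z := z + s • Y z
  invFun z := z - s • Y z
  left_inv z := by simp [hY.inv]
  right_inv z := by
    have : Y (z - s • Y z) = Y z := by simpa [sub_eq_add_neg] using hY.inv (-s) z
    simp [this]
  continuous_toFun := continuous_id.add (hY.smooth.continuous.const_smul s)
  continuous_invFun := continuous_id.sub (hY.smooth.continuous.const_smul s)

theorem contDiff_coef (hY : IsShear Y) (σ τ : Ix n) : ContDiff ℝ ∞ (coef Y σ τ) :=
  (contDiff_coord τ).comp ((hY.smooth.fderiv_right (m := ∞) (by simp)).clm_apply contDiff_const)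

theorem coef_inv (hY : IsShear Y) (σ τ : Ix n) (s : ℝ) (z) : coef Y σ τ (z + s • Y z) = coef Y σ τ z := by
  simp [coef, hY.fderiv_inv]

theorem measurableEmbedding (hY : IsShear Y) (s : ℝ) : MeasurableEmbedding fun z => z + s • Y z :=
  (hY.homeo s).measurableEmbedding

theorem integral_comp (hY : IsShear Y) {G : Type*} [NormedAddCommGroup G] [NormedSpace ℝ G] (s : ℝ)
    (f : Phase n → G) : ∫ z, f (z + s • Y z) = ∫ z, f z :=
  (hY.mp s).integral_comp (hY.measurableEmbedding s) f

theorem contDiff_map (hY : IsShear Y) (s : ℝ) : ContDiff ℝ ∞ fun z => z + s • Y z :=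
  contDiff_id.add (hY.smooth.const_smul s)

theorem isTest_comp (hY : IsShear Y) (s : ℝ) {φ : Phase n → ℝ} (h : IsTest φ) :
    IsTest fun z => φ (z + s • Y z) :=
  ⟨h.1.comp (hY.contDiff_map s), h.2.comp_homeomorph (hY.homeo s)⟩

theorem isWD_comp (hY : IsShear Y) (s : ℝ) {F : Phase n → ℂ} {Fd : Ix n → Phase n → ℂ} (hF : MemLp F 2 volume)
    (hd : ∀ τ, MemLp (Fd τ) 2 volume) (h : ∀ τ, IsWD [τ] F (Fd τ)) (σ : Ix n) :
    IsWD [σ] (fun z => F (z + s • Y z)) (fun z => Fd σ (z + s • Y z) +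
      ∑ τ, (s * coef Y σ τ z) • Fd τ (z + s • Y z)) := by
  have hli : ∀ τ, LocallyIntegrable (fun z => Fd τ (z + s • Y z)) volume := fun τ =>
    memLp_locInt ((hd τ).comp_measurePreserving (hY.mp s))
  have hli2 : ∀ τ, LocallyIntegrable (fun z => (s * coef Y σ τ z) • Fd τ (z + s • Y z))
      volume := fun τ =>
    (hli τ).continuous_smul (continuous_const.mul (hY.contDiff_coef σ τ).continuous)
  rw [isWD_singleton_iff]
  refine ⟨memLp_locInt (hF.comp_measurePreserving (hY.mp s)), (hli σ).add
    (locallyIntegrable_finsetSum _ fun τ _ => hli2 τ), fun φ hφ => ?_⟩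
  set χ : Phase n → ℝ := fun z => φ (z + (-s) • Y z) with hχd
  have hχ : IsTest χ := hY.isTest_comp (-s) hφ
  have hφχ : ∀ z, φ z = χ (z + s • Y z) := fun z => by simp [hχd, hY.inv]
  have hder : ∀ z, fderiv ℝ φ z (dir n σ) = fderiv ℝ χ (z + s • Y z) (dir n σ) +
      ∑ τ, s * coef Y σ τ z * fderiv ℝ χ (z + s • Y z) (dir n τ) := by
    intro z
    have h1 : HasFDerivAt (fun z => z + s • Y z)
        (ContinuousLinearMap.id ℝ (Phase n) + s • fderiv ℝ Y z) z :=
      (hasFDerivAt_id z).add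
        ((hY.smooth.differentiable (by simp)).differentiableAt.hasFDerivAt.const_smul s)
    have h2 : HasFDerivAt χ (fderiv ℝ χ (z + s • Y z)) (z + s • Y z) :=
      (hχ.1.differentiable (by simp)).differentiableAt.hasFDerivAt
    have h3 : φ = χ ∘ fun z => z + s • Y z := funext hφχ
    have h4 : fderiv ℝ Y z (dir n σ) = ∑ τ, coef Y σ τ z • dir n τ :=
      (sum_coord_smul_dir _).symm
    rw [h3, (h2.comp z h1).fderiv]
    simp only [h4, ContinuousLinearMap.comp_apply, add_apply, smul_apply,
      ContinuousLinearMap.id_apply, map_add, map_smul, map_sum, smul_eq_mul, Finset.mul_sum,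
      mul_assoc]
  have hcomp : ∀ τ, IsTest fun z => s * coef Y σ τ z * χ z := fun τ =>
    hχ.mul_left (contDiff_const.mul (hY.contDiff_coef σ τ))
  have hcd : ∀ τ z, fderiv ℝ (fun z => s * coef Y σ τ z * χ z) z (dir n τ) =
      s * coef Y σ τ z * fderiv ℝ χ z (dir n τ) := by
    intro τ z
    have hc0 := ((hY.contDiff_coef σ τ).differentiable (by simp)).differentiableAt (x := z)
    rw [fderiv_fun_mul (hc0.const_mul s)
      (hχ.1.differentiable (by simp)).differentiableAt, fderiv_const_mul hc0]
    have := hY.div σ τ z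
    change fderiv ℝ (coef Y σ τ) z (dir n τ) = 0 at this
    simp [this]
  have hI1 : ∫ z, fderiv ℝ φ z (dir n σ) • F (z + s • Y z) =
      ∫ z, (fderiv ℝ χ z (dir n σ) • F z +
        ∑ τ, fderiv ℝ (fun z => s * coef Y σ τ z * χ z) z (dir n τ) • F z) := by
    rw [← hY.integral_comp s fun z => fderiv ℝ χ z (dir n σ) • F z +
      ∑ τ, fderiv ℝ (fun z => s * coef Y σ τ z * χ z) z (dir n τ) • F z]
    congr 1
    funext z
    rw [hder, add_smul, Finset.sum_smul]
    simp only [hcd, hY.coef_inv]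
  have hFl := memLp_locInt hF
  rw [hI1, integral_add ((hχ.fderiv_apply _).integrable_smul hFl)
    (integrable_finsetSum _ fun τ _ => ((hcomp τ).fderiv_apply _).integrable_smul hFl),
    integral_finsetSum _ fun τ _ => ((hcomp τ).fderiv_apply _).integrable_smul hFl,
    (isWD_singleton_iff.1 (h σ)).2.2 χ hχ]
  simp only [fun τ => (isWD_singleton_iff.1 (h τ)).2.2 _ (hcomp τ)]
  simp only [smul_add, Finset.smul_sum]
  rw [integral_add (hφ.integrable_smul (hli σ))
    (integrable_finsetSum _ fun τ _ => hφ.integrable_smul (hli2 τ)),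
    integral_finsetSum _ fun τ _ => hφ.integrable_smul (hli2 τ), neg_add,
    ← hY.integral_comp s fun z => χ z • Fd σ z, ← Finset.sum_neg_distrib]
  simp only [← hφχ]
  congr 1
  refine Finset.sum_congr rfl fun τ _ => ?_
  rw [← hY.integral_comp s fun z => (s * coef Y σ τ z * χ z) • Fd τ z]
  simp only [← hφχ, hY.coef_inv, smul_smul, mul_comm, mul_left_comm]

end IsShear

end Liouville

end

noncomputable section

namespace Liouville

/-! ### Sobolev norms -/

variable {n : ℕ}

theorem IsWeakDeriv.derivL2_eq {A B : Fin n → ℕ} {f g : Phase n → ℂ} (h : IsWeakDeriv A B f g) :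
    derivL2 A B f = eLpNorm g 2 volume := by
  refine le_antisymm (iInf₂_le g h) (le_iInf₂ fun g' h' => le_of_eq ?_)
  exact eLpNorm_congr_ae (WeakEq.ae_unique h h' (Filter.EventuallyEq.refl _ _))

theorem exists_isWeakDeriv {A B : Fin n → ℕ} {f : Phase n → ℂ} (h : derivL2 A B f < ⊤) :
    ∃ g, IsWeakDeriv A B f g ∧ MemLp g 2 volume := by
  unfold derivL2 at h
  simp only [iInf_lt_iff] at h
  obtain ⟨g, hg, hlt⟩ := h
  exact ⟨g, hg, hg.2.1.aestronglyMeasurable, hlt⟩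

/-- The functions `F w` are the weak derivatives of `f` along the words `w` of length at most `m`,
and they are square integrable. -/
def IsJet (m : ℕ) (f : Phase n → ℂ) (F : List (Ix n) → Phase n → ℂ) : Prop :=
  ∀ w, w.length ≤ m → IsWD w f (F w) ∧ MemLp (F w) 2 volume

theorem exists_isJet {m : ℕ} {f : Phase n → ℂ} (h : sobolevNorm m f < ⊤) :
    ∃ F, IsJet m f F := by
  have : ∀ w : List (Ix n), ∃ g, w.length ≤ m → IsWD w f g ∧ MemLp g 2 volume := by
    intro w
    by_cases hw : w.length ≤ m
    · obtain ⟨g, hg, hg'⟩ := exists_isWeakDeriv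
        (ENNReal.sum_lt_top.1 h (cnt w) (cnt_mem_multiIdx.2 hw))
      exact ⟨g, fun _ => ⟨(isWeakDeriv_cnt w f g).1 hg, hg'⟩⟩
    · exact ⟨0, fun h => absurd h hw⟩
  choose F hF using this
  exact ⟨F, hF⟩

theorem length_canon₂_le {m : ℕ} {p : (Fin n → ℕ) × (Fin n → ℕ)} (hp : p ∈ multiIdx n m) :
    (canon₂ p.1 p.2).length ≤ m := by
  rw [length_canon₂]
  exact (mem_multiIdx p).1 hp

theorem sobolevNorm_le_sum {m : ℕ} {f : Phase n → ℂ} {F : List (Ix n) → Phase n → ℂ}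
    (h : ∀ w, w.length ≤ m → IsWD w f (F w)) :
    sobolevNorm m f ≤ ∑ p ∈ multiIdx n m, eLpNorm (F (canon₂ p.1 p.2)) 2 volume :=
  Finset.sum_le_sum fun p hp =>
    (((isWeakDeriv_iff_isWD p.1 p.2 f _).2 (h _ (length_canon₂_le hp))).derivL2_eq).le

namespace IsJet

variable {m : ℕ} {f : Phase n → ℂ} {F : List (Ix n) → Phase n → ℂ}

theorem sobolevNorm_eq (h : IsJet m f F) :
    sobolevNorm m f = ∑ p ∈ multiIdx n m, eLpNorm (F (canon₂ p.1 p.2)) 2 volume :=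
  Finset.sum_congr rfl fun p hp =>
    ((isWeakDeriv_iff_isWD p.1 p.2 f _).2 (h _ (length_canon₂_le hp)).1).derivL2_eq

theorem sobolevNorm_lt_top (h : IsJet m f F) : sobolevNorm m f < ⊤ := by
  rw [h.sobolevNorm_eq]
  exact ENNReal.sum_lt_top.2 fun p hp => (h _ (length_canon₂_le hp)).2.eLpNorm_lt_top

theorem eLpNorm_le (h : IsJet m f F) {w : List (Ix n)} (hw : w.length ≤ m) :
    eLpNorm (F w) 2 volume ≤ sobolevNorm m f := by
  rw [← ((isWeakDeriv_cnt w f (F w)).2 (h w hw).1).derivL2_eq]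
  exact Finset.single_le_sum (f := fun p : (Fin n → ℕ) × (Fin n → ℕ) => derivL2 p.1 p.2 f)
    (fun _ _ => zero_le) (cnt_mem_multiIdx.2 hw)

theorem isWD_cons (h : IsJet m f F) {w : List (Ix n)} (hw : w.length < m) (σ : Ix n) :
    IsWD [σ] (F w) (F (σ :: w)) :=
  (h w hw.le).1.of_cons (h (σ :: w) hw).1

theorem ae_eq (h : IsJet m f F) : f =ᵐ[volume] F [] :=
  WeakEq.ae_unique (isWD_nil (h [] (Nat.zero_le _)).1.1) (h [] (Nat.zero_le _)).1
    (Filter.EventuallyEq.refl _ _)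

theorem memLp (h : IsJet m f F) : MemLp f 2 volume :=
  (h [] (Nat.zero_le _)).2.ae_eq h.ae_eq.symm

theorem add (h : IsJet m f F) {f' : Phase n → ℂ} {F' : List (Ix n) → Phase n → ℂ}
    (h' : IsJet m f' F') : IsJet m (fun z => f z + f' z) (fun w z => F w z + F' w z) :=
  fun w hw => ⟨(h w hw).1.add (h' w hw).1, (h w hw).2.add (h' w hw).2⟩

theorem smul (h : IsJet m f F) (c : ℝ) : IsJet m (fun z => c • f z) (fun w z => c • F w z) :=
  fun w hw => ⟨(h w hw).1.smul c, (h w hw).2.const_smul c⟩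

/-- The derivative along `v` has a jet of lower order. -/
theorem tail (h : IsJet m f F) {m' : ℕ} {v : List (Ix n)} (hv : m' + v.length ≤ m) :
    IsJet m' (F v) (fun w => F (w ++ v)) := by
  intro w
  induction w with
  | nil => exact fun _ => ⟨isWD_nil (h v (by omega)).1.2.1, (h v (by omega)).2⟩
  | cons σ w ih =>
    intro hw
    simp only [List.length_cons] at hw
    refine ⟨(ih (by omega)).1.cons (h.isWD_cons (by simp; omega) σ), ?_⟩
    exact (h (σ :: w ++ v) (by simp; omega)).2

end IsJet

theorem sobolevNorm_congr {m : ℕ} {f g : Phase n → ℂ} (h : f =ᵐ[volume] g) :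
    sobolevNorm m f = sobolevNorm m g := by
  unfold sobolevNorm derivL2
  have : ∀ A B (u : Phase n → ℂ), IsWeakDeriv A B f u ↔ IsWeakDeriv A B g u := fun A B u =>
    ⟨fun hu => WeakEq.congr hu h (Filter.EventuallyEq.refl _ _),
      fun hu => WeakEq.congr hu h.symm (Filter.EventuallyEq.refl _ _)⟩
  simp only [this]

theorem memLp_of_sobolevNorm_lt_top {m : ℕ} {f : Phase n → ℂ} (h : sobolevNorm m f < ⊤) :
    MemLp f 2 volume := by
  obtain ⟨F, hF⟩ := exists_isJet h
  exact hF.memLp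

theorem sobolevNorm_add_le (m : ℕ) (f g : Phase n → ℂ) :
    sobolevNorm m (fun z => f z + g z) ≤ sobolevNorm m f + sobolevNorm m g := by
  rcases eq_or_ne (sobolevNorm m f) ⊤ with hf | hf
  · simp [hf]
  rcases eq_or_ne (sobolevNorm m g) ⊤ with hg | hg
  · simp [hg]
  obtain ⟨F, hF⟩ := exists_isJet hf.lt_top
  obtain ⟨G, hG⟩ := exists_isJet hg.lt_top
  rw [(hF.add hG).sobolevNorm_eq, hF.sobolevNorm_eq, hG.sobolevNorm_eq, ← Finset.sum_add_distrib]
  refine Finset.sum_le_sum fun p hp => ?_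
  have hp := length_canon₂_le hp
  exact eLpNorm_add_le (hF _ hp).2.1 (hG _ hp).2.1 (by norm_num)

theorem sobolevNorm_smul_le (m : ℕ) (c : ℝ) (f : Phase n → ℂ) (hf : sobolevNorm m f < ⊤) :
    sobolevNorm m (fun z => c • f z) ≤ ENNReal.ofReal |c| * sobolevNorm m f := by
  obtain ⟨F, hF⟩ := exists_isJet hf
  rw [(hF.smul c).sobolevNorm_eq, hF.sobolevNorm_eq, Finset.mul_sum]
  refine Finset.sum_le_sum fun p hp => ?_
  refine (eLpNorm_const_smul_le (c := c) (f := F (canon₂ p.1 p.2))).trans ?_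
  rw [← Real.norm_eq_abs, ofReal_norm]

theorem sobolevNorm_sum_le {κ : Type*} (m : ℕ) (s : Finset κ) (f : κ → Phase n → ℂ) :
    sobolevNorm m (fun z => ∑ i ∈ s, f i z) ≤ ∑ i ∈ s, sobolevNorm m (f i) := by
  classical
  induction s using Finset.induction_on with
  | empty =>
    have h0 : IsJet m (fun _ : Phase n => (0 : ℂ)) fun _ _ => 0 :=
      fun w _ => ⟨isWD_zero w, MemLp.zero⟩
    simp [h0.sobolevNorm_eq]
  | insert a s ha ih =>
    simp only [Finset.sum_insert ha]
    exact (sobolevNorm_add_le _ _ _).trans (add_le_add le_rfl ih)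

/-! ### Uniformly bounded families of coefficients -/

section Coefficients

variable {κ : Type*}

/-- The functions `c i` are smooth, and bounded together with their derivatives of order up to
`j`, uniformly in `i`. -/
def UnifBdd : ℕ → (κ → Phase n → ℝ) → Prop
  | 0, c => (∀ i, ContDiff ℝ ∞ (c i)) ∧ ∃ M, ∀ i z, |c i z| ≤ M
  | j + 1, c => ((∀ i, ContDiff ℝ ∞ (c i)) ∧ ∃ M, ∀ i z, |c i z| ≤ M) ∧
      ∀ σ, UnifBdd j fun i z => fderiv ℝ (c i) z (dir n σ)

theorem UnifBdd.zero {j : ℕ} {c : κ → Phase n → ℝ} (h : UnifBdd j c) : UnifBdd 0 c := by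
  cases j with
  | zero => exact h
  | succ j => exact h.1

theorem UnifBdd.of_succ {j : ℕ} {c : κ → Phase n → ℝ} (h : UnifBdd (j + 1) c) :
    UnifBdd j c := by
  induction j generalizing c with
  | zero => exact h.1
  | succ j ih => exact ⟨h.1, fun σ => ih (h.2 σ)⟩

theorem UnifBdd.add {j : ℕ} {c d : κ → Phase n → ℝ} (hc : UnifBdd j c) (hd : UnifBdd j d) :
    UnifBdd j fun i z => c i z + d i z := by
  have h0 : ∀ {c d : κ → Phase n → ℝ}, UnifBdd 0 c → UnifBdd 0 d →
      UnifBdd 0 fun i z => c i z + d i z := by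
    rintro c d ⟨hc, M, hM⟩ ⟨hd, M', hM'⟩
    exact ⟨fun i => (hc i).add (hd i), M + M', fun i z =>
      (abs_add_le _ _).trans (add_le_add (hM i z) (hM' i z))⟩
  induction j generalizing c d with
  | zero => exact h0 hc hd
  | succ j ih =>
    refine ⟨h0 hc.zero hd.zero, fun σ => ?_⟩
    have := ih (hc.2 σ) (hd.2 σ)
    convert this using 3 with i z
    rw [fderiv_fun_add ((hc.zero.1 i).differentiable (by simp)).differentiableAt
      ((hd.zero.1 i).differentiable (by simp)).differentiableAt]
    rfl

theorem UnifBdd.mul {j : ℕ} {c d : κ → Phase n → ℝ} (hc : UnifBdd j c) (hd : UnifBdd j d) :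
    UnifBdd j fun i z => c i z * d i z := by
  have h0 : ∀ {c d : κ → Phase n → ℝ}, UnifBdd 0 c → UnifBdd 0 d →
      UnifBdd 0 fun i z => c i z * d i z := by
    rintro c d ⟨hc, M, hM⟩ ⟨hd, M', hM'⟩
    refine ⟨fun i => (hc i).mul (hd i), |M| * |M'|, fun i z => ?_⟩
    rw [abs_mul]
    exact mul_le_mul ((hM i z).trans (le_abs_self _)) ((hM' i z).trans (le_abs_self _))
      (abs_nonneg _) (abs_nonneg _)
  induction j generalizing c d with
  | zero => exact h0 hc hd
  | succ j ih =>
    refine ⟨h0 hc.zero hd.zero, fun σ => ?_⟩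
    have := UnifBdd.add (ih hc.of_succ (hd.2 σ)) (ih hd.of_succ (hc.2 σ))
    convert this using 3 with i z
    rw [fderiv_fun_mul ((hc.zero.1 i).differentiable (by simp)).differentiableAt
        ((hd.zero.1 i).differentiable (by simp)).differentiableAt]
    simp

theorem UnifBdd.const (j : ℕ) {s : κ → ℝ} {M : ℝ} (h : ∀ i, |s i| ≤ M) :
    UnifBdd j fun i (_ : Phase n) => s i := by
  induction j generalizing s M with
  | zero => exact ⟨fun i => contDiff_const, M, fun i _ => h i⟩
  | succ j ih =>
    refine ⟨⟨fun i => contDiff_const, M, fun i _ => h i⟩, fun σ => ?_⟩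
    simpa using ih (s := fun _ => 0) (M := 0) (by simp)

/-- The value of a linear differential expression, given as a list of words and coefficients, at
the jet `F` composed with the map `K`. -/
def diffExpr (l : List (List (Ix n) × (κ → Phase n → ℝ))) (i : κ)
    (F : List (Ix n) → Phase n → ℂ) (K : Phase n → Phase n) (z : Phase n) : ℂ :=
  (l.map fun p => p.2 i z • F p.1 (K z)).sum

theorem eLpNorm_smul_le_of_bdd {c : Phase n → ℝ} {M : ℝ} (hc : ∀ z, |c z| ≤ M)
    {f : Phase n → ℂ} :
    eLpNorm (fun z => c z • f z) 2 volume ≤ ENNReal.ofReal M * eLpNorm f 2 volume := by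
  refine eLpNorm_le_mul_eLpNorm_of_ae_le_mul (Filter.Eventually.of_forall fun z => ?_) 2
  rw [norm_smul, Real.norm_eq_abs]
  exact mul_le_mul_of_nonneg_right (hc z) (norm_nonneg _)

end Coefficients

end Liouville

end

noncomputable section

namespace Liouville

variable {n : ℕ} {κ : Type*}

/-! ### Composition with shears -/

theorem isWD_list_sum {α : Type*} {w : List (Ix n)} (l : List α) {f g : α → Phase n → ℂ}
    (h : ∀ a ∈ l, IsWD w (f a) (g a)) :
    IsWD w (fun z => (l.map fun a => f a z).sum) (fun z => (l.map fun a => g a z).sum) := by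
  induction l with
  | nil => simpa using isWD_zero w
  | cons a l ih =>
    simp only [List.map_cons, List.sum_cons]
    exact (h a (by simp)).add (ih fun b hb => h b (by simp [hb]))

theorem exists_eLpNorm_diffExpr_le {m : ℕ} (l : List (List (Ix n) × (κ → Phase n → ℝ)))
    (hl : ∀ p ∈ l, p.1.length ≤ m ∧ UnifBdd 0 p.2) :
    ∃ C : ℝ, 0 ≤ C ∧ ∀ (i : κ) (f : Phase n → ℂ) (F : List (Ix n) → Phase n → ℂ)
      (K : Phase n → Phase n), IsJet m f F → MeasurePreserving K volume volume →
      MemLp (diffExpr l i F K) 2 volume ∧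
      eLpNorm (diffExpr l i F K) 2 volume ≤ ENNReal.ofReal C * sobolevNorm m f := by
  induction l with
  | nil =>
    refine ⟨0, le_rfl, fun i f F K _ _ => ?_⟩
    have : diffExpr ([] : List (List (Ix n) × (κ → Phase n → ℝ))) i F K = fun _ => 0 := by
      funext z; simp [diffExpr]
    rw [this]
    exact ⟨MemLp.zero, by simp⟩
  | cons p l ih =>
    obtain ⟨C, hC0, hC⟩ := ih fun q hq => hl q (by simp [hq])
    obtain ⟨hp, hc, M, hM⟩ := hl p (by simp)
    refine ⟨|M| + C, by positivity, fun i f F K hF hK => ?_⟩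
    obtain ⟨h1, h2⟩ := hC i f F K hF hK
    have hFK : MemLp (fun z => F p.1 (K z)) 2 volume :=
      (hF p.1 hp).2.comp_measurePreserving hK
    have hb : ∀ z, |p.2 i z| ≤ |M| := fun z => (hM i z).trans (le_abs_self M)
    have hle := eLpNorm_smul_le_of_bdd (c := p.2 i) (f := fun z => F p.1 (K z)) hb
    have hmem : MemLp (fun z => p.2 i z • F p.1 (K z)) 2 volume :=
      ⟨((hc i).continuous.aestronglyMeasurable).smul hFK.1,
        hle.trans_lt (ENNReal.mul_lt_top ENNReal.ofReal_lt_top hFK.eLpNorm_lt_top)⟩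
    have he : diffExpr (p :: l) i F K =
        fun z => p.2 i z • F p.1 (K z) + diffExpr l i F K z := by
      funext z; simp [diffExpr]
    rw [he]
    refine ⟨hmem.add h1, (eLpNorm_add_le hmem.1 h1.1 (by norm_num)).trans ?_⟩
    rw [ENNReal.ofReal_add (abs_nonneg _) hC0, add_mul]
    refine add_le_add (hle.trans ?_) h2
    gcongr
    have : eLpNorm (fun z => F p.1 (K z)) 2 volume = eLpNorm (F p.1) 2 volume :=
      eLpNorm_comp_measurePreserving (hF p.1 hp).2.1 hK
    rw [this]
    exact hF.eLpNorm_le hp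

theorem diffExpr_append (l l' : List (List (Ix n) × (κ → Phase n → ℝ))) (i : κ)
    (F : List (Ix n) → Phase n → ℂ) (K : Phase n → Phase n) (z : Phase n) :
    diffExpr (l ++ l') i F K z = diffExpr l i F K z + diffExpr l' i F K z := by
  simp [diffExpr]

theorem diffExpr_flatMap {α : Type*} (l : List α)
    (e : α → List (List (Ix n) × (κ → Phase n → ℝ))) (i : κ)
    (F : List (Ix n) → Phase n → ℂ) (K : Phase n → Phase n) (z : Phase n) :
    diffExpr (l.flatMap e) i F K z = (l.map fun a => diffExpr (e a) i F K z).sum := by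
  induction l with
  | nil => simp [diffExpr]
  | cons a l ih => rw [List.flatMap_cons, diffExpr_append, ih, List.map_cons, List.sum_cons]

/-- The formal derivative in the direction `σ` of a summand of a differential expression composed
with a shear. -/
def formalDeriv (Y : κ → Phase n → Phase n) (s : κ → ℝ) (σ : Ix n)
    (p : List (Ix n) × (κ → Phase n → ℝ)) : List (List (Ix n) × (κ → Phase n → ℝ)) :=
  (p.1, fun i z => fderiv ℝ (p.2 i) z (dir n σ)) :: (σ :: p.1, p.2) ::
    (Finset.univ.toList.map fun τ => (τ :: p.1, fun i z => p.2 i z * (s i * coef (Y i) σ τ z)))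

theorem isWD_formalDeriv {m : ℕ} {Y : κ → Phase n → Phase n} {s : κ → ℝ}
    (hY : ∀ i, IsShear (Y i)) (σ : Ix n) (p : List (Ix n) × (κ → Phase n → ℝ))
    (hp : p.1.length < m) (hc : ∀ i, ContDiff ℝ ∞ (p.2 i)) (i : κ) {f : Phase n → ℂ}
    {F : List (Ix n) → Phase n → ℂ} (hF : IsJet m f F) :
    IsWD [σ] (fun z => p.2 i z • F p.1 (z + s i • Y i z))
      (diffExpr (formalDeriv Y s σ p) i F fun z => z + s i • Y i z) := by
  have h1 := (hY i).isWD_comp (s i) (hF p.1 hp.le).2 (fun τ => (hF (τ :: p.1) hp).2)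
    (fun τ => hF.isWD_cons hp τ) σ
  have h2 := h1.mul (hc i)
  convert h2 using 1
  funext z
  simp only [diffExpr, formalDeriv, List.map_cons, List.map_map, List.sum_cons]
  congr 1
  rw [smul_add, Finset.smul_sum, ← Finset.sum_map_toList]
  simp only [Function.comp_def, smul_smul]

theorem exists_isWD_comp (m : ℕ) {Y : κ → Phase n → Phase n} {s : κ → ℝ}
    (hY : ∀ i, IsShear (Y i)) (hs : ∀ i, |s i| ≤ 1)
    (hc : ∀ j < m, ∀ σ τ, UnifBdd j fun i => coef (Y i) σ τ) (w : List (Ix n))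
    (hw : w.length ≤ m) :
    ∃ l : List (List (Ix n) × (κ → Phase n → ℝ)),
      (∀ p ∈ l, p.1.length ≤ w.length ∧ UnifBdd (m - w.length) p.2) ∧
      ∀ (i : κ) (f : Phase n → ℂ) (F : List (Ix n) → Phase n → ℂ), IsJet m f F →
        IsWD w (fun z => f (z + s i • Y i z)) fun z => F w (z + s i • Y i z) +
          s i • diffExpr l i F (fun z => z + s i • Y i z) z := by
  induction w with
  | nil =>
    refine ⟨[], by simp, fun i f F hF => ?_⟩
    have h1 : LocallyIntegrable (fun z => f (z + s i • Y i z)) volume :=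
      memLp_locInt (hF.memLp.comp_measurePreserving ((hY i).mp (s i)))
    refine (isWD_nil h1).congr (Filter.EventuallyEq.refl _ _) ?_
    have := ((hY i).mp (s i)).quasiMeasurePreserving.ae_eq_comp hF.ae_eq
    simpa [diffExpr, Function.comp_def] using this
  | cons σ w ih =>
    simp only [List.length_cons] at hw
    obtain ⟨l, hl, hl'⟩ := ih (by omega)
    have hj : m - w.length = (m - (w.length + 1)) + 1 := by omega
    have hcj := hc (m - (w.length + 1)) (by omega) σ
    refine ⟨(Finset.univ.toList.map fun τ => (τ :: w, fun i => coef (Y i) σ τ)) ++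
      l.flatMap (formalDeriv Y s σ), ?_, fun i f F hF => ?_⟩
    · intro p hp
      simp only [List.mem_append, List.mem_map, List.mem_flatMap] at hp
      rcases hp with ⟨τ, _, rfl⟩ | ⟨q, hq, hp⟩
      · exact ⟨by simp, hcj τ⟩
      · obtain ⟨hq1, hq2⟩ := hl q hq
        rw [hj] at hq2
        simp only [formalDeriv, List.mem_cons, List.mem_map] at hp
        rcases hp with rfl | rfl | ⟨τ, _, rfl⟩
        · exact ⟨by simp; omega, hq2.2 σ⟩
        · exact ⟨by simp; omega, hq2.of_succ⟩
        · exact ⟨by simp; omega, hq2.of_succ.mul ((UnifBdd.const _ hs).mul (hcj τ))⟩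
    · refine (hl' i f F hF).cons ?_
      have h1 := (hY i).isWD_comp (s i) (hF w (by omega)).2
        (fun τ => (hF (τ :: w) (by simpa using hw)).2) (fun τ => hF.isWD_cons (by omega) τ) σ
      have h2 := isWD_list_sum (w := [σ]) l
        (f := fun p z => p.2 i z • F p.1 (z + s i • Y i z))
        (g := fun p => diffExpr (formalDeriv Y s σ p) i F fun z => z + s i • Y i z)
        fun p hp => isWD_formalDeriv hY σ p (by have := (hl p hp).1; omega)
          (hl p hp).2.zero.1 i hF
      have h3 := h1.add (h2.smul (s i))
      refine h3.congr (Filter.EventuallyEq.refl _ _) (Filter.Eventually.of_forall fun z => ?_)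
      beta_reduce
      rw [diffExpr_append, diffExpr_flatMap, smul_add, ← add_assoc]
      congr 2
      rw [diffExpr, List.map_map]
      simp only [Function.comp_def]
      rw [Finset.sum_map_toList, Finset.smul_sum]
      simp only [smul_smul]

/-- Shears change Sobolev norms by a factor `1 + O(s)`. -/
theorem exists_sobolevNorm_comp_shear_le (m : ℕ) {Y : κ → Phase n → Phase n} {s : κ → ℝ}
    (hY : ∀ i, IsShear (Y i)) (hs : ∀ i, |s i| ≤ 1)
    (hc : ∀ j < m, ∀ σ τ, UnifBdd j fun i => coef (Y i) σ τ) :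
    ∃ C : ℝ, 0 ≤ C ∧ ∀ (i : κ) (f : Phase n → ℂ),
      sobolevNorm m (fun z => f (z + s i • Y i z)) ≤
        ENNReal.ofReal (1 + |s i| * C) * sobolevNorm m f := by
  have key : ∀ p ∈ multiIdx n m, ∃ C : ℝ, 0 ≤ C ∧ ∀ (i : κ) (f : Phase n → ℂ)
      (F : List (Ix n) → Phase n → ℂ), IsJet m f F →
      derivL2 p.1 p.2 (fun z => f (z + s i • Y i z)) ≤ eLpNorm (F (canon₂ p.1 p.2)) 2 volume +
        ENNReal.ofReal (|s i| * C) * sobolevNorm m f := by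
    intro p hp
    have hlen := length_canon₂_le hp
    obtain ⟨l, hl, h⟩ := exists_isWD_comp m hY hs hc (canon₂ p.1 p.2) hlen
    obtain ⟨C, hC0, hC⟩ := exists_eLpNorm_diffExpr_le (m := m) l
      fun q hq => ⟨(hl q hq).1.trans hlen, (hl q hq).2.zero⟩
    refine ⟨C, hC0, fun i f F hF => ?_⟩
    obtain ⟨h1, h2⟩ := hC i f F _ hF ((hY i).mp (s i))
    have hmp := (hY i).mp (s i)
    refine (iInf₂_le _ ((isWeakDeriv_iff_isWD _ _ _ _).2 (h i f F hF))).trans ?_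
    refine (eLpNorm_add_le ((hF _ hlen).2.comp_measurePreserving hmp).1
      (h1.const_smul (s i)).1 (by norm_num)).trans ?_
    refine add_le_add ?_ ?_
    · exact (eLpNorm_comp_measurePreserving (hF _ hlen).2.1 hmp).le
    · refine (eLpNorm_const_smul_le (c := s i) (f := diffExpr l i F _)).trans ?_
      rw [ENNReal.ofReal_mul (abs_nonneg _), mul_assoc, ← Real.norm_eq_abs, ofReal_norm]
      gcongr
  choose! C hC0 hC using key
  refine ⟨∑ p ∈ multiIdx n m, C p, Finset.sum_nonneg hC0, fun i f => ?_⟩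
  have hpos : 0 ≤ |s i| * ∑ p ∈ multiIdx n m, C p :=
    mul_nonneg (abs_nonneg _) (Finset.sum_nonneg hC0)
  rcases eq_or_ne (sobolevNorm m f) ⊤ with hf | hf
  · rw [hf, ENNReal.mul_top]
    · exact le_top
    · simp only [ne_eq, ENNReal.ofReal_eq_zero, not_le]
      linarith
  obtain ⟨F, hF⟩ := exists_isJet hf.lt_top
  refine (Finset.sum_le_sum fun p hp => hC p hp i f F hF).trans ?_
  rw [Finset.sum_add_distrib, ← hF.sobolevNorm_eq, ENNReal.ofReal_add zero_le_one hpos, add_mul,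
    ENNReal.ofReal_one, one_mul, Finset.mul_sum, ENNReal.ofReal_sum_of_nonneg
      fun p hp => mul_nonneg (abs_nonneg _) (hC0 p hp), Finset.sum_mul]

/-! ### Weak limits -/

open Filter Topology

theorem exists_weak_limit {H : Type*} [NormedAddCommGroup H] [InnerProductSpace ℂ H]
    [CompleteSpace H] (U : Ultrafilter ℕ) (x : ℕ → H) (B : ℝ) (hB : ∀ N, ‖x N‖ ≤ B) :
    ∃ (y : H) (r : ℝ), Tendsto (fun N => ‖x N‖) U (𝓝 r) ∧ ‖y‖ ≤ r ∧
      ∀ f, Tendsto (fun N => inner ℂ f (x N)) U (𝓝 (inner ℂ f y)) := by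
  have hr : ∃ r ∈ Metric.closedBall (0 : ℝ) B, Tendsto (fun N => ‖x N‖) U (𝓝 r) := by
    have := (isCompact_closedBall (0 : ℝ) B).ultrafilter_le_nhds (U.map fun N => ‖x N‖)
      (by
        refine le_principal_iff.2 (Ultrafilter.mem_coe.2 (Ultrafilter.mem_map.2 ?_))
        exact Filter.univ_mem' fun N => by simpa using hB N)
    simpa [Tendsto] using this
  obtain ⟨r, _, hr⟩ := hr
  have hl : ∀ f : H, ∃ a : ℂ, Tendsto (fun N => inner ℂ (x N) f) U (𝓝 a) := by
    intro f
    obtain ⟨a, _, ha⟩ := (isCompact_closedBall (0 : ℂ) (B * ‖f‖)).ultrafilter_le_nhds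
      (U.map fun N => inner ℂ (x N) f)
      (by
        refine le_principal_iff.2 (Ultrafilter.mem_coe.2 (Ultrafilter.mem_map.2 ?_))
        refine Filter.univ_mem' fun N => ?_
        simp only [Set.mem_preimage, mem_closedBall_zero_iff]
        exact (norm_inner_le_norm _ _).trans
          (mul_le_mul_of_nonneg_right (hB N) (norm_nonneg f)))
    exact ⟨a, ha⟩
  choose ℓ hℓ using hl
  let L : H →ₗ[ℂ] ℂ :=
    { toFun := ℓ
      map_add' := fun f g => by
        refine tendsto_nhds_unique (hℓ (f + g)) ?_
        simpa only [inner_add_right] using (hℓ f).add (hℓ g)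
      map_smul' := fun c f => by
        refine tendsto_nhds_unique (hℓ (c • f)) ?_
        simpa only [inner_smul_right, smul_eq_mul, RingHom.id_apply] using (hℓ f).const_mul c }
  have hL : ∀ f, ‖L f‖ ≤ r * ‖f‖ := fun f =>
    le_of_tendsto_of_tendsto (hℓ f).norm (hr.mul_const ‖f‖)
      (Eventually.of_forall fun N => norm_inner_le_norm _ _)
  have hr0 : 0 ≤ r := ge_of_tendsto hr (Eventually.of_forall fun N => norm_nonneg _)
  let Lc : H →L[ℂ] ℂ := L.mkContinuous r hL
  refine ⟨(InnerProductSpace.toDual ℂ H).symm Lc, r, hr, ?_, fun f => ?_⟩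
  · rw [LinearIsometryEquiv.norm_map]
    exact L.mkContinuous_norm_le hr0 hL
  · have h1 : inner ℂ ((InnerProductSpace.toDual ℂ H).symm Lc) f = ℓ f := by
      rw [InnerProductSpace.toDual_symm_apply]
      rfl
    have h2 := (Complex.continuous_conj.tendsto _).comp (hℓ f)
    rw [← h1] at h2
    simpa only [Function.comp_def, inner_conj_symm] using h2

theorem IsTest.memLp {φ : Phase n → ℝ} (h : IsTest φ) :
    MemLp (fun z => (φ z : ℂ)) 2 volume :=
  (Complex.continuous_ofReal.comp h.continuous).memLp_of_hasCompactSupport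
    (h.2.comp_left (g := fun x : ℝ => (x : ℂ)) (by simp))

theorem inner_test {φ : Phase n → ℝ} (h : IsTest φ) (g : Lp ℂ 2 (volume : Measure (Phase n))) :
    inner ℂ h.memLp.toLp g = ∫ z, φ z • g z := by
  rw [L2.inner_def]
  refine integral_congr_ae ?_
  filter_upwards [h.memLp.coeFn_toLp] with z hz
  rw [hz]
  simp [mul_comm]

/-- Sobolev norms are lower semicontinuous under weak convergence. -/
theorem sobolevNorm_le_of_tendsto {m : ℕ} {v : Phase n → ℂ} (hv : LocallyIntegrable v volume)
    {vN : ℕ → Phase n → ℂ} {B : ℝ≥0∞} (hB : ∀ N, sobolevNorm m (vN N) ≤ B)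
    (hlim : ∀ φ : Phase n → ℝ, IsTest φ →
      Tendsto (fun N => ∫ z, φ z • vN N z) atTop (𝓝 (∫ z, φ z • v z))) :
    sobolevNorm m v ≤ B := by
  rcases eq_or_ne B ⊤ with rfl | hBt
  · exact le_top
  have hfin : ∀ N, sobolevNorm m (vN N) < ⊤ := fun N => (hB N).trans_lt hBt.lt_top
  choose F hF using fun N => exists_isJet (hfin N)
  let U : Ultrafilter ℕ := hyperfilter ℕ
  have hU : (U : Filter ℕ) ≤ atTop := by
    rw [← Nat.cofinite_eq_atTop]
    exact hyperfilter_le_cofinite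
  have key : ∀ w : List (Ix n), ∃ (g : Lp ℂ 2 (volume : Measure (Phase n))) (r : ℝ),
      w.length ≤ m → IsWD w v g ∧ ‖g‖ ≤ r ∧
        Tendsto (fun N => (eLpNorm (F N w) 2 volume).toReal) U (𝓝 r) := by
    intro w
    by_cases hw : w.length ≤ m
    swap
    · exact ⟨0, 0, fun h => absurd h hw⟩
    obtain ⟨g, r, h1, h2, h3⟩ := exists_weak_limit U (fun N => (hF N w hw).2.toLp) B.toReal
      fun N => by
        rw [Lp.norm_toLp]
        exact ENNReal.toReal_mono hBt (((hF N).eLpNorm_le hw).trans (hB N))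
    simp only [Lp.norm_toLp] at h1
    refine ⟨g, r, fun _ => ⟨⟨hv, memLp_locInt (Lp.memLp g), fun φ hφ => ?_⟩, h2, h1⟩⟩
    have h4 := h3 hφ.memLp.toLp
    rw [inner_test hφ] at h4
    refine tendsto_nhds_unique ((hlim _ (isTest_wd w hφ)).mono_left hU) (h4.congr fun N => ?_)
    rw [inner_test hφ, (hF N w hw).1.2.2 φ hφ]
    refine integral_congr_ae ?_
    filter_upwards [(hF N w hw).2.coeFn_toLp] with z hz
    rw [hz]
  choose g r hg using key
  refine (sobolevNorm_le_sum (F := fun w => g w) fun w hw => (hg w hw).1).trans ?_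
  have hsum : ∑ p ∈ multiIdx n m, r (canon₂ p.1 p.2) ≤ B.toReal := by
    have ht : Tendsto (fun N => ∑ p ∈ multiIdx n m,
        (eLpNorm (F N (canon₂ p.1 p.2)) 2 volume).toReal) U
        (𝓝 (∑ p ∈ multiIdx n m, r (canon₂ p.1 p.2))) :=
      tendsto_finsetSum _ fun p hp => (hg _ (length_canon₂_le hp)).2.2
    refine le_of_tendsto ht (Eventually.of_forall fun N => ?_)
    rw [← ENNReal.toReal_sum fun p hp => ((hF N) _ (length_canon₂_le hp)).2.eLpNorm_ne_top,
      ← (hF N).sobolevNorm_eq]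
    exact ENNReal.toReal_mono hBt (hB N)
  calc ∑ p ∈ multiIdx n m, eLpNorm (g (canon₂ p.1 p.2)) 2 volume
      ≤ ∑ p ∈ multiIdx n m, ENNReal.ofReal (r (canon₂ p.1 p.2)) := by
        refine Finset.sum_le_sum fun p hp => ?_
        rw [← ENNReal.ofReal_toReal (Lp.memLp (g (canon₂ p.1 p.2))).eLpNorm_ne_top]
        exact ENNReal.ofReal_le_ofReal (hg _ (length_canon₂_le hp)).2.1
    _ = ENNReal.ofReal (∑ p ∈ multiIdx n m, r (canon₂ p.1 p.2)) :=
        (ENNReal.ofReal_sum_of_nonneg fun p hp =>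
          (norm_nonneg _).trans (hg _ (length_canon₂_le hp)).2.1).symm
    _ ≤ B := ENNReal.ofReal_le_of_le_toReal hsum

end Liouville

end

noncomputable section

namespace Liouville

open Filter Topology

/-! ### Mollification -/

section Mollification

variable {F : Type*} [NormedAddCommGroup F] [NormedSpace ℝ F] [MeasureSpace F]

/-- The mollification of `G` with the kernel `η`. -/
def moll (η G : F → ℝ) (z : F) : ℝ := ∫ y, η (z - y) * G y

/-- `η` is a smooth probability density supported in the ball of radius `ε`. -/
structure IsMollifier (η : F → ℝ) (ε : ℝ) : Prop where
  test : IsTest η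
  nonneg : ∀ y, 0 ≤ η y
  integral_eq : ∫ y, η y = 1
  supp : ∀ y, η y ≠ 0 → ‖y‖ ≤ ε

set_option linter.unusedSectionVars false

variable [BorelSpace F] [FiniteDimensional ℝ F] [(volume : Measure F).IsAddHaarMeasure]

theorem exists_isMollifier {ε : ℝ} (hε : 0 < ε) : ∃ η : F → ℝ, IsMollifier η ε := by
  let b : ContDiffBump (0 : F) := ⟨ε / 2, ε, by positivity, by linarith⟩
  refine ⟨b.normed volume, ⟨b.contDiff_normed, b.hasCompactSupport_normed⟩,
    b.nonneg_normed, b.integral_normed, fun y hy => ?_⟩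
  have h1 : y ∈ Function.support (b.normed volume) := hy
  rw [b.support_normed_eq] at h1
  exact (mem_ball_zero_iff.1 h1).le

theorem moll_eq_convolution (η G : F → ℝ) :
    moll η G = convolution G η (ContinuousLinearMap.mul ℝ ℝ) volume := by
  funext z
  simp [moll, convolution_def, mul_comm]

theorem moll_eq (η G : F → ℝ) (z : F) : moll η G z = ∫ y, η y * G (z - y) := by
  unfold moll
  rw [← integral_sub_left_eq_self (fun y => η (z - y) * G y) volume z]
  simp

theorem contDiff_moll {η G : F → ℝ} (hη : IsTest η) (hG : LocallyIntegrable G volume) :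
    ContDiff ℝ ∞ (moll η G) := by
  rw [moll_eq_convolution]
  exact hη.2.contDiff_convolution_right _ hG hη.1

theorem fderiv_moll {η G : F → ℝ} (hη : IsTest η) (hG : LocallyIntegrable G volume) (z v : F) :
    fderiv ℝ (moll η G) z v = moll (fun y => fderiv ℝ η y v) G z := by
  have hη1 : ContDiff ℝ 1 η := hη.1.of_le (by simp)
  rw [moll_eq_convolution, moll_eq_convolution,
    (hη.2.hasFDerivAt_convolution_right (ContinuousLinearMap.mul ℝ ℝ) hG hη1 z).fderiv,
    convolution_precompR_apply _ hG (hη.2.fderiv ℝ) (hη1.continuous_fderiv one_ne_zero)]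

theorem integrable_moll {η G : F → ℝ} (hη : IsTest η) (hG : LocallyIntegrable G volume) (z : F) :
    Integrable (fun y => η (z - y) * G y) volume :=
  (hη.comp_neg_sub z).integrable_smul hG

theorem integrable_moll_left {η G : F → ℝ} (hη : IsTest η) (hG : LocallyIntegrable G volume)
    (z : F) : Integrable (fun y => η y * G (z - y)) volume := by
  have := (integrable_moll hη hG z).comp_sub_left z
  simpa using this

theorem moll_sub_moll_add {η G G' : F → ℝ} (hη : IsTest η) (hG : LocallyIntegrable G volume)
    (hG' : LocallyIntegrable G' volume) (z v : F) :
    moll η G z - moll η G' (z + v) = moll η (fun y => G y - G' (y + v)) z := by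
  rw [moll_eq, moll_eq, moll_eq]
  simp only [mul_sub]
  rw [integral_sub (integrable_moll_left hη hG z)]
  · simp only [sub_add_eq_add_sub]
  · simpa [sub_add_eq_add_sub] using integrable_moll_left hη hG' (z + v)

theorem abs_moll_sub_le {η G : F → ℝ} {ε : ℝ} (hη : IsMollifier η ε)
    (hG : LocallyIntegrable G volume) (z : F) {a b : ℝ}
    (h : ∀ y, ‖y‖ ≤ ε → |G (z - y) - a| ≤ b) : |moll η G z - a| ≤ b := by
  have hi : Integrable η volume := hη.test.continuous.integrable_of_hasCompactSupport hη.test.2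
  have hi2 := integrable_moll_left hη.test hG z
  have e1 : moll η G z - a = ∫ y, η y * (G (z - y) - a) := by
    rw [moll_eq]
    simp only [mul_sub]
    rw [integral_sub hi2 (hi.mul_const a), integral_mul_const, hη.integral_eq, one_mul]
  rw [e1, ← Real.norm_eq_abs]
  calc ‖∫ y, η y * (G (z - y) - a)‖ ≤ ∫ y, η y * b := by
        refine norm_integral_le_of_norm_le (hi.mul_const b) (Eventually.of_forall fun y => ?_)
        rw [norm_mul, Real.norm_eq_abs, abs_of_nonneg (hη.nonneg y)]
        rcases eq_or_ne (η y) 0 with h0 | h0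
        · simp [h0]
        · exact mul_le_mul_of_nonneg_left (h y (hη.supp y h0)) (hη.nonneg y)
    _ = b := by rw [integral_mul_const, hη.integral_eq, one_mul]

theorem abs_moll_sub_moll_le {η G : F → ℝ} {ε c : ℝ} (hη : IsMollifier η ε) (hG : Continuous G)
    {z z' : F} (hL : ∀ y, ‖y‖ ≤ ε → |G (z - y) - G (z' - y)| ≤ c) :
    |moll η G z - moll η G z'| ≤ c := by
  have h1 := moll_sub_moll_add hη.test hG.locallyIntegrable hG.locallyIntegrable z (z' - z)
  rw [add_sub_cancel] at h1
  have hc : Continuous fun y => G y - G (y + (z' - z)) :=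
    hG.sub (hG.comp (continuous_id.add continuous_const))
  rw [h1, ← sub_zero (moll _ _ _)]
  refine abs_moll_sub_le hη hc.locallyIntegrable z fun y hy => ?_
  rw [sub_zero, show z - y + (z' - z) = z' - y by abel]
  exact hL y hy

theorem moll_eq_zero {η G : F → ℝ} {ε R : ℝ} (hη : ∀ y, η y ≠ 0 → ‖y‖ ≤ ε)
    (hG : ∀ y, G y ≠ 0 → ‖y‖ ≤ R) {z : F} (hz : R + ε < ‖z‖) : moll η G z = 0 := by
  unfold moll
  rw [integral_eq_zero_of_ae]
  refine Eventually.of_forall fun y => ?_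
  by_contra h
  have h1 := hη (z - y) (left_ne_zero_of_mul h)
  have h2 := hG y (right_ne_zero_of_mul h)
  have := norm_add_le (z - y) y
  simp only [sub_add_cancel] at this
  linarith

theorem exists_taylor_bound {η : F → ℝ} (hη : IsTest η) :
    ∃ C : ℝ, 0 ≤ C ∧ ∀ a v, |η (a + v) - η a - fderiv ℝ η a v| ≤ C * ‖v‖ ^ 2 := by
  obtain ⟨C, hC⟩ := ContDiff.lipschitzWith_of_hasCompactSupport (𝕂 := ℝ) (n := 1)
    (hη.2.fderiv ℝ) ((hη.1.fderiv_right (m := ∞) (by simp)).of_le (by simp))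
    one_ne_zero
  refine ⟨C, C.2, fun a v => ?_⟩
  have h1 := (convex_closedBall a ‖v‖).norm_image_sub_le_of_norm_fderiv_le' (𝕜 := ℝ) (f := η)
    (φ := fderiv ℝ η a) (C := C * ‖v‖) (x := a) (y := a + v)
    (fun x _ => (hη.1.differentiable (by simp)).differentiableAt) ?_
    (Metric.mem_closedBall_self (norm_nonneg v)) (by simp)
  · simpa [pow_two, mul_assoc] using h1
  · intro x hx
    have := hC.dist_le_mul x a
    rw [dist_eq_norm, dist_eq_norm] at this
    refine this.trans (mul_le_mul_of_nonneg_left ?_ C.2)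
    simpa [dist_eq_norm] using hx

theorem moll_taylor {η : F → ℝ} (hη : IsTest η) (R : ℝ) :
    ∃ C : ℝ, 0 ≤ C ∧ ∀ (G : F → ℝ) (b : ℝ), Continuous G → (∀ y, G y ≠ 0 → ‖y‖ ≤ R) →
      (∀ y, |G y| ≤ b) → ∀ z v,
      |moll η G (z + v) - moll η G z - fderiv ℝ (moll η G) z v| ≤ C * b * ‖v‖ ^ 2 := by
  obtain ⟨C, hC0, hC⟩ := exists_taylor_bound hη
  refine ⟨C * (volume (Metric.closedBall (0 : F) R)).toReal, by positivity,
    fun G b hG hR hb z v => ?_⟩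
  have hGl : LocallyIntegrable G volume := hG.locallyIntegrable
  have hb0 : 0 ≤ b := (abs_nonneg _).trans (hb 0)
  rw [fderiv_moll hη hGl]
  have e1 : moll η G (z + v) - moll η G z - moll (fun y => fderiv ℝ η y v) G z =
      ∫ y, (η ((z - y) + v) - η (z - y) - fderiv ℝ η (z - y) v) * G y := by
    unfold moll
    have i1 := integrable_moll hη hGl (z + v)
    have i12 : Integrable (fun y => η (z + v - y) * G y - η (z - y) * G y) volume :=
      i1.sub (integrable_moll hη hGl z)
    rw [← integral_sub i1 (integrable_moll hη hGl z),
      ← integral_sub i12 (integrable_moll (hη.fderiv_apply v) hGl z)]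
    congr 1
    funext y
    rw [show z - y + v = z + v - y by abel]
    ring
  rw [e1, ← Real.norm_eq_abs]
  have e2 : ∫ y, (η ((z - y) + v) - η (z - y) - fderiv ℝ η (z - y) v) * G y =
      ∫ y in Metric.closedBall (0 : F) R,
        (η ((z - y) + v) - η (z - y) - fderiv ℝ η (z - y) v) * G y := by
    rw [setIntegral_eq_integral_of_forall_compl_eq_zero]
    intro y hy
    have : G y = 0 := by
      by_contra h
      exact hy (by simpa using hR y h)
    simp [this]
  rw [e2]
  have hfin : volume (Metric.closedBall (0 : F) R) < ⊤ :=
    (isCompact_closedBall (0 : F) R).measure_lt_top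
  refine (norm_setIntegral_le_of_norm_le_const hfin (C := C * ‖v‖ ^ 2 * b) fun y _ => ?_).trans
    (le_of_eq ?_)
  · rw [norm_mul]
    exact mul_le_mul (hC _ _) (hb y) (norm_nonneg _) (by positivity)
  · simp only [Measure.real]
    ring

end Mollification

end Liouville

end

noncomputable section

namespace Liouville

open Filter Topology

variable {n : ℕ}

instance isAddHaarMeasure_phase (n : ℕ) : (volume : Measure (Phase n)).IsAddHaarMeasure :=
  Measure.prod.instIsAddHaarMeasure volume volume

theorem fderiv_eq_zero_of_supp {φ : Phase n → ℝ} {R : ℝ} (hs : ∀ z, φ z ≠ 0 → ‖z‖ ≤ R)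
    {z : Phase n} (hz : R < ‖z‖) : fderiv ℝ φ z = 0 := by
  have : φ =ᶠ[𝓝 z] fun _ => 0 := by
    have hop : IsOpen {y : Phase n | R < ‖y‖} := isOpen_lt continuous_const continuous_norm
    filter_upwards [hop.mem_nhds hz] with x hx
    by_contra h0
    exact absurd (hs x h0) (not_le.2 hx)
  rw [this.fderiv_eq]
  simp

/-- Square integrable functions on phase space. -/
abbrev PhaseL2 (n : ℕ) : Type := Lp ℂ 2 (volume : Measure (Phase n))

/-! ### Pairings with continuous functions of bounded support -/

theorem hasCompactSupport_of_supp {E : Phase n → ℝ} {R : ℝ} (hs : ∀ z, E z ≠ 0 → ‖z‖ ≤ R) :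
    HasCompactSupport E :=
  HasCompactSupport.intro (isCompact_closedBall 0 R) fun z hz => by
    by_contra h
    exact hz (by simpa using hs z h)

theorem integrable_pair {E : Phase n → ℝ} {R : ℝ} (hE : Continuous E)
    (hs : ∀ z, E z ≠ 0 → ‖z‖ ≤ R) (w : PhaseL2 n) :
    Integrable (fun z => E z • w z) volume :=
  (memLp_locInt (Lp.memLp w)).integrable_smul_left_of_hasCompactSupport hE
    (hasCompactSupport_of_supp hs)

theorem memLp_pair {E : Phase n → ℝ} {R : ℝ} (hE : Continuous E)
    (hs : ∀ z, E z ≠ 0 → ‖z‖ ≤ R) : MemLp (fun z => (E z : ℂ)) 2 volume :=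
  (Complex.continuous_ofReal.comp hE).memLp_of_hasCompactSupport
    ((hasCompactSupport_of_supp hs).comp_left (g := fun x : ℝ => (x : ℂ)) (by simp))

theorem inner_pair {E : Phase n → ℝ} {R : ℝ} (hE : Continuous E)
    (hs : ∀ z, E z ≠ 0 → ‖z‖ ≤ R) (w : PhaseL2 n) :
    inner ℂ (memLp_pair hE hs).toLp w = ∫ z, E z • w z := by
  rw [L2.inner_def]
  refine integral_congr_ae ?_
  filter_upwards [(memLp_pair hE hs).coeFn_toLp] with z hz
  rw [hz]
  simp [mul_comm]

theorem pair_sub {E : Phase n → ℝ} {R : ℝ} (hE : Continuous E)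
    (hs : ∀ z, E z ≠ 0 → ‖z‖ ≤ R) (w w' : PhaseL2 n) :
    ∫ z, E z • (w - w') z = (∫ z, E z • w z) - ∫ z, E z • w' z := by
  rw [← inner_pair hE hs, ← inner_pair hE hs, ← inner_pair hE hs, inner_sub_right]

theorem continuousOn_pair {E : Phase n → ℝ} {R : ℝ} (hE : Continuous E)
    (hs : ∀ z, E z ≠ 0 → ‖z‖ ≤ R) {u : ℝ → PhaseL2 n} {S : Set ℝ} (hu : ContinuousOn u S) :
    ContinuousOn (fun r => ∫ z, E z • u r z) S := by
  simp only [← inner_pair hE hs]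
  exact continuousOn_const.inner hu

/-- The square root of the volume of a ball of phase space. -/
def ballConst (n : ℕ) (R : ℝ) : ℝ :=
  ((volume (Metric.closedBall (0 : Phase n) R)) ^ (2 : ℝ)⁻¹).toReal

theorem norm_pair_le {E : Phase n → ℝ} {R a : ℝ} (hE : Continuous E)
    (hs : ∀ z, E z ≠ 0 → ‖z‖ ≤ R) (ha : ∀ z, |E z| ≤ a) (w : PhaseL2 n) :
    ‖∫ z, E z • w z‖ ≤ a * ballConst n R * ‖w‖ := by
  have ha0 : 0 ≤ a := (abs_nonneg _).trans (ha 0)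
  rw [← inner_pair hE hs]
  refine (norm_inner_le_norm _ _).trans (mul_le_mul_of_nonneg_right ?_ (norm_nonneg _))
  rw [Lp.norm_toLp]
  have hfin : volume (Metric.closedBall (0 : Phase n) R) < ⊤ :=
    (isCompact_closedBall (0 : Phase n) R).measure_lt_top
  have h1 : eLpNorm (fun z => (E z : ℂ)) 2 volume ≤
      (volume (Metric.closedBall (0 : Phase n) R)) ^ (2 : ℝ)⁻¹ * ENNReal.ofReal a := by
    rw [← eLpNorm_restrict_eq_of_support_subset (s := Metric.closedBall (0 : Phase n) R)]
    · refine (eLpNorm_le_of_ae_bound (C := a) (Eventually.of_forall fun z => by simpa using ha z)).trans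
        (le_of_eq ?_)
      simp
    · intro z hz
      simpa using hs z (by simpa using hz)
  have h2 := ENNReal.toReal_mono (ENNReal.mul_ne_top
    (ENNReal.rpow_ne_top_of_nonneg (by norm_num) hfin.ne) ENNReal.ofReal_ne_top) h1
  rw [ENNReal.toReal_mul, ENNReal.toReal_ofReal ha0] at h2
  rw [ballConst, mul_comm]
  exact h2

theorem ballConst_nonneg (n : ℕ) (R : ℝ) : 0 ≤ ballConst n R := ENNReal.toReal_nonneg

/-! ### One step of the backward transport of a test function -/

theorem abs_moll_step_le {X P : Phase n → Phase n} {G η : Phase n → ℝ}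
    {h L θ Λ ε R b M C : ℝ} (hη : IsMollifier η ε) (hε : ε ≤ 1) (hh : 0 ≤ h) (hL : 0 ≤ L)
    (hΛ : 0 ≤ Λ) (hG : Continuous G) (hP : Continuous P)
    (hGs : ∀ z, G z ≠ 0 → ‖z‖ ≤ R) (hGPs : ∀ z, G (P z) ≠ 0 → ‖z‖ ≤ R)
    (hGL : ∀ z z', |G z - G z'| ≤ Λ * ‖z - z'‖) (hb : ∀ z, |G z| ≤ b)
    (hPL : ∀ z z', ‖z‖ ≤ R + 2 → ‖z'‖ ≤ R + 2 → ‖(P z - z) - (P z' - z')‖ ≤ L * h * ‖z - z'‖)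
    (hPX : ∀ z, ‖z‖ ≤ R + 2 → ‖P z - z - h • X z‖ ≤ h * θ)
    (hM : ∀ z, ‖z‖ ≤ R + 2 → ‖X z‖ ≤ M) (hθ : 0 ≤ θ)
    (hC0 : 0 ≤ C) (hC : ∀ z v,
      |moll η G (z + v) - moll η G z - fderiv ℝ (moll η G) z v| ≤ C * b * ‖v‖ ^ 2) (z : Phase n) :
    |moll η (fun z => G (P z)) z - moll η G z - h * fderiv ℝ (moll η G) z (X z)| ≤
      h * (Λ * (L * ε + θ) + C * b * h * M ^ 2) := by
  have hb0 : 0 ≤ b := (abs_nonneg _).trans (hb 0)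
  have hε0 : 0 ≤ ε := by
    by_contra hneg
    have : ∀ y, η y = 0 := fun y => by
      by_contra h
      have := hη.supp y h
      linarith [norm_nonneg y]
    have h1 := hη.integral_eq
    simp [this] at h1
  have hrhs : 0 ≤ h * (Λ * (L * ε + θ) + C * b * h * M ^ 2) := by positivity
  have hGl : LocallyIntegrable G volume := hG.locallyIntegrable
  have hGPl : LocallyIntegrable (fun z => G (P z)) volume := (hG.comp hP).locallyIntegrable
  rcases lt_or_ge (R + 1) ‖z‖ with hz | hz
  · have hz' : R + ε < ‖z‖ := by linarith
    have hdη : ∀ v y, fderiv ℝ η y v ≠ 0 → ‖y‖ ≤ ε := by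
      intro v y hy
      by_contra hlt
      apply hy
      rw [fderiv_eq_zero_of_supp hη.supp (not_le.1 hlt)]
      simp
    rw [fderiv_moll hη.test hGl, moll_eq_zero hη.supp hGs hz', moll_eq_zero hη.supp hGPs hz',
      moll_eq_zero (hdη (X z)) hGs hz']
    simpa using hrhs
  · have h1 := hC z (h • X z)
    rw [map_smul, smul_eq_mul, norm_smul, Real.norm_eq_abs, abs_of_nonneg hh] at h1
    have hXz := hM z (by linarith)
    have h2 : |moll η (fun z => G (P z)) z - moll η G (z + h • X z)| ≤ Λ * (h * (L * ε + θ)) := by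
      have e1 : moll η (fun z => G (P z)) z - moll η G (z + h • X z) =
          moll η (fun y => G (P y) - G (y + h • X z)) z - 0 := by
        rw [sub_zero, moll_sub_moll_add hη.test hGPl hGl]
      rw [e1]
      have hcont : Continuous fun y => G (P y) - G (y + h • X z) :=
        (hG.comp hP).sub (hG.comp (continuous_id.add continuous_const))
      refine abs_moll_sub_le hη hcont.locallyIntegrable z fun y hy => ?_
      rw [sub_zero]
      refine (hGL _ _).trans (mul_le_mul_of_nonneg_left ?_ hΛ)
      have hzy : ‖z - y‖ ≤ R + 2 := by
        have := norm_sub_le z y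
        linarith
      have e2 : P (z - y) - (z - y + h • X z) =
          ((P (z - y) - (z - y)) - (P z - z)) + (P z - z - h • X z) := by abel
      rw [e2]
      refine (norm_add_le _ _).trans ?_
      have h3 := hPL (z - y) z hzy (by linarith)
      have h4 := hPX z (by linarith)
      rw [sub_sub_cancel_left, norm_neg] at h3
      have h5 : L * h * ‖y‖ ≤ L * h * ε := mul_le_mul_of_nonneg_left hy (by positivity)
      linarith
    have h6 : C * b * (h * ‖X z‖) ^ 2 ≤ h * (C * b * h * M ^ 2) := by
      have : ‖X z‖ ^ 2 ≤ M ^ 2 := pow_le_pow_left₀ (norm_nonneg _) hXz 2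
      calc C * b * (h * ‖X z‖) ^ 2 = C * b * h ^ 2 * ‖X z‖ ^ 2 := by ring
        _ ≤ C * b * h ^ 2 * M ^ 2 := mul_le_mul_of_nonneg_left this (by positivity)
        _ = _ := by ring
    have e3 : moll η (fun z => G (P z)) z - moll η G z - h * fderiv ℝ (moll η G) z (X z) =
        (moll η (fun z => G (P z)) z - moll η G (z + h • X z)) +
        (moll η G (z + h • X z) - moll η G z - h * fderiv ℝ (moll η G) z (X z)) := by ring
    rw [e3]
    refine (abs_add_le _ _).trans ?_
    calc _ ≤ Λ * (h * (L * ε + θ)) + C * b * (h * ‖X z‖) ^ 2 := add_le_add h2 h1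
      _ ≤ Λ * (h * (L * ε + θ)) + h * (C * b * h * M ^ 2) := by linarith
      _ = _ := by ring

/-- `u ∈ C([0,t]; L²)` is a weak solution of `u_t + X·∇u = f` for the divergence free vector
field `X`. -/
structure IsWeakSolution (X : Phase n → Phase n) (f : PhaseL2 n) (t : ℝ) (u : ℝ → PhaseL2 n) :
    Prop where
  continuousOn : ContinuousOn u (Set.Icc 0 t)
  weak : ∀ φ : Phase n → ℝ, IsTest φ → ∀ s ∈ Set.Icc 0 t,
    (∫ z, φ z • u s z) - ∫ z, φ z • u 0 z =
      ∫ r in (0 : ℝ)..s, ((∫ z, fderiv ℝ φ z (X z) • u r z) + ∫ z, φ z • f z)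

theorem IsWeakSolution.norm_step_le {X : Phase n → Phase n} {f : PhaseL2 n} {t : ℝ}
    {u : ℝ → PhaseL2 n} (hu : IsWeakSolution X f t u) (hX : Continuous X) {φ : Phase n → ℝ}
    (hφ : IsTest φ) {R a osc : ℝ} (hs : ∀ z, φ z ≠ 0 → ‖z‖ ≤ R)
    (ha : ∀ z, |fderiv ℝ φ z (X z)| ≤ a) {r s : ℝ} (hr : 0 ≤ r) (hrs : r ≤ s) (hst : s ≤ t)
    (hosc : ∀ q ∈ Set.Icc r s, ‖u q - u r‖ ≤ osc) :
    ‖(∫ z, φ z • u s z) - (∫ z, φ z • u r z) -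
      ((s - r : ℝ) : ℂ) * ((∫ z, fderiv ℝ φ z (X z) • u r z) + ∫ z, φ z • f z)‖ ≤
      (s - r) * (a * ballConst n R * osc) := by
  have hEc : Continuous fun z => fderiv ℝ φ z (X z) :=
    (hφ.1.continuous_fderiv (by simp)).clm_apply hX
  have hEs : ∀ z, fderiv ℝ φ z (X z) ≠ 0 → ‖z‖ ≤ R := by
    intro z hz
    by_contra hlt
    apply hz
    rw [fderiv_eq_zero_of_supp hs (not_le.1 hlt)]
    simp
  have ha0 : 0 ≤ a := (abs_nonneg _).trans (ha 0)
  set g : ℝ → ℂ := fun q => (∫ z, fderiv ℝ φ z (X z) • u q z) + ∫ z, φ z • f z with hg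
  have hgc : ContinuousOn g (Set.Icc 0 t) :=
    (continuousOn_pair hEc hEs hu.continuousOn).add continuousOn_const
  have hint : ∀ q ∈ Set.Icc 0 t, IntervalIntegrable g volume 0 q := fun q hq =>
    (hgc.mono (by rw [Set.uIcc_of_le hq.1]; exact Set.Icc_subset_Icc_right hq.2)).intervalIntegrable
  have h1 := hu.weak φ hφ s ⟨hr.trans hrs, hst⟩
  have h2 := hu.weak φ hφ r ⟨hr, hrs.trans hst⟩
  have h3 : (∫ z, φ z • u s z) - (∫ z, φ z • u r z) = ∫ q in r..s, g q := by
    rw [← intervalIntegral.integral_interval_sub_left (hint s ⟨hr.trans hrs, hst⟩)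
      (hint r ⟨hr, hrs.trans hst⟩), ← h1, ← h2]
    ring
  have hint' : IntervalIntegrable g volume r s :=
    (hint r ⟨hr, hrs.trans hst⟩).symm.trans (hint s ⟨hr.trans hrs, hst⟩)
  have h4 : ((s - r : ℝ) : ℂ) * g r = ∫ _ in r..s, g r := by
    rw [intervalIntegral.integral_const, Complex.real_smul]
  change ‖_ - ((s - r : ℝ) : ℂ) * g r‖ ≤ _
  rw [h3, h4, ← intervalIntegral.integral_sub hint' intervalIntegrable_const]
  refine (intervalIntegral.norm_integral_le_of_norm_le_const (C := a * ballConst n R * osc)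
    fun q hq => ?_).trans (le_of_eq ?_)
  · rw [Set.uIoc_of_le hrs] at hq
    have : g q - g r = ∫ z, fderiv ℝ φ z (X z) • (u q - u r) z := by
      rw [pair_sub hEc hEs]
      simp only [hg]
      ring
    rw [this]
    refine (norm_pair_le hEc hEs ha _).trans ?_
    exact mul_le_mul_of_nonneg_left (hosc q ⟨hq.1.le, hq.2⟩)
      (mul_nonneg ha0 (ballConst_nonneg _ _))
  · rw [abs_of_nonneg (by linarith)]
    ring

end Liouville

end

noncomputable section

namespace Liouville

open Filter Topology

variable {n : ℕ}

/-- The one-step maps `P N`, with step `t / (N + 1)`, approximate the flow of `X` on the region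
that matters for the transport of the test function `ψ` up to the time `t`. -/
structure IsApproxFlow (X : Phase n → Phase n) (ψ : Phase n → ℝ) (t R : ℝ)
    (P : ℕ → Phase n → Phase n) : Prop where
  cont : ∀ N, Continuous (P N)
  supp : ∀ N j z, j ≤ N + 1 → ψ ((P N)^[j] z) ≠ 0 → ‖z‖ ≤ R
  lip : ∃ Λ : ℝ, 0 ≤ Λ ∧ ∀ N j, j ≤ N + 1 → ∀ z z',
    |ψ ((P N)^[j] z) - ψ ((P N)^[j] z')| ≤ Λ * ‖z - z'‖
  step : ∃ L : ℝ, 0 ≤ L ∧ ∀ (N : ℕ) z z', ‖z‖ ≤ R + 2 → ‖z'‖ ≤ R + 2 →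
    ‖(P N z - z) - (P N z' - z')‖ ≤ L * (t / (N + 1)) * ‖z - z'‖
  consistent : ∃ θ : ℕ → ℝ, Tendsto θ atTop (𝓝 0) ∧ ∀ (N : ℕ) z, ‖z‖ ≤ R + 2 →
    ‖P N z - z - (t / (N + 1)) • X z‖ ≤ t / (N + 1) * θ N

/-- Duality: the solution tested with `ψ` at time `t` is computed by transporting `ψ` backwards. -/
theorem IsWeakSolution.tendsto_duality {X : Phase n → Phase n} {f : PhaseL2 n} {t R : ℝ}
    {u : ℝ → PhaseL2 n} (hu : IsWeakSolution X f t u) (hX : Continuous X) (ht : 0 ≤ t)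
    {ψ : Phase n → ℝ} (hψ : IsTest ψ) {P : ℕ → Phase n → Phase n}
    (hP : IsApproxFlow X ψ t R P) :
    Tendsto (fun N : ℕ => (∫ z, ψ ((P N)^[N + 1] z) • u 0 z) +
      ∑ j ∈ Finset.range (N + 1), ((t / (N + 1) : ℝ) : ℂ) * ∫ z, ψ ((P N)^[j] z) • f z)
      atTop (𝓝 (∫ z, ψ z • u t z)) := by
  obtain ⟨Λ, hΛ, hlip⟩ := hP.lip
  obtain ⟨L, hL, hstep⟩ := hP.step
  obtain ⟨θ, hθ, hcons⟩ := hP.consistent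
  obtain ⟨M, hM⟩ := (isCompact_closedBall (0 : Phase n) (R + 2)).exists_bound_of_continuousOn
    hX.continuousOn
  replace hM : ∀ z, ‖z‖ ≤ R + 2 → ‖X z‖ ≤ |M| := fun z hz =>
    (hM z (by simpa using hz)).trans (le_abs_self M)
  obtain ⟨B, hB⟩ := isCompact_Icc.exists_bound_of_continuousOn hu.continuousOn
  replace hB : ∀ s ∈ Set.Icc 0 t, ‖u s‖ ≤ |B| := fun s hs => (hB s hs).trans (le_abs_self B)
  obtain ⟨b, hb⟩ := hψ.2.exists_bound_of_continuous hψ.continuous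
  have hb0 : 0 ≤ b := (norm_nonneg _).trans (hb 0)
  set c := ballConst n (R + 1) with hc
  have hc0 : 0 ≤ c := ballConst_nonneg _ _
  have huc : UniformContinuousOn u (Set.Icc 0 t) :=
    isCompact_Icc.uniformContinuousOn_of_continuous hu.continuousOn
  have hGcont : ∀ N j, Continuous fun z => ψ ((P N)^[j] z) := fun N j =>
    hψ.continuous.comp ((hP.cont N).iterate j)
  set K := Λ * c * (‖u t‖ + ‖u 0‖ + t * ‖f‖) + t * Λ * L * c * |B| with hK
  have hK0 : 0 ≤ K := by positivity
  have main : ∀ ε : ℝ, 0 < ε → ε ≤ 1 → ∃ K₂ : ℝ, 0 ≤ K₂ ∧ ∀ e : ℝ, 0 < e → ∀ᶠ N : ℕ in atTop,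
      ‖(∫ z, ψ z • u t z) - ((∫ z, ψ ((P N)^[N + 1] z) • u 0 z) +
        ∑ j ∈ Finset.range (N + 1), ((t / (N + 1) : ℝ) : ℂ) * ∫ z, ψ ((P N)^[j] z) • f z)‖ ≤
        K * ε + K₂ * e := by
    intro ε hε hε1
    obtain ⟨η, hη⟩ := exists_isMollifier (F := Phase n) hε
    obtain ⟨C, hC0, hC⟩ := moll_taylor hη.test R
    refine ⟨t * (Λ * |M| * c + (Λ + C * b * |M| ^ 2) * c * |B|), by positivity, fun e he => ?_⟩
    obtain ⟨δ, hδ, hosc⟩ := Metric.uniformContinuousOn_iff_le.1 huc e he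
    have hh : Tendsto (fun N : ℕ => t / ((N : ℝ) + 1)) atTop (𝓝 0) :=
      tendsto_const_div_atTop_nhds_zero_nat t |>.comp (tendsto_add_atTop_nat 1) |>.congr
        fun N => by simp
    filter_upwards [hh.eventually_le_const hδ, hh.eventually_le_const he,
      hθ.eventually_le_const he] with N hN1 hN2 hN3
    set h := t / ((N : ℝ) + 1) with hh'
    have hNt : ((N : ℝ) + 1) * h = t := by rw [hh']; field_simp
    have hh0 : 0 ≤ h := by positivity
    set G : ℕ → Phase n → ℝ := fun j z => ψ ((P N)^[j] z) with hG
    set m : ℕ → Phase n → ℝ := fun j => moll η (G j) with hm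
    set τ : ℕ → ℝ := fun j => t - j * h with hτ
    have hGc : ∀ j, Continuous (G j) := fun j => hGcont N j
    have hGs : ∀ j ≤ N + 1, ∀ z, G j z ≠ 0 → ‖z‖ ≤ R := fun j hj z => hP.supp N j z hj
    have hGb : ∀ j z, |G j z| ≤ b := fun j z => hb _
    have hmc : ∀ j, ContDiff ℝ ∞ (m j) := fun j =>
      contDiff_moll hη.test (hGc j).locallyIntegrable
    have hms : ∀ j ≤ N + 1, ∀ z, m j z ≠ 0 → ‖z‖ ≤ R + 1 := by
      intro j hj z hz
      by_contra hlt
      exact hz (moll_eq_zero hη.supp (hGs j hj) (by linarith))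
    have hmt : ∀ j ≤ N + 1, IsTest (m j) := fun j hj =>
      ⟨hmc j, hasCompactSupport_of_supp (hms j hj)⟩
    have hGm : ∀ j ≤ N + 1, ∀ w : PhaseL2 n,
        ‖(∫ z, G j z • w z) - ∫ z, m j z • w z‖ ≤ Λ * ε * c * ‖w‖ := by
      intro j hj w
      have hGs' : ∀ z, G j z ≠ 0 → ‖z‖ ≤ R + 1 := fun z hz => by linarith [hGs j hj z hz]
      rw [← integral_sub (integrable_pair (hGc j) hGs' w)
        (integrable_pair (hmc j).continuous (hms j hj) w)]
      simp only [← sub_smul]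
      refine norm_pair_le (E := fun z => G j z - m j z) ((hGc j).sub (hmc j).continuous)
        (fun z hz => ?_) (fun z => ?_) w
      · by_contra hlt
        have h1 : G j z = 0 := by by_contra h1; exact hlt (hGs' z h1)
        have h2 : m j z = 0 := by by_contra h2; exact hlt (hms j hj z h2)
        exact hz (by simp only [h1, h2, sub_zero])
      · rw [abs_sub_comm]
        refine abs_moll_sub_le hη (hGc j).locallyIntegrable z fun y hy => ?_
        refine (hlip N j hj _ _).trans (mul_le_mul_of_nonneg_left ?_ hΛ)
        simpa using hy
    have hfd : ∀ j ≤ N + 1, ∀ z, |fderiv ℝ (m j) z (X z)| ≤ Λ * |M| := by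
      intro j hj z
      rcases le_or_gt ‖z‖ (R + 1) with hz | hz
      · have h1 : ‖fderiv ℝ (m j) z‖ ≤ Λ :=
          norm_fderiv_le_of_lip' ℝ hΛ (Eventually.of_forall fun z' =>
            abs_moll_sub_moll_le hη (hGc j) fun y _ => by
              simpa using hlip N j hj (z' - y) (z - y))
        exact ((fderiv ℝ (m j) z).le_opNorm _).trans
          (mul_le_mul h1 (hM z (by linarith)) (norm_nonneg _) hΛ)
      · rw [fderiv_eq_zero_of_supp (hms j hj) hz]
        simpa using mul_nonneg hΛ (abs_nonneg M)
    have hτmem : ∀ j ≤ N + 1, τ j ∈ Set.Icc 0 t := by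
      intro j hj
      have hj' : (j : ℝ) ≤ N + 1 := by exact_mod_cast hj
      have := mul_le_mul_of_nonneg_right hj' hh0
      exact ⟨by simp only [hτ]; linarith, by simp only [hτ]; linarith [mul_nonneg j.cast_nonneg hh0]⟩
    set κ := Λ * |M| * c * e + (Λ * (L * ε + e) + C * b * e * |M| ^ 2) * c * |B| with hκ
    have hone : ∀ j < N + 1, ‖(∫ z, m j z • u (τ j) z) - (∫ z, m (j + 1) z • u (τ (j + 1)) z) -
        (h : ℂ) * ∫ z, m j z • f z‖ ≤ h * κ := by
      intro j hj
      have hτd : τ j - τ (j + 1) = h := by simp only [hτ]; push_cast; ring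
      have hA := hu.norm_step_le hX (hmt j hj.le) (hms j hj.le) (hfd j hj.le)
        (r := τ (j + 1)) (s := τ j) (osc := e) (hτmem (j + 1) hj).1 (by linarith) (hτmem j hj.le).2
        (fun q hq => by
          have hq' : q ∈ Set.Icc 0 t :=
            ⟨(hτmem (j + 1) hj).1.trans hq.1, hq.2.trans (hτmem j hj.le).2⟩
          have := hosc q hq' (τ (j + 1)) (hτmem (j + 1) hj) (by
            rw [Real.dist_eq, abs_of_nonneg (by linarith [hq.1])]
            linarith [hq.2])
          rwa [dist_eq_norm] at this)
      rw [hτd] at hA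
      set E : Phase n → ℝ := fun z => m (j + 1) z - m j z - h * fderiv ℝ (m j) z (X z) with hE
      have hfc : Continuous fun z => fderiv ℝ (m j) z (X z) :=
        ((hmc j).continuous_fderiv (by simp)).clm_apply hX
      have hfs : ∀ z, fderiv ℝ (m j) z (X z) ≠ 0 → ‖z‖ ≤ R + 1 := by
        intro z hz
        by_contra hlt
        exact hz (by rw [fderiv_eq_zero_of_supp (hms j hj.le) (not_le.1 hlt)]; simp)
      have hEc : Continuous E :=
        ((hmc (j + 1)).continuous.sub (hmc j).continuous).sub (continuous_const.mul hfc)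
      have hEs : ∀ z, E z ≠ 0 → ‖z‖ ≤ R + 1 := by
        intro z hz
        by_contra hlt
        have h1 : m j z = 0 := by by_contra h1; exact hlt (hms j hj.le z h1)
        have h2 : m (j + 1) z = 0 := by by_contra h2; exact hlt (hms (j + 1) hj z h2)
        have h3 : fderiv ℝ (m j) z (X z) = 0 := by by_contra h3; exact hlt (hfs z h3)
        exact hz (by simp [hE, h1, h2, h3])
      have hEb : ∀ z, |E z| ≤ h * (Λ * (L * ε + e) + C * b * e * |M| ^ 2) := by
        intro z
        have := abs_moll_step_le (X := X) (P := P N) (G := G j) (h := h) (L := L) (θ := e)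
          (Λ := Λ) (R := R) (b := b) (M := |M|) (C := C) hη hε1 hh0 hL hΛ (hGc j) (hP.cont N)
          (hGs j hj.le) (fun z => hGs (j + 1) hj z) (hlip N j hj.le) (hGb j) (hstep N)
          (fun z hz => (hcons N z hz).trans (mul_le_mul_of_nonneg_left hN3 hh0)) hM he.le hC0
          (hC (G j) b (hGc j) (hGs j hj.le) (hGb j)) z
        refine this.trans ?_
        gcongr
      have hEu := norm_pair_le hEc hEs hEb (u (τ (j + 1)))
      have hEe : ∫ z, E z • u (τ (j + 1)) z = (∫ z, m (j + 1) z • u (τ (j + 1)) z) -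
          (∫ z, m j z • u (τ (j + 1)) z) -
          (h : ℂ) * ∫ z, fderiv ℝ (m j) z (X z) • u (τ (j + 1)) z := by
        have i1 := integrable_pair (hmc (j + 1)).continuous (hms (j + 1) hj) (u (τ (j + 1)))
        have i2 := integrable_pair (hmc j).continuous (hms j hj.le) (u (τ (j + 1)))
        have i3 := integrable_pair hfc hfs (u (τ (j + 1)))
        have i12 : Integrable (fun z => m (j + 1) z • u (τ (j + 1)) z -
          m j z • u (τ (j + 1)) z) volume := i1.sub i2
        have i4 : Integrable (fun z => h • fderiv ℝ (m j) z (X z) • u (τ (j + 1)) z) volume :=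
          i3.smul h
        rw [← integral_sub i1 i2, ← Complex.real_smul, ← integral_smul,
          ← integral_sub i12 i4]
        simp only [hE, sub_smul, mul_smul]
      have e1 : (∫ z, m j z • u (τ j) z) - (∫ z, m (j + 1) z • u (τ (j + 1)) z) -
          (h : ℂ) * ∫ z, m j z • f z =
          ((∫ z, m j z • u (τ j) z) - (∫ z, m j z • u (τ (j + 1)) z) -
            (h : ℂ) * ((∫ z, fderiv ℝ (m j) z (X z) • u (τ (j + 1)) z) + ∫ z, m j z • f z)) -
          ∫ z, E z • u (τ (j + 1)) z := by
        rw [hEe]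
        ring
      rw [e1]
      refine (norm_sub_le _ _).trans ((add_le_add hA hEu).trans ?_)
      have h2 : h * (Λ * (L * ε + e) + C * b * e * |M| ^ 2) * c * ‖u (τ (j + 1))‖ ≤
          h * (Λ * (L * ε + e) + C * b * e * |M| ^ 2) * c * |B| :=
        mul_le_mul_of_nonneg_left (hB _ (hτmem (j + 1) hj)) (by positivity)
      calc _ ≤ h * (Λ * |M| * c * e) + h * (Λ * (L * ε + e) + C * b * e * |M| ^ 2) * c * |B| :=
            add_le_add le_rfl h2
        _ = h * κ := by rw [hκ]; ring
    have hsum : ‖(∫ z, m 0 z • u t z) - (∫ z, m (N + 1) z • u 0 z) -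
        ∑ j ∈ Finset.range (N + 1), (h : ℂ) * ∫ z, m j z • f z‖ ≤ t * κ := by
      have e1 : τ 0 = t := by simp [hτ]
      have e2 : τ (N + 1) = 0 := by simp only [hτ]; push_cast; linarith
      have e3 := Finset.sum_range_sub' (fun j => ∫ z, m j z • u (τ j) z) (N + 1)
      simp only [e1, e2] at e3
      rw [← e3, ← Finset.sum_sub_distrib]
      refine (norm_sum_le _ _).trans ((Finset.sum_le_sum fun j hj =>
        hone j (Finset.mem_range.1 hj)).trans (le_of_eq ?_))
      rw [Finset.sum_const, Finset.card_range, nsmul_eq_mul, ← mul_assoc]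
      push_cast
      rw [hNt]
    have hsf : ‖∑ j ∈ Finset.range (N + 1), (h : ℂ) * ((∫ z, G j z • f z) - ∫ z, m j z • f z)‖ ≤
        t * (Λ * ε * c * ‖f‖) := by
      refine (norm_sum_le _ _).trans ((Finset.sum_le_sum (g := fun _ => h * (Λ * ε * c * ‖f‖))
        fun j hj => ?_).trans (le_of_eq ?_))
      · rw [norm_mul, Complex.norm_real, Real.norm_eq_abs, abs_of_nonneg hh0]
        exact mul_le_mul_of_nonneg_left (hGm j (Finset.mem_range.1 hj).le f) hh0
      · rw [Finset.sum_const, Finset.card_range, nsmul_eq_mul, ← mul_assoc]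
        push_cast
        rw [hNt]
    have h0 := hGm 0 (Nat.zero_le _) (u t)
    have hN := hGm (N + 1) le_rfl (u 0)
    have e5 : (∫ z, ψ z • u t z) - ((∫ z, ψ ((P N)^[N + 1] z) • u 0 z) +
        ∑ j ∈ Finset.range (N + 1), (h : ℂ) * ∫ z, ψ ((P N)^[j] z) • f z) =
        ((∫ z, G 0 z • u t z) - ∫ z, m 0 z • u t z) +
        ((∫ z, m 0 z • u t z) - (∫ z, m (N + 1) z • u 0 z) -
          ∑ j ∈ Finset.range (N + 1), (h : ℂ) * ∫ z, m j z • f z) -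
        ((∫ z, G (N + 1) z • u 0 z) - ∫ z, m (N + 1) z • u 0 z) -
        ∑ j ∈ Finset.range (N + 1), (h : ℂ) * ((∫ z, G j z • f z) - ∫ z, m j z • f z) := by
      simp only [mul_sub, Finset.sum_sub_distrib]
      simp only [hG, Function.iterate_zero, id]
      ring
    rw [e5]
    refine (norm_sub_le _ _).trans ((add_le_add ((norm_sub_le _ _).trans (add_le_add
      ((norm_add_le _ _).trans (add_le_add h0 hsum)) hN)) hsf).trans (le_of_eq ?_))
    rw [hκ, hK]
    ring
  rw [Metric.tendsto_nhds]
  intro e he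
  have hε : 0 < min 1 (e / (4 * (K + 1))) := by positivity
  obtain ⟨K₂, hK₂, h⟩ := main _ hε (min_le_left _ _)
  filter_upwards [h (e / (4 * (K₂ + 1))) (by positivity)] with N hN
  rw [dist_comm, dist_eq_norm]
  refine hN.trans_lt ?_
  have h1 : K * min 1 (e / (4 * (K + 1))) ≤ e / 4 := by
    refine (mul_le_mul_of_nonneg_left (min_le_right _ _) hK0).trans ?_
    rw [mul_div_assoc', div_le_div_iff₀ (by positivity) (by norm_num)]
    nlinarith
  have h2 : K₂ * (e / (4 * (K₂ + 1))) ≤ e / 4 := by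
    rw [mul_div_assoc', div_le_div_iff₀ (by positivity) (by norm_num)]
    nlinarith
  linarith

end Liouville

end

noncomputable section

namespace Liouville

open Filter Topology

variable {n : ℕ}

/-! ### The shears of the splitting scheme -/

theorem gradient_apply (W : Conf n → ℝ) (x : Conf n) (j : Fin n) :
    gradient W x j = fderiv ℝ W x (ebasis n j) := by
  have h1 : inner ℝ (gradient W x) (ebasis n j) = fderiv ℝ W x (ebasis n j) := by
    rw [gradient, InnerProductSpace.toDual_symm_apply]
  rw [← h1, ebasis, EuclideanSpace.inner_single_right]
  simp

theorem gradient_eq_sum (W : Conf n → ℝ) (x : Conf n) :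
    gradient W x = ∑ j, fderiv ℝ W x (ebasis n j) • ebasis n j := by
  conv_lhs => rw [← conf_sum (gradient W x)]
  simp only [gradient_apply]

theorem contDiff_gradient {W : Conf n → ℝ} (hW : ContDiff ℝ ∞ W) :
    ContDiff ℝ ∞ (gradient W) := by
  have : gradient W = fun x => ∑ j, fderiv ℝ W x (ebasis n j) • ebasis n j :=
    funext (gradient_eq_sum W)
  rw [this]
  exact ContDiff.sum fun j _ => (contDiff_fderiv_apply hW _).smul contDiff_const

theorem continuous_gradient {V : Conf n → ℝ} (hV : ContDiff ℝ 1 V) :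
    Continuous (gradient V) := by
  have : gradient V = fun x => ∑ j, fderiv ℝ V x (ebasis n j) • ebasis n j :=
    funext (gradient_eq_sum V)
  rw [this]
  exact continuous_finsetSum _ fun j _ =>
    ((hV.continuous_fderiv one_ne_zero).clm_apply continuous_const).smul continuous_const

/-- The vector field `(0, -∂ₓW(x)/(2π))`. -/
def kick (W : Conf n → ℝ) (z : Phase n) : Phase n :=
  (0, -((1 / (2 * Real.pi)) • gradient W z.1))

/-- The vector field `(2πk, 0)`. -/
def drift (z : Phase n) : Phase n := ((2 * Real.pi) • z.2, 0)

theorem field_eq (V : Conf n → ℝ) (z : Phase n) : field V z = drift z + kick V z := by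
  simp [field, drift, kick]

theorem continuous_field {V : Conf n → ℝ} (hV : ContDiff ℝ 1 V) : Continuous (field V) :=
  Continuous.prodMk (continuous_snd.const_smul (2 * Real.pi))
    (((continuous_gradient hV).comp continuous_fst).const_smul (1 / (2 * Real.pi))).neg

/-- The coordinates of phase space, as continuous linear maps. -/
def coordL (n : ℕ) (τ : Ix n) : Phase n →L[ℝ] ℝ :=
  Sum.elim
    (fun i => (EuclideanSpace.proj i).comp (ContinuousLinearMap.fst ℝ (Conf n) (Conf n)))
    (fun i => (EuclideanSpace.proj i).comp (ContinuousLinearMap.snd ℝ (Conf n) (Conf n))) τ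

theorem coordL_apply (τ : Ix n) (z : Phase n) : coordL n τ z = coord n τ z := by
  rcases τ with i | i <;> rfl

theorem coef_eq {Y : Phase n → Phase n} (hY : ContDiff ℝ ∞ Y) (σ τ : Ix n) (z : Phase n) :
    coef Y σ τ z = fderiv ℝ (fun z => coord n τ (Y z)) z (dir n σ) := by
  have h1 : HasFDerivAt Y (fderiv ℝ Y z) z :=
    (hY.differentiable (by simp)).differentiableAt.hasFDerivAt
  have h2 := ((coordL n τ).hasFDerivAt (x := Y z)).comp z h1
  have h3 : (fun z => coord n τ (Y z)) = coordL n τ ∘ Y := by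
    funext z
    exact (coordL_apply τ (Y z)).symm
  rw [h3, h2.fderiv, coef, ← coordL_apply]
  rfl

theorem fderiv_comp_fst {G : Type*} [NormedAddCommGroup G] [NormedSpace ℝ G] {g : Conf n → G}
    {z : Phase n} (hg : DifferentiableAt ℝ g z.1) (v : Phase n) :
    fderiv ℝ (fun z : Phase n => g z.1) z v = fderiv ℝ g z.1 v.1 := by
  have := (hg.hasFDerivAt.comp z (hasFDerivAt_fst (𝕜 := ℝ) (p := z)))
  change fderiv ℝ (g ∘ Prod.fst) z v = _
  rw [this.fderiv]
  rfl

theorem isShear_kick {W : Conf n → ℝ} (hW : ContDiff ℝ ∞ W) : IsShear (kick W) := by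
  have hg := contDiff_gradient hW
  have hsm : ContDiff ℝ ∞ (kick W) :=
    contDiff_const.prodMk ((hg.comp contDiff_fst).const_smul (1 / (2 * Real.pi))).neg
  set G : Conf n → Phase n := fun x => (0, -((1 / (2 * Real.pi)) • gradient W x)) with hG
  have hGs : ContDiff ℝ ∞ G := contDiff_const.prodMk (hg.const_smul (1 / (2 * Real.pi))).neg
  have hfd : ∀ z v, fderiv ℝ (kick W) z v = fderiv ℝ G z.1 v.1 := fun z v =>
    fderiv_comp_fst (hGs.differentiable (by simp)).differentiableAt v
  have hfst : ∀ (s : ℝ) (z : Phase n), (z + s • kick W z).1 = z.1 := fun s z => by simp [kick]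
  refine ⟨hsm, fun s z => ?_, fun s => ?_, fun s z => ?_, fun σ τ z => ?_⟩
  · simp [kick]
  · have h1 : MeasurePreserving (fun p : Conf n × Conf n =>
        (p.1, p.2 + s • -((1 / (2 * Real.pi)) • gradient W p.1)))
        ((volume : Measure (Conf n)).prod volume) ((volume : Measure (Conf n)).prod volume) := by
      refine (MeasurePreserving.id (volume : Measure (Conf n))).skew_product
        (g := fun x k => k + s • -((1 / (2 * Real.pi)) • gradient W x)) ?_ ?_
      · exact (continuous_snd.add (((hg.continuous.comp continuous_fst).const_smul
          (1 / (2 * Real.pi))).neg.const_smul s)).measurable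
      · exact Eventually.of_forall fun x => (measurePreserving_add_right _ _).map_eq
    have he : (fun z => z + s • kick W z) =
        fun p => (p.1, p.2 + s • -((1 / (2 * Real.pi)) • gradient W p.1)) := by
      funext z
      ext1 <;> simp [kick]
    rw [he]
    exact h1
  · refine ContinuousLinearMap.ext fun v => ?_
    rw [hfd, hfd, hfst]
  · have : (fun z => coord n τ (fderiv ℝ (kick W) z (dir n σ))) =
        fun z : Phase n => coordL n τ (fderiv ℝ G z.1 (dir n σ).1) := by
      funext z
      rw [hfd, coordL_apply]
    have hd : DifferentiableAt ℝ (fun x => coordL n τ (fderiv ℝ G x (dir n σ).1)) z.1 := by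
      have := ((hGs.fderiv_right (m := ∞) (by simp)).clm_apply
        (contDiff_const (c := (dir n σ).1)))
      exact (((coordL n τ).contDiff.comp this).differentiable (by simp)).differentiableAt
    rw [this]
    rcases τ with i | i
    · have h0 : (fun z : Phase n => coordL n (Sum.inl i) (fderiv ℝ G z.1 (dir n σ).1)) =
          fun _ => 0 := by
        funext z
        rw [← hfd z (dir n σ), coordL_apply]
        have := coef_eq hsm σ (Sum.inl i) z
        rw [coef] at this
        rw [this]
        simp [coord, kick]
      rw [h0]
      simp
    · rw [fderiv_comp_fst hd]
      simp [dir]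

theorem isShear_drift : IsShear (drift (n := n)) := by
  set D : Phase n →L[ℝ] Phase n :=
    (((2 * Real.pi) • ContinuousLinearMap.snd ℝ (Conf n) (Conf n)).prod 0) with hD
  have hDd : drift (n := n) = D := by
    funext z
    ext1 <;> simp [drift, hD]
  refine ⟨hDd ▸ D.contDiff, fun s z => by simp [drift], fun s => ?_, fun s z => ?_,
    fun σ τ z => ?_⟩
  · have h1 : MeasurePreserving (fun p : Conf n × Conf n =>
        (p.1, p.2 + s • ((2 * Real.pi) • p.1)))
        ((volume : Measure (Conf n)).prod volume) ((volume : Measure (Conf n)).prod volume) := by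
      refine (MeasurePreserving.id (volume : Measure (Conf n))).skew_product
        (g := fun x k => k + s • ((2 * Real.pi) • x)) ?_ ?_
      · exact (continuous_snd.add ((continuous_fst.const_smul
          (2 * Real.pi)).const_smul s)).measurable
      · exact Eventually.of_forall fun x => (measurePreserving_add_right _ _).map_eq
    have h2 := (Measure.measurePreserving_swap (μ := (volume : Measure (Conf n)))
      (ν := (volume : Measure (Conf n))))
    have h3 := h2.comp (h1.comp h2)
    have he : (fun z : Phase n => z + s • drift z) = Prod.swap ∘
        (fun p : Conf n × Conf n => (p.1, p.2 + s • ((2 * Real.pi) • p.1))) ∘ Prod.swap := by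
      funext z
      ext1 <;> simp [drift]
    rw [he]
    exact h3
  · rw [hDd, D.fderiv, D.fderiv]
  · rw [hDd]
    simp

/-! ### Uniform bounds for the coefficients -/

section Bounds

variable {κ : Type*}

theorem UnifBdd.of_conf {j : ℕ} {g : κ → Conf n → ℝ} (hg : ∀ i, ContDiff ℝ ∞ (g i))
    (h : ∀ w : List (Fin n), w.length ≤ j → ∃ M, ∀ i x, |pd (ebasis n) w (g i) x| ≤ M) :
    UnifBdd j fun i (z : Phase n) => g i z.1 := by
  induction j generalizing g with
  | zero =>
    obtain ⟨M, hM⟩ := h [] le_rfl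
    exact ⟨fun i => (hg i).comp contDiff_fst, M, fun i z => hM i z.1⟩
  | succ j ih =>
    obtain ⟨M, hM⟩ := h [] (Nat.zero_le _)
    refine ⟨⟨fun i => (hg i).comp contDiff_fst, M, fun i z => hM i z.1⟩, fun σ => ?_⟩
    have hd : ∀ i (z : Phase n), fderiv ℝ (fun z : Phase n => g i z.1) z (dir n σ) =
        fderiv ℝ (g i) z.1 (dir n σ).1 := fun i z =>
      fderiv_comp_fst ((hg i).differentiable (by simp)).differentiableAt _
    simp only [hd]
    rcases σ with l | l
    · refine ih (fun i => contDiff_fderiv_apply (hg i) _) fun w hw => ?_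
      obtain ⟨M, hM⟩ := h (w ++ [l]) (by simpa using hw)
      refine ⟨M, fun i x => ?_⟩
      have := hM i x
      rw [pd_append] at this
      exact this
    · simpa [dir] using UnifBdd.const (n := n) j (s := fun _ : κ => 0) (M := 0) (by simp)

theorem unifBdd_coef_drift (j : ℕ) (σ τ : Ix n) :
    UnifBdd j fun _ : κ => coef (drift (n := n)) σ τ := by
  have : ∀ z, coef (drift (n := n)) σ τ z = coef (drift (n := n)) σ τ 0 := by
    intro z
    have h := isShear_drift (n := n)
    set D : Phase n →L[ℝ] Phase n :=
      (((2 * Real.pi) • ContinuousLinearMap.snd ℝ (Conf n) (Conf n)).prod 0) with hD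
    have hDd : drift (n := n) = D := by
      funext z
      ext1 <;> simp [drift, hD]
    simp only [coef, hDd, D.fderiv]
  have h2 := UnifBdd.const (n := n) j (s := fun _ : κ => coef (drift (n := n)) σ τ 0)
    (M := |coef (drift (n := n)) σ τ 0|) (fun _ => le_rfl)
  convert h2 using 3 with i z
  exact this z

theorem unifBdd_coef_kick {W : κ → Conf n → ℝ} (hW : ∀ i, ContDiff ℝ ∞ (W i)) {j : ℕ}
    (h : ∀ w : List (Fin n), 2 ≤ w.length → w.length ≤ j + 2 →
      ∃ M, ∀ i x, |pd (ebasis n) w (W i) x| ≤ M) (σ τ : Ix n) :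
    UnifBdd j fun i => coef (kick (W i)) σ τ := by
  have hc : ∀ i z, coef (kick (W i)) σ τ z =
      fderiv ℝ (fun z => coord n τ (kick (W i) z)) z (dir n σ) := fun i z =>
    coef_eq (isShear_kick (hW i)).smooth σ τ z
  have hzero : UnifBdd j fun (_ : κ) (_ : Phase n) => (0 : ℝ) :=
    UnifBdd.const j (s := fun _ : κ => 0) (M := 0) (by simp)
  rcases τ with a | a
  · convert hzero using 3 with i z
    rw [hc]
    simp [coord, kick]
  · have hk : ∀ i, (fun z => coord n (Sum.inr a) (kick (W i) z)) =
        fun z : Phase n => (-(1 / (2 * Real.pi))) * fderiv ℝ (W i) z.1 (ebasis n a) := by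
      intro i
      funext z
      simp [coord, kick, gradient_apply]
    have hd : ∀ i (z : Phase n), coef (kick (W i)) σ (Sum.inr a) z = (-(1 / (2 * Real.pi))) *
        fderiv ℝ (fun x => fderiv ℝ (W i) x (ebasis n a)) z.1 (dir n σ).1 := by
      intro i z
      have hs := (contDiff_fderiv_apply (hW i) (ebasis n a)).differentiable (by simp)
      rw [hc, hk, fderiv_comp_fst (g := fun x => (-(1 / (2 * Real.pi))) *
        fderiv ℝ (W i) x (ebasis n a)) (hs.differentiableAt.const_mul _),
        fderiv_const_mul hs.differentiableAt]
      rfl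
    rcases σ with b | b
    · have h1 : UnifBdd j fun i (z : Phase n) => pd (ebasis n) [b, a] (W i) z.1 := by
        refine UnifBdd.of_conf (fun i => contDiff_pd _ _ (hW i)) fun w hw => ?_
        obtain ⟨M, hM⟩ := h (w ++ [b, a]) (by simp) (by simpa using hw)
        refine ⟨M, fun i x => ?_⟩
        have := hM i x
        rwa [pd_append] at this
      have h2 := (UnifBdd.const (n := n) j (s := fun _ : κ => -(1 / (2 * Real.pi)))
        (M := |-(1 / (2 * Real.pi))|) (fun _ => le_rfl)).mul h1
      convert h2 using 3 with i z
      rw [hd]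
      rfl
    · convert hzero using 3 with i z
      rw [hd]
      simp [dir]

end Bounds

end Liouville

end

noncomputable section

namespace Liouville

open Filter Topology

variable {n : ℕ}

/-! ### The splitting scheme -/

/-- One step of the splitting scheme. -/
def stepMap (W : Conf n → ℝ) (h : ℝ) (z : Phase n) : Phase n :=
  (z + h • kick W z) + h • drift (z + h • kick W z)

/-- The inverse of one step of the splitting scheme. -/
def stepInv (W : Conf n → ℝ) (h : ℝ) (z : Phase n) : Phase n :=
  (z + (-h) • drift z) + (-h) • kick W (z + (-h) • drift z)

theorem norm_kick_sub_le (W W' : Conf n → ℝ) (z z' : Phase n) :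
    ‖kick W z - kick W' z'‖ ≤ ‖gradient W z.1 - gradient W' z'.1‖ := by
  have h1 : kick W z - kick W' z' =
      (0, -((1 / (2 * Real.pi)) • (gradient W z.1 - gradient W' z'.1))) := by
    ext1
    · simp [kick]
    · simp only [kick, Prod.snd_sub, smul_sub]
      abel
  have h2 : |1 / (2 * Real.pi)| ≤ 1 := by
    rw [abs_of_pos (by positivity), div_le_one (by positivity)]
    linarith [Real.pi_gt_three]
  rw [h1, Prod.norm_mk, norm_zero, norm_neg, norm_smul, Real.norm_eq_abs,
    max_eq_right (by positivity)]
  exact mul_le_of_le_one_left (norm_nonneg _) h2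

theorem norm_kick_le (W : Conf n → ℝ) (z : Phase n) : ‖kick W z‖ ≤ ‖gradient W z.1‖ := by
  have h0 : gradient (fun _ : Conf n => (0 : ℝ)) z.1 = 0 := by simp [gradient]
  have := norm_kick_sub_le W (fun _ => 0) z z
  rwa [h0, sub_zero, show kick (fun _ : Conf n => (0 : ℝ)) z = 0 by simp [kick, h0], sub_zero]
    at this

theorem norm_drift_sub_le (z z' : Phase n) :
    ‖drift z - drift z'‖ ≤ 2 * Real.pi * ‖z - z'‖ := by
  have h1 : drift z - drift z' = ((2 * Real.pi) • (z - z').2, 0) := by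
    ext1 <;> simp [drift, smul_sub]
  rw [h1, Prod.norm_mk, norm_zero, norm_smul, Real.norm_eq_abs, abs_of_pos (by positivity),
    max_eq_left (by positivity)]
  exact mul_le_mul_of_nonneg_left (norm_snd_le _) (by positivity)

section Orbits

variable {W : Conf n → ℝ} {M h : ℝ}

theorem stepMap_snd (W : Conf n → ℝ) (h : ℝ) (z : Phase n) :
    (stepMap W h z).2 = z.2 + h • (kick W z).2 := by simp [stepMap, drift]

theorem stepMap_fst (W : Conf n → ℝ) (h : ℝ) (z : Phase n) :
    (stepMap W h z).1 = z.1 + h • ((2 * Real.pi) • (stepMap W h z).2) := by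
  simp [stepMap, drift, kick]

theorem stepMap_bounds (hM : ∀ x, ‖gradient W x‖ ≤ M) (hh : 0 ≤ h) (z : Phase n) :
    ‖(stepMap W h z).2 - z.2‖ ≤ h * M ∧
      ‖(stepMap W h z).1 - z.1‖ ≤ h * (2 * Real.pi * ‖(stepMap W h z).2‖) := by
  constructor
  · rw [stepMap_snd, add_sub_cancel_left, norm_smul, Real.norm_eq_abs, abs_of_nonneg hh]
    exact mul_le_mul_of_nonneg_left ((norm_snd_le _).trans ((norm_kick_le W z).trans (hM _))) hh
  · rw [stepMap_fst, add_sub_cancel_left, norm_smul, norm_smul, Real.norm_eq_abs, Real.norm_eq_abs,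
      abs_of_nonneg hh, abs_of_pos (by positivity)]

/-- A bound for the orbits, up to the time `t`, of points of norm at most `r`. -/
def orbitBound (M t r : ℝ) : ℝ := r + t * M + 2 * Real.pi * t * (r + t * M)

theorem norm_le_orbitBound {z : Phase n} {r s t : ℝ} (hM : 0 ≤ M) (hr : 0 ≤ r) (hs : 0 ≤ s)
    (hst : s ≤ t) (h2 : ‖z.2‖ ≤ r + s * M)
    (h1 : ‖z.1‖ ≤ r + s * (2 * Real.pi * (r + s * M))) : ‖z‖ ≤ orbitBound M t r := by
  have ht : 0 ≤ t := hs.trans hst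
  have e1 : s * M ≤ t * M := mul_le_mul_of_nonneg_right hst hM
  have e2 : s * (2 * Real.pi * (r + s * M)) ≤ t * (2 * Real.pi * (r + t * M)) := by
    gcongr
  have e3 : 0 ≤ t * (2 * Real.pi * (r + t * M)) := by positivity
  have e4 : 0 ≤ t * M := by positivity
  rw [orbitBound, Prod.norm_def]
  refine max_le ?_ ?_ <;> linarith

theorem backward_bounds (hM : ∀ x, ‖gradient W x‖ ≤ M) (hh : 0 ≤ h) {r : ℝ} (j : ℕ) (z : Phase n) (hz : ‖(stepMap W h)^[j] z‖ ≤ r) :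
    ‖z.2‖ ≤ r + j * h * M ∧ ‖z.1‖ ≤ r + j * h * (2 * Real.pi * (r + j * h * M)) := by
  have hM0 : 0 ≤ M := (norm_nonneg _).trans (hM 0)
  induction j generalizing z with
  | zero =>
    simp only [Function.iterate_zero, id] at hz
    simpa using ⟨(norm_snd_le z).trans hz, (norm_fst_le z).trans hz⟩
  | succ j ih =>
    rw [Function.iterate_succ_apply] at hz
    obtain ⟨i2, i1⟩ := ih _ hz
    obtain ⟨b2, b1⟩ := stepMap_bounds hM hh z
    have c2 : ‖z.2‖ ≤ ‖(stepMap W h z).2‖ + h * M := by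
      have := norm_sub_norm_le z.2 (stepMap W h z).2
      rw [norm_sub_rev] at this
      linarith
    have c1 : ‖z.1‖ ≤ ‖(stepMap W h z).1‖ + h * (2 * Real.pi * ‖(stepMap W h z).2‖) := by
      have := norm_sub_norm_le z.1 (stepMap W h z).1
      rw [norm_sub_rev] at this
      linarith
    push_cast
    refine ⟨by linarith, ?_⟩
    have e1 : h * (2 * Real.pi * ‖(stepMap W h z).2‖) ≤
        h * (2 * Real.pi * (r + (j + 1) * h * M)) := by
      gcongr
      nlinarith [mul_nonneg hh hM0]
    have e2 : j * h * (2 * Real.pi * (r + j * h * M)) ≤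
        j * h * (2 * Real.pi * (r + (j + 1) * h * M)) := by
      gcongr
      linarith
    linarith

theorem forward_bounds (hM : ∀ x, ‖gradient W x‖ ≤ M) (hh : 0 ≤ h) {r : ℝ} (j : ℕ) (z : Phase n) (hz : ‖z‖ ≤ r) :
    ‖((stepMap W h)^[j] z).2‖ ≤ r + j * h * M ∧
      ‖((stepMap W h)^[j] z).1‖ ≤ r + j * h * (2 * Real.pi * (r + j * h * M)) := by
  have hM0 : 0 ≤ M := (norm_nonneg _).trans (hM 0)
  induction j with
  | zero => simpa using ⟨(norm_snd_le z).trans hz, (norm_fst_le z).trans hz⟩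
  | succ j ih =>
    rw [Function.iterate_succ_apply']
    obtain ⟨i2, i1⟩ := ih
    set y := (stepMap W h)^[j] z
    obtain ⟨b2, b1⟩ := stepMap_bounds hM hh y
    have c2 : ‖(stepMap W h y).2‖ ≤ ‖y.2‖ + h * M := by
      have := norm_sub_norm_le (stepMap W h y).2 y.2
      linarith
    have c1 : ‖(stepMap W h y).1‖ ≤ ‖y.1‖ + h * (2 * Real.pi * ‖(stepMap W h y).2‖) := by
      have := norm_sub_norm_le (stepMap W h y).1 y.1
      linarith
    push_cast
    have d2 : ‖(stepMap W h y).2‖ ≤ r + (j + 1) * h * M := by linarith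
    refine ⟨d2, ?_⟩
    have e1 : h * (2 * Real.pi * ‖(stepMap W h y).2‖) ≤
        h * (2 * Real.pi * (r + (j + 1) * h * M)) := by
      gcongr
    have e2 : j * h * (2 * Real.pi * (r + j * h * M)) ≤
        j * h * (2 * Real.pi * (r + (j + 1) * h * M)) := by
      gcongr
      linarith
    linarith

theorem stepMap_sub_lipschitz {L r : ℝ} (hh : 0 ≤ h) (hL0 : 0 ≤ L)
    (hL : ∀ x x', ‖x‖ ≤ r → ‖x'‖ ≤ r → ‖gradient W x - gradient W x'‖ ≤ L * ‖x - x'‖)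
    {z z' : Phase n} (hz : ‖z‖ ≤ r) (hz' : ‖z'‖ ≤ r) :
    ‖(stepMap W h z - z) - (stepMap W h z' - z')‖ ≤
      (L + 2 * Real.pi * (1 + h * L)) * h * ‖z - z'‖ := by
  have hk : ‖kick W z - kick W z'‖ ≤ L * ‖z - z'‖ := by
    refine (norm_kick_sub_le W W z z').trans ((hL _ _ ((norm_fst_le z).trans hz)
      ((norm_fst_le z').trans hz')).trans (mul_le_mul_of_nonneg_left ?_ hL0))
    exact norm_fst_le (z - z')
  have e1 : (stepMap W h z - z) - (stepMap W h z' - z') = h • (kick W z - kick W z') +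
      h • (drift (z + h • kick W z) - drift (z' + h • kick W z')) := by
    simp only [stepMap, smul_sub]
    abel
  have e2 : z + h • kick W z - (z' + h • kick W z') = (z - z') + h • (kick W z - kick W z') := by
    rw [smul_sub]
    abel
  have e3 : ‖z + h • kick W z - (z' + h • kick W z')‖ ≤ ‖z - z'‖ + h * (L * ‖z - z'‖) := by
    rw [e2]
    refine (norm_add_le _ _).trans (add_le_add le_rfl ?_)
    rw [norm_smul, Real.norm_eq_abs, abs_of_nonneg hh]
    exact mul_le_mul_of_nonneg_left hk hh
  rw [e1]
  refine (norm_add_le _ _).trans ?_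
  rw [norm_smul, norm_smul, Real.norm_eq_abs, abs_of_nonneg hh]
  calc h * ‖kick W z - kick W z'‖ + h * ‖drift (z + h • kick W z) - drift (z' + h • kick W z')‖
      ≤ h * (L * ‖z - z'‖) + h * (2 * Real.pi * (‖z - z'‖ + h * (L * ‖z - z'‖))) := by
        gcongr
        exact (norm_drift_sub_le _ _).trans (mul_le_mul_of_nonneg_left e3 (by positivity))
    _ = _ := by ring

theorem stepMap_consistent (hM : ∀ x, ‖gradient W x‖ ≤ M) (hh : 0 ≤ h) (V : Conf n → ℝ)
    {θ : ℝ} {z : Phase n} (hθ : ‖gradient W z.1 - gradient V z.1‖ ≤ θ) :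
    ‖stepMap W h z - z - h • field V z‖ ≤ h * (θ + 2 * Real.pi * M * h) := by
  have e1 : stepMap W h z - z - h • field V z = h • (kick W z - kick V z) +
      h • (drift (z + h • kick W z) - drift z) := by
    simp only [stepMap, field_eq, smul_sub, smul_add]
    abel
  rw [e1]
  refine (norm_add_le _ _).trans ?_
  rw [norm_smul, norm_smul, Real.norm_eq_abs, abs_of_nonneg hh, mul_add]
  refine add_le_add (mul_le_mul_of_nonneg_left ((norm_kick_sub_le W V z z).trans hθ) hh)
    (mul_le_mul_of_nonneg_left ((norm_drift_sub_le _ _).trans ?_) hh)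
  rw [add_sub_cancel_left, norm_smul, Real.norm_eq_abs, abs_of_nonneg hh]
  calc 2 * Real.pi * (h * ‖kick W z‖) ≤ 2 * Real.pi * (h * M) := by
        gcongr
        exact (norm_kick_le W z).trans (hM _)
    _ = 2 * Real.pi * M * h := by ring

end Orbits

/-- A test function composed with maps that are Lipschitz near the ball supporting the composition
is globally Lipschitz. -/
theorem abs_sub_le_of_supp {G : Phase n → ℝ} {R b Λ : ℝ} (hs : ∀ z, G z ≠ 0 → ‖z‖ ≤ R)
    (hb : ∀ z, |G z| ≤ b) (hΛ : 0 ≤ Λ)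
    (hL : ∀ z z', ‖z‖ ≤ R + 2 → ‖z'‖ ≤ R + 2 → |G z - G z'| ≤ Λ * ‖z - z'‖) (z z' : Phase n) :
    |G z - G z'| ≤ (Λ + b) * ‖z - z'‖ := by
  have hb0 : 0 ≤ b := (abs_nonneg _).trans (hb 0)
  have key : ∀ y y' : Phase n, R + 2 < ‖y'‖ → |G y - G y'| ≤ (Λ + b) * ‖y - y'‖ := by
    intro y y' hy'
    have h1 : G y' = 0 := by
      by_contra h
      linarith [hs y' h]
    rw [h1, sub_zero]
    by_cases h2 : G y = 0
    · rw [h2, abs_zero]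
      positivity
    · have h3 := hs y h2
      have h4 := norm_sub_norm_le y' y
      rw [norm_sub_rev] at h4
      have h5 : (2 : ℝ) ≤ ‖y - y'‖ := by linarith
      nlinarith [hb y, mul_nonneg hΛ (norm_nonneg (y - y')), mul_nonneg hb0 (norm_nonneg (y - y'))]
  rcases le_or_gt ‖z‖ (R + 2) with hz | hz
  · rcases le_or_gt ‖z'‖ (R + 2) with hz' | hz'
    · refine (hL z z' hz hz').trans (mul_le_mul_of_nonneg_right ?_ (norm_nonneg _))
      linarith
    · exact key z z' hz'
  · rw [abs_sub_comm, norm_sub_rev]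
    exact key z' z hz

/-- The smooth potentials `W N` approximate `V`, with uniform bounds for the derivatives. -/
structure IsSmoothApprox (V : Conf n → ℝ) (m : ℕ) (W : ℕ → Conf n → ℝ) : Prop where
  smooth : ∀ N, ContDiff ℝ ∞ (W N)
  bound : ∃ M : ℝ, ∀ N x, ‖gradient (W N) x‖ ≤ M
  lip : ∀ r : ℝ, ∃ L : ℝ, 0 ≤ L ∧ ∀ N x x', ‖x‖ ≤ r → ‖x'‖ ≤ r →
    ‖gradient (W N) x - gradient (W N) x'‖ ≤ L * ‖x - x'‖
  tendsto : ∀ r : ℝ, ∃ θ : ℕ → ℝ, Tendsto θ atTop (𝓝 0) ∧ ∀ N x, ‖x‖ ≤ r →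
    ‖gradient (W N) x - gradient V x‖ ≤ θ N
  deriv : ∀ w : List (Fin n), 2 ≤ w.length → w.length ≤ m + 1 →
    ∃ M, ∀ N x, |pd (ebasis n) w (W N) x| ≤ M

theorem tendsto_step (t : ℝ) : Tendsto (fun N : ℕ => t / ((N : ℝ) + 1)) atTop (𝓝 0) :=
  tendsto_const_div_atTop_nhds_zero_nat t |>.comp (tendsto_add_atTop_nat 1) |>.congr
    fun N => by simp

theorem step_mul_le {t : ℝ} (ht : 0 ≤ t) {N j : ℕ} (hj : j ≤ N + 1) :
    (j : ℝ) * (t / ((N : ℝ) + 1)) ≤ t := by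
  have h1 : (j : ℝ) ≤ N + 1 := by exact_mod_cast hj
  calc (j : ℝ) * (t / ((N : ℝ) + 1)) ≤ ((N : ℝ) + 1) * (t / ((N : ℝ) + 1)) := by gcongr
    _ = t := by field_simp

theorem continuous_stepMap {W : Conf n → ℝ} (hW : ContDiff ℝ ∞ W) (h : ℝ) :
    Continuous (stepMap W h) :=
  ((isShear_drift.contDiff_map h).continuous).comp ((isShear_kick hW).contDiff_map h).continuous

theorem IsTest.exists_lipschitz {ψ : Phase n → ℝ} (hψ : IsTest ψ) :
    ∃ Λ : ℝ, 0 ≤ Λ ∧ ∀ z z', |ψ z - ψ z'| ≤ Λ * ‖z - z'‖ := by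
  obtain ⟨C, hC⟩ := ContDiff.lipschitzWith_of_hasCompactSupport (𝕂 := ℝ) (n := 1)
    hψ.2 (hψ.1.of_le (by simp)) one_ne_zero
  exact ⟨C, C.2, fun z z' => by simpa [Real.dist_eq, dist_eq_norm] using hC.dist_le_mul z z'⟩

theorem IsTest.exists_radius {ψ : Phase n → ℝ} (hψ : IsTest ψ) :
    ∃ r : ℝ, 0 ≤ r ∧ ∀ z, ψ z ≠ 0 → ‖z‖ ≤ r := by
  obtain ⟨r, hr⟩ := hψ.2.isBounded.exists_norm_le
  exact ⟨|r|, abs_nonneg r, fun z hz =>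
    (hr z (subset_tsupport ψ (Function.mem_support.2 hz))).trans (le_abs_self r)⟩

theorem IsSmoothApprox.isApproxFlow {V : Conf n → ℝ} {m : ℕ} {W : ℕ → Conf n → ℝ}
    (hW : IsSmoothApprox V m W) {ψ : Phase n → ℝ} (hψ : IsTest ψ) {t : ℝ} (ht : 0 ≤ t) :
    ∃ R, IsApproxFlow (field V) ψ t R fun N => stepMap (W N) (t / (N + 1)) := by
  obtain ⟨M, hM⟩ := hW.bound
  have hM0 : 0 ≤ M := (norm_nonneg _).trans (hM 0 0)
  obtain ⟨r, hr0, hr⟩ := hψ.exists_radius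
  obtain ⟨Λ, hΛ0, hΛ⟩ := hψ.exists_lipschitz
  obtain ⟨b, hb⟩ := hψ.2.exists_bound_of_continuous hψ.continuous
  set R := orbitBound M t r with hR
  have hR0 : 0 ≤ R := by unfold orbitBound at hR; rw [hR]; positivity
  set R' := orbitBound M t (R + 2) with hR'
  have hRR' : R + 2 ≤ R' := by
    rw [hR', orbitBound]
    have : 0 ≤ t * M + 2 * Real.pi * t * (R + 2 + t * M) := by positivity
    linarith
  obtain ⟨L, hL0, hL⟩ := hW.lip R'
  set L' := L + 2 * Real.pi * (1 + t * L) with hL'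
  have hL'0 : 0 ≤ L' := by positivity
  have hh : ∀ N : ℕ, 0 ≤ t / ((N : ℝ) + 1) := fun N => by positivity
  have hht : ∀ N : ℕ, t / ((N : ℝ) + 1) ≤ t := fun N => by
    simpa using step_mul_le ht (N := N) (j := 1) (by omega)
  have hstep : ∀ (N : ℕ) (z z' : Phase n), ‖z‖ ≤ R' → ‖z'‖ ≤ R' →
      ‖(stepMap (W N) (t / (N + 1)) z - z) - (stepMap (W N) (t / (N + 1)) z' - z')‖ ≤
        L' * (t / (N + 1)) * ‖z - z'‖ := by
    intro N z z' hz hz'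
    refine (stepMap_sub_lipschitz (hh N) hL0 (hL N) hz hz').trans ?_
    gcongr ?_ * _ * _
    rw [hL']
    gcongr
    exact hht N
  have hsupp : ∀ N j z, j ≤ N + 1 → ψ ((stepMap (W N) (t / (N + 1)))^[j] z) ≠ 0 → ‖z‖ ≤ R := by
    intro N j z hj hz
    obtain ⟨b2, b1⟩ := backward_bounds (hM N) (hh N) j z (hr _ hz)
    exact norm_le_orbitBound hM0 hr0 (mul_nonneg j.cast_nonneg (hh N)) (step_mul_le ht hj) b2 b1
  refine ⟨R, fun N => continuous_stepMap (hW.smooth N) _, hsupp, ?_, ?_, ?_⟩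
  · refine ⟨Λ * Real.exp (L' * t) + b, ?_, fun N j hj => ?_⟩
    · have : 0 ≤ b := (norm_nonneg _).trans (hb 0)
      positivity
    · refine abs_sub_le_of_supp (G := fun z => ψ ((stepMap (W N) (t / (N + 1)))^[j] z))
        (fun z hz => hsupp N j z hj hz) (fun z => hb _) (by positivity) fun z z' hz hz' => ?_
      refine (hΛ _ _).trans ?_
      rw [mul_assoc]
      refine mul_le_mul_of_nonneg_left ?_ hΛ0
      have hit : ∀ i ≤ j, ‖(stepMap (W N) (t / (N + 1)))^[i] z -
          (stepMap (W N) (t / (N + 1)))^[i] z'‖ ≤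
          (1 + L' * (t / (N + 1))) ^ i * ‖z - z'‖ := by
        intro i
        induction i with
        | zero => simp
        | succ i ih =>
          intro hi
          have ih := ih (by omega)
          have hball : ∀ y : Phase n, ‖y‖ ≤ R + 2 →
              ‖(stepMap (W N) (t / (N + 1)))^[i] y‖ ≤ R' := fun y hy => by
            obtain ⟨b2, b1⟩ := forward_bounds (hM N) (hh N) (r := R + 2) i y hy
            exact norm_le_orbitBound hM0 (by positivity) (mul_nonneg i.cast_nonneg (hh N))
              (step_mul_le ht (by omega)) b2 b1
          rw [Function.iterate_succ_apply', Function.iterate_succ_apply']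
          set y := (stepMap (W N) (t / (N + 1)))^[i] z
          set y' := (stepMap (W N) (t / (N + 1)))^[i] z'
          have h1 := hstep N y y' (hball z hz) (hball z' hz')
          have h2 : stepMap (W N) (t / (N + 1)) y - stepMap (W N) (t / (N + 1)) y' =
              ((stepMap (W N) (t / (N + 1)) y - y) - (stepMap (W N) (t / (N + 1)) y' - y')) +
              (y - y') := by abel
          rw [h2]
          refine (norm_add_le _ _).trans ?_
          have h3 : 0 ≤ 1 + L' * (t / (N + 1)) := by have := hh N; positivity
          calc _ ≤ L' * (t / (N + 1)) * ‖y - y'‖ + ‖y - y'‖ := add_le_add h1 le_rfl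
            _ = (1 + L' * (t / (N + 1))) * ‖y - y'‖ := by ring
            _ ≤ (1 + L' * (t / (N + 1))) * ((1 + L' * (t / (N + 1))) ^ i * ‖z - z'‖) := by gcongr
            _ = _ := by ring
      refine (hit j le_rfl).trans (mul_le_mul_of_nonneg_right ?_ (norm_nonneg _))
      have h4 : 1 + L' * (t / (N + 1)) ≤ Real.exp (L' * (t / (N + 1))) := by
        rw [add_comm]
        exact Real.add_one_le_exp _
      have h3 : 0 ≤ 1 + L' * (t / (N + 1)) := by have := hh N; positivity
      refine (pow_le_pow_left₀ h3 h4 j).trans ?_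
      rw [← Real.exp_nat_mul]
      refine Real.exp_le_exp.2 ?_
      have := mul_le_mul_of_nonneg_left (step_mul_le ht hj) hL'0
      linarith
  · exact ⟨L', hL'0, fun N z z' hz hz' => hstep N z z' (hz.trans hRR') (hz'.trans hRR')⟩
  · obtain ⟨θ, hθ, hθ'⟩ := hW.tendsto (R + 2)
    refine ⟨fun N => θ N + 2 * Real.pi * M * (t / (N + 1)), ?_, fun N z hz => ?_⟩
    · simpa using hθ.add ((tendsto_step t).const_mul (2 * Real.pi * M))
    · exact stepMap_consistent (hM N) (hh N) V (hθ' N z.1 ((norm_fst_le z).trans hz))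

end Liouville

end

noncomputable section

namespace Liouville

open Filter Topology

variable {n : ℕ}

/-! ### Propagation of Sobolev regularity -/

section StepInv

variable {W : Conf n → ℝ}

theorem stepInv_stepMap (hW : ContDiff ℝ ∞ W) (h : ℝ) (z : Phase n) :
    stepInv W h (stepMap W h z) = z := by
  have h1 := (isShear_drift (n := n)).inv h (z + h • kick W z)
  have h2 := (isShear_kick hW).inv h z
  have h3 : stepMap W h z + (-h) • drift (stepMap W h z) = z + h • kick W z := by
    rw [stepMap, h1, neg_smul, add_neg_cancel_right]
  rw [stepInv, h3, h2, neg_smul, add_neg_cancel_right]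

theorem measurePreserving_stepInv (hW : ContDiff ℝ ∞ W) (h : ℝ) :
    MeasurePreserving (stepInv W h) :=
  ((isShear_kick hW).mp (-h)).comp (isShear_drift.mp (-h))

theorem integral_comp_stepMap (hW : ContDiff ℝ ∞ W) (h : ℝ) (g : Phase n → ℂ) :
    ∫ z, g (stepMap W h z) = ∫ z, g z := by
  rw [← isShear_drift.integral_comp h g,
    ← (isShear_kick hW).integral_comp h fun z => g (z + h • drift z)]
  rfl

theorem integral_iterate_stepMap (hW : ContDiff ℝ ∞ W) (h : ℝ) (ψ : Phase n → ℝ) (j : ℕ)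
    (g : Phase n → ℂ) :
    ∫ z, ψ ((stepMap W h)^[j] z) • g z = ∫ z, ψ z • g ((stepInv W h)^[j] z) := by
  induction j generalizing g with
  | zero => rfl
  | succ j ih =>
    have h1 := integral_comp_stepMap hW h
      fun z => ψ ((stepMap W h)^[j] z) • g (stepInv W h z)
    simp only [stepInv_stepMap hW] at h1
    simp only [Function.iterate_succ_apply' (stepInv W h)]
    rw [← ih fun z => g (stepInv W h z), ← h1]
    simp only [Function.iterate_succ_apply]

end StepInv

theorem IsSmoothApprox.exists_sobolevNorm_stepInv_le {V : Conf n → ℝ} {m : ℕ}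
    {W : ℕ → Conf n → ℝ} (hW : IsSmoothApprox V m W) :
    ∃ C : ℝ, 0 ≤ C ∧ ∀ (N : ℕ) (s : ℝ), 0 ≤ s → s ≤ 1 → ∀ f : Phase n → ℂ,
      sobolevNorm m (fun z => f (stepInv (W N) s z)) ≤
        ENNReal.ofReal (Real.exp (s * C)) * sobolevNorm m f := by
  have hk : ∀ j < m, ∀ σ τ, UnifBdd j fun i : ℕ × Set.Icc (-1 : ℝ) 1 =>
      coef (kick (W i.1)) σ τ := by
    intro j hj σ τ
    refine unifBdd_coef_kick (W := fun i : ℕ × Set.Icc (-1 : ℝ) 1 => W i.1)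
      (fun i => hW.smooth i.1) (fun w hw hw' => ?_) σ τ
    obtain ⟨M, hM⟩ := hW.deriv w hw (by omega)
    exact ⟨M, fun i x => hM i.1 x⟩
  obtain ⟨C₁, h1, H1⟩ := exists_sobolevNorm_comp_shear_le (n := n) m
    (Y := fun i : ℕ × Set.Icc (-1 : ℝ) 1 => kick (W i.1)) (s := fun i => (i.2 : ℝ))
    (fun i => isShear_kick (hW.smooth i.1)) (fun i => abs_le.2 i.2.2) hk
  obtain ⟨C₂, h2, H2⟩ := exists_sobolevNorm_comp_shear_le (n := n) m
    (Y := fun _ : ℕ × Set.Icc (-1 : ℝ) 1 => drift) (s := fun i => (i.2 : ℝ))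
    (fun i => isShear_drift) (fun i => abs_le.2 i.2.2) (fun j hj σ τ => unifBdd_coef_drift j σ τ)
  refine ⟨C₂ + C₁, add_nonneg h2 h1, fun N s hs0 hs1 f => ?_⟩
  have hs : -s ∈ Set.Icc (-1 : ℝ) 1 := ⟨by linarith, by linarith⟩
  have b1 := H1 (N, ⟨-s, hs⟩) f
  have b2 := H2 (N, ⟨-s, hs⟩) fun z => f (z + (-s) • kick (W N) z)
  simp only [abs_neg, abs_of_nonneg hs0] at b1 b2
  have he : ∀ C : ℝ, ENNReal.ofReal (1 + s * C) ≤ ENNReal.ofReal (Real.exp (s * C)) := fun C =>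
    ENNReal.ofReal_le_ofReal (by rw [add_comm]; exact Real.add_one_le_exp _)
  rw [mul_add, Real.exp_add, ENNReal.ofReal_mul (Real.exp_nonneg _), mul_assoc]
  exact b2.trans (mul_le_mul' (he C₂) (b1.trans (mul_le_mul' (he C₁) le_rfl)))

/-- Weak solutions of the (inhomogeneous) Liouville equation stay in `H^m`. -/
theorem IsSmoothApprox.exists_sobolevNorm_le {V : Conf n → ℝ} (hV : ContDiff ℝ 1 V) {m : ℕ}
    {W : ℕ → Conf n → ℝ} (hW : IsSmoothApprox V m W) :
    ∃ C : ℝ, 0 ≤ C ∧ ∀ (t : ℝ), 0 ≤ t → ∀ (f : PhaseL2 n) (u : ℝ → PhaseL2 n),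
      IsWeakSolution (field V) f t u →
      sobolevNorm m (u t) ≤ ENNReal.ofReal (Real.exp (t * C)) *
        (sobolevNorm m (u 0) + ENNReal.ofReal t * sobolevNorm m f) := by
  obtain ⟨C, hC0, hC⟩ := hW.exists_sobolevNorm_stepInv_le
  refine ⟨C, hC0, fun t ht f u hu => ?_⟩
  rcases ht.eq_or_lt with rfl | ht'
  · simp
  rcases eq_or_ne (sobolevNorm m f) ⊤ with hf | hf
  · rw [hf, ENNReal.mul_top (by simpa using ht'), add_top, ENNReal.mul_top
      (by simpa using Real.exp_pos _)]
    exact le_top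
  obtain ⟨N₀, hN₀⟩ : ∃ N₀ : ℕ, ∀ N : ℕ, t / (((N + N₀ : ℕ) : ℝ) + 1) ≤ 1 := by
    obtain ⟨N₀, h⟩ := exists_nat_gt t
    refine ⟨N₀, fun N => (div_le_one (by positivity)).2 ?_⟩
    push_cast
    have := N.cast_nonneg (α := ℝ)
    linarith
  have hit : ∀ (N : ℕ) (s : ℝ), 0 ≤ s → s ≤ 1 → ∀ (j : ℕ) (g : Phase n → ℂ),
      sobolevNorm m (fun z => g ((stepInv (W N) s)^[j] z)) ≤
        ENNReal.ofReal (Real.exp (j * s * C)) * sobolevNorm m g := by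
    intro N s hs0 hs1 j g
    induction j with
    | zero => simp
    | succ j ih =>
      have h1 := hC N s hs0 hs1 fun z => g ((stepInv (W N) s)^[j] z)
      simp only [← Function.iterate_succ_apply] at h1
      refine h1.trans ((mul_le_mul' le_rfl ih).trans_eq ?_)
      rw [← mul_assoc, ← ENNReal.ofReal_mul (Real.exp_nonneg _), ← Real.exp_add]
      congr 3
      push_cast
      ring
  set h : ℕ → ℝ := fun N => t / ((N : ℝ) + 1) with hh
  have hh0 : ∀ N, 0 ≤ h N := fun N => by positivity
  set vN : ℕ → Phase n → ℂ := fun N z => u 0 ((stepInv (W N) (h N))^[N + 1] z) +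
    ∑ j ∈ Finset.range (N + 1), h N • f ((stepInv (W N) (h N))^[j] z) with hvN
  refine sobolevNorm_le_of_tendsto (memLp_locInt (Lp.memLp (u t))) (vN := fun N => vN (N + N₀))
    (fun N => ?_) fun ψ hψ => ?_
  · generalize hM : N + N₀ = M
    have hM1 : h M ≤ 1 := by
      rw [← hM]
      exact hN₀ N
    have hexp : ∀ j ≤ M + 1, ∀ g : Phase n → ℂ,
        sobolevNorm m (fun z => g ((stepInv (W M) (h M))^[j] z)) ≤
        ENNReal.ofReal (Real.exp (t * C)) * sobolevNorm m g := fun j hj g =>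
      (hit M (h M) (hh0 M) hM1 j g).trans (mul_le_mul' (ENNReal.ofReal_le_ofReal
        (Real.exp_le_exp.2 (mul_le_mul_of_nonneg_right (step_mul_le ht hj) hC0))) le_rfl)
    refine (sobolevNorm_add_le m _ _).trans ?_
    rw [mul_add]
    refine add_le_add (hexp _ le_rfl _) ((sobolevNorm_sum_le m _ _).trans ?_)
    have hterm : ∀ j ∈ Finset.range (M + 1),
        sobolevNorm m (fun z => h M • f ((stepInv (W M) (h M))^[j] z)) ≤
        ENNReal.ofReal (h M) * (ENNReal.ofReal (Real.exp (t * C)) * sobolevNorm m f) := by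
      intro j hj
      have h1 := hexp j (Finset.mem_range.1 hj).le f
      refine (sobolevNorm_smul_le m _ _ (h1.trans_lt
        (ENNReal.mul_lt_top ENNReal.ofReal_lt_top hf.lt_top))).trans ?_
      rw [abs_of_nonneg (hh0 M)]
      exact mul_le_mul' le_rfl h1
    refine (Finset.sum_le_sum hterm).trans ?_
    rw [Finset.sum_const, Finset.card_range, nsmul_eq_mul, ← mul_assoc]
    have : ((M + 1 : ℕ) : ℝ≥0∞) * ENNReal.ofReal (h M) = ENNReal.ofReal t := by
      rw [← ENNReal.ofReal_natCast, ← ENNReal.ofReal_mul (Nat.cast_nonneg _)]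
      congr 1
      rw [hh]
      push_cast
      field_simp
    rw [this, mul_left_comm]
  · obtain ⟨R, hR⟩ := hW.isApproxFlow hψ ht
    have hmain := hu.tendsto_duality (continuous_field hV) ht hψ hR
    refine (tendsto_add_atTop_iff_nat (f := fun N => ∫ z, ψ z • vN N z) N₀).2
      (hmain.congr fun N => ?_)
    have hmp : ∀ j (g : PhaseL2 n), MemLp (fun z => g ((stepInv (W N) (h N))^[j] z)) 2 volume :=
      fun j g => (Lp.memLp g).comp_measurePreserving
        ((measurePreserving_stepInv (hW.smooth N) (h N)).iterate j)
    have hi : ∀ j (g : PhaseL2 n), Integrable (fun z => ψ z • g ((stepInv (W N) (h N))^[j] z))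
        volume := fun j g => hψ.integrable_smul (memLp_locInt (hmp j g))
    have hi' : ∀ j, Integrable (fun z => h N • ψ z • f ((stepInv (W N) (h N))^[j] z)) volume :=
      fun j => (hi j f).smul (h N)
    simp only [hvN, smul_add, Finset.smul_sum, smul_comm (ψ _) (h N)]
    rw [integral_add (hi _ _) (integrable_finsetSum _ fun j _ => hi' j),
      integral_finsetSum _ fun j _ => hi' j]
    rw [integral_iterate_stepMap (hW.smooth N)]
    refine congr_arg₂ _ rfl (Finset.sum_congr rfl fun j _ => ?_)
    rw [integral_iterate_stepMap (hW.smooth N), integral_smul, Complex.real_smul]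

theorem pair_zero (φ : Phase n → ℝ) : ∫ z, φ z • (0 : PhaseL2 n) z = 0 := by
  rw [integral_congr_ae (g := fun _ => (0 : ℂ))]
  · simp
  · filter_upwards [Lp.coeFn_zero ℂ 2 (volume : Measure (Phase n))] with z hz
    rw [hz, Pi.zero_apply, smul_zero]

theorem IsSolution.isWeakSolution {V : Conf n → ℝ} {T : ℝ} {ρ₀ : PhaseL2 n} {ρ : ℝ → PhaseL2 n}
    (h : IsSolution V T ρ₀ ρ) {t : ℝ} (ht : t ≤ T) : IsWeakSolution (field V) 0 t ρ := by
  refine ⟨h.continuousOn.mono (Set.Icc_subset_Icc_right ht), fun φ hφ s hs => ?_⟩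
  rw [h.initial, h.weak φ hφ s ⟨hs.1, hs.2.trans ht⟩]
  simp only [pair_zero, add_zero]

theorem sobolevNorm_zero (m : ℕ) : sobolevNorm (n := n) m (0 : PhaseL2 n) = 0 := by
  rw [sobolevNorm_congr (Lp.coeFn_zero ℂ 2 (volume : Measure (Phase n)))]
  refine le_antisymm ((sobolevNorm_le_sum (F := fun _ _ => 0) fun w _ => isWD_zero w).trans ?_)
    zero_le
  simp

/-- Solutions of the Liouville equation stay in `H^m`. -/
theorem IsSmoothApprox.exists_isSolution_le {V : Conf n → ℝ} (hV : ContDiff ℝ 1 V) {m : ℕ}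
    {W : ℕ → Conf n → ℝ} (hW : IsSmoothApprox V m W) :
    ∃ C : ℝ, 0 < C ∧ ∀ (T : ℝ) (ρ₀ : PhaseL2 n) (ρ : ℝ → PhaseL2 n), IsSolution V T ρ₀ ρ →
      ∀ t ∈ Set.Icc 0 T, sobolevNorm m (ρ t) ≤
        ENNReal.ofReal (Real.exp (t * C)) * sobolevNorm m ρ₀ := by
  obtain ⟨C, hC0, hC⟩ := hW.exists_sobolevNorm_le hV
  refine ⟨C + 1, by linarith, fun T ρ₀ ρ hρ t ht => ?_⟩
  have h1 := hC t ht.1 0 ρ (hρ.isWeakSolution ht.2)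
  rw [sobolevNorm_zero, mul_zero, add_zero, hρ.initial] at h1
  refine h1.trans (mul_le_mul' (ENNReal.ofReal_le_ofReal (Real.exp_le_exp.2
    (mul_le_mul_of_nonneg_left ?_ ht.1))) le_rfl)
  linarith

end Liouville

end

noncomputable section

namespace Liouville

open Filter Topology

variable {n : ℕ}

/-! ### Mollified potentials -/

/-- `g` is the weak derivative, along the word `w`, of a function `U` on `ℝⁿ`. -/
def IsWDC (w : List (Fin n)) (U g : Conf n → ℝ) : Prop :=
  WeakEq (fun φ x => (-1) ^ w.length * pd (ebasis n) w φ x) U g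

theorem isWeakDerivConf_iff (a : Fin n → ℕ) (U g : Conf n → ℝ) :
    IsWeakDerivConf a U g ↔ IsWDC (canon a) U g := by
  unfold IsWeakDerivConf IsWDC
  simp only [mixedPartial_eq_pd, length_canon]

theorem IsWDC.perm {w w' : List (Fin n)} {U g : Conf n → ℝ} (h : IsWDC w U g)
    (hw : w.Perm w') : IsWDC w' U g := by
  refine ⟨h.1, h.2.1, fun φ hφ => ?_⟩
  rw [← h.2.2 φ hφ]
  simp only [pd_perm _ hw hφ.1, hw.length_eq]

theorem canon_count_perm (w : List (Fin n)) : (canon fun i => w.count i).Perm w := by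
  rw [List.perm_iff_count]
  exact count_canon _

theorem isWeakDerivConf_count (w : List (Fin n)) (U g : Conf n → ℝ) :
    IsWeakDerivConf (fun i => w.count i) U g ↔ IsWDC w U g := by
  rw [isWeakDerivConf_iff]
  exact ⟨fun h => h.perm (canon_count_perm w), fun h => h.perm (canon_count_perm w).symm⟩

theorem sum_count (w : List (Fin n)) : ∑ i, w.count i = w.length := by
  rw [← length_canon, (canon_count_perm w).length_eq]

theorem pd_moll {η G : Conf n → ℝ} (hη : IsTest η) (hG : LocallyIntegrable G volume)
    (w : List (Fin n)) : pd (ebasis n) w (moll η G) = moll (pd (ebasis n) w η) G := by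
  induction w with
  | nil => rfl
  | cons i w ih =>
    funext x
    simp only [pd, ih]
    exact fderiv_moll (hη.pd _ w) hG x _

theorem IsWDC.pd_moll {w : List (Fin n)} {U g η : Conf n → ℝ} (h : IsWDC w U g) (hη : IsTest η) :
    pd (ebasis n) w (moll η U) = moll η g := by
  rw [Liouville.pd_moll hη h.1]
  funext x
  have h1 := h.2.2 _ (hη.comp_neg_sub x)
  simp only [pd_comp_sub _ _ hη.1, ← mul_assoc, ← pow_add, ← two_mul, pow_mul, neg_one_sq,
    one_pow, one_mul, smul_eq_mul] at h1
  exact h1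

theorem abs_pd_moll_le {w : List (Fin n)} {U g η : Conf n → ℝ} {ε M : ℝ} (h : IsWDC w U g)
    (hη : IsMollifier η ε) {x : Conf n} (hM : ∀ᵐ y, ‖y‖ ≤ ‖x‖ + ε → |g y| ≤ M) :
    |pd (ebasis n) w (moll η U) x| ≤ M := by
  rw [h.pd_moll hη.test, moll, ← Real.norm_eq_abs]
  have hi : Integrable (fun y => η (x - y)) volume :=
    (hη.test.comp_neg_sub x).continuous.integrable_of_hasCompactSupport
      (hη.test.comp_neg_sub x).2
  calc ‖∫ y, η (x - y) * g y‖ ≤ ∫ y, η (x - y) * M := by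
        refine norm_integral_le_of_norm_le (hi.mul_const M) ?_
        filter_upwards [hM] with y hy
        rw [norm_mul, Real.norm_eq_abs, abs_of_nonneg (hη.nonneg _), Real.norm_eq_abs]
        rcases eq_or_ne (η (x - y)) 0 with h0 | h0
        · simp [h0]
        · refine mul_le_mul_of_nonneg_left (hy ?_) (hη.nonneg _)
          have h1 := hη.supp _ h0
          have h2 := norm_sub_norm_le y x
          rw [norm_sub_rev] at h2
          linarith
    _ = M := by
        rw [integral_mul_const, integral_sub_left_eq_self η volume x, hη.integral_eq, one_mul]

theorem isWDC_singleton {V : Conf n → ℝ} (hV : ContDiff ℝ 1 V) (l : Fin n) :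
    IsWDC [l] V fun x => fderiv ℝ V x (ebasis n l) := by
  have hc : Continuous fun x => fderiv ℝ V x (ebasis n l) :=
    (hV.continuous_fderiv one_ne_zero).clm_apply continuous_const
  refine ⟨hV.continuous.locallyIntegrable, hc.locallyIntegrable, fun φ hφ => ?_⟩
  have h1 := integral_mul_fderiv_eq_neg_fderiv_mul_of_integrable (μ := volume) (f := φ) (g := V)
    (v := ebasis n l) ((hφ.fderiv_apply _).integrable_smul hV.continuous.locallyIntegrable)
    (hφ.integrable_smul hc.locallyIntegrable)
    (hφ.integrable_smul hV.continuous.locallyIntegrable)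
    (fun x _ => (hφ.1.differentiable (by simp)).differentiableAt)
    (fun x _ => (hV.differentiable one_ne_zero).differentiableAt)
  simp only [smul_eq_mul, h1]
  simp [pd, integral_neg]

/-- `f` is Lipschitz on every ball. -/
def LipOnBalls {E G : Type*} [NormedAddCommGroup E] [NormedAddCommGroup G] (f : E → G) : Prop :=
  ∀ r : ℝ, ∃ L : ℝ, 0 ≤ L ∧ ∀ x x', ‖x‖ ≤ r → ‖x'‖ ≤ r → ‖f x - f x'‖ ≤ L * ‖x - x'‖

theorem LocallyLipschitz.lipOnBalls {G : Type*} [NormedAddCommGroup G] {f : Conf n → G}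
    (h : LocallyLipschitz f) : LipOnBalls f := by
  intro r
  obtain ⟨L, hL⟩ := h.locallyLipschitzOn.exists_lipschitzOnWith_of_compact
    (isCompact_closedBall (0 : Conf n) r)
  refine ⟨L, L.2, fun x x' hx hx' => ?_⟩
  simpa [dist_eq_norm] using hL.dist_le_mul x (by simpa using hx) x' (by simpa using hx')

theorem norm_le_sum_abs (v : Conf n) : ‖v‖ ≤ ∑ j, |v j| := by
  conv_lhs => rw [← conf_sum v]
  refine (norm_sum_le _ _).trans (Finset.sum_le_sum fun j _ => ?_)
  rw [norm_smul, ebasis]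
  simp

theorem abs_apply_le_norm (v : Conf n) (j : Fin n) : |v j| ≤ ‖v‖ := by
  simpa using PiLp.norm_apply_le v j

theorem norm_fderiv_le_sum (f : Conf n → ℝ) (x : Conf n) :
    ‖fderiv ℝ f x‖ ≤ ∑ l, |fderiv ℝ f x (ebasis n l)| := by
  refine ContinuousLinearMap.opNorm_le_bound _ (Finset.sum_nonneg fun l _ => abs_nonneg _)
    fun v => ?_
  conv_lhs => rw [← conf_sum v, map_sum]
  rw [Finset.sum_mul]
  refine (norm_sum_le _ _).trans (Finset.sum_le_sum fun l _ => ?_)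
  rw [map_smul, norm_smul, Real.norm_eq_abs, Real.norm_eq_abs, mul_comm]
  exact mul_le_mul_of_nonneg_left (abs_apply_le_norm v l) (abs_nonneg _)

theorem gradient_moll {V η : Conf n → ℝ} (hV : ContDiff ℝ 1 V) (hη : IsTest η) (x : Conf n)
    (j : Fin n) : gradient (moll η V) x j = moll η (fun y => gradient V y j) x := by
  rw [gradient_apply]
  simp only [gradient_apply]
  exact congr_fun ((isWDC_singleton hV j).pd_moll hη) x

theorem continuous_gradient_apply {V : Conf n → ℝ} (hV : ContDiff ℝ 1 V) (j : Fin n) :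
    Continuous fun x => gradient V x j := by
  simp only [gradient_apply]
  exact (hV.continuous_fderiv one_ne_zero).clm_apply continuous_const

section Lipschitz

variable {V : Conf n → ℝ} {η : ℕ → Conf n → ℝ}

theorem mollRadius_le (N : ℕ) : 1 / ((N : ℝ) + 1) ≤ 1 := by
  rw [div_le_one (by positivity)]
  linarith [N.cast_nonneg (α := ℝ)]

theorem exists_gradient_moll_lip (hV : ContDiff ℝ 1 V) (hL : LipOnBalls (gradient V))
    (hη : ∀ N : ℕ, IsMollifier (η N) (1 / ((N : ℝ) + 1))) (r : ℝ) :
    ∃ L : ℝ, 0 ≤ L ∧ ∀ N x x', ‖x‖ ≤ r → ‖x'‖ ≤ r →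
      ‖gradient (moll (η N) V) x - gradient (moll (η N) V) x'‖ ≤ L * ‖x - x'‖ := by
  obtain ⟨L, hL0, hL⟩ := hL (r + 1)
  refine ⟨n * L, by positivity, fun N x x' hx hx' => ?_⟩
  refine (norm_le_sum_abs _).trans ((Finset.sum_le_sum (g := fun _ => L * ‖x - x'‖)
    fun j _ => ?_).trans_eq (by simp [mul_assoc]))
  rw [PiLp.sub_apply, gradient_moll hV (hη N).test, gradient_moll hV (hη N).test]
  refine abs_moll_sub_moll_le (hη N) (continuous_gradient_apply hV j) fun y hy => ?_
  have hy1 := hy.trans (mollRadius_le N)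
  have h1 := hL (x - y) (x' - y) (by linarith [norm_sub_le x y]) (by linarith [norm_sub_le x' y])
  rw [sub_sub_sub_cancel_right] at h1
  exact (abs_apply_le_norm (gradient V (x - y) - gradient V (x' - y)) j).trans h1

theorem exists_gradient_moll_sub_le (hV : ContDiff ℝ 1 V) (hL : LipOnBalls (gradient V))
    (hη : ∀ N : ℕ, IsMollifier (η N) (1 / ((N : ℝ) + 1))) (r : ℝ) :
    ∃ L : ℝ, 0 ≤ L ∧ ∀ N x, ‖x‖ ≤ r →
      ‖gradient (moll (η N) V) x - gradient V x‖ ≤ L * (1 / ((N : ℝ) + 1)) := by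
  obtain ⟨L, hL0, hL⟩ := hL (r + 1)
  refine ⟨n * L, by positivity, fun N x hx => ?_⟩
  refine (norm_le_sum_abs _).trans ((Finset.sum_le_sum (g := fun _ => L * (1 / ((N : ℝ) + 1)))
    fun j _ => ?_).trans_eq (by simp [mul_assoc]))
  rw [PiLp.sub_apply, gradient_moll hV (hη N).test]
  refine abs_moll_sub_le (hη N) (continuous_gradient_apply hV j).locallyIntegrable x
    fun y hy => ?_
  have hy1 := hy.trans (mollRadius_le N)
  have h1 := hL (x - y) x (by linarith [norm_sub_le x y]) (by linarith)
  rw [sub_sub_cancel_left, norm_neg] at h1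
  exact (abs_apply_le_norm (gradient V (x - y) - gradient V x) j).trans
    (h1.trans (mul_le_mul_of_nonneg_left hy hL0))

theorem tendsto_moll {G : Conf n → ℝ} (hG : Continuous G)
    (hη : ∀ N : ℕ, IsMollifier (η N) (1 / ((N : ℝ) + 1))) (x : Conf n) :
    Tendsto (fun N => moll (η N) G x) atTop (𝓝 (G x)) := by
  rw [Metric.tendsto_atTop]
  intro ε hε
  obtain ⟨δ, hδ, h⟩ := Metric.continuous_iff.1 hG x (ε / 2) (by positivity)
  obtain ⟨N₀, hN₀⟩ := exists_nat_one_div_lt hδ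
  refine ⟨N₀, fun N hN => ?_⟩
  have h1 : 1 / ((N : ℝ) + 1) < δ := (one_div_le_one_div_of_le (by positivity)
    (by have : (N₀ : ℝ) ≤ N := by exact_mod_cast hN
        linarith)).trans_lt hN₀
  refine (abs_moll_sub_le (hη N) hG.locallyIntegrable x (b := ε / 2) fun y hy => ?_).trans_lt
    (by linarith)
  have := h (x - y) (by simpa [dist_eq_norm] using hy.trans_lt h1)
  exact (Real.dist_eq _ _ ▸ this).le

/-- Locally bounded second derivatives make the gradient Lipschitz on balls. -/
theorem lipOnBalls_gradient (hV : ContDiff ℝ 1 V)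
    (h : ∀ i j r, ∃ g M, IsWDC [i, j] V g ∧ ∀ᵐ x, ‖x‖ ≤ r → |g x| ≤ M) :
    LipOnBalls (gradient V) := by
  intro r
  choose η hη using fun N : ℕ => exists_isMollifier (F := Conf n)
    (Nat.one_div_pos_of_nat (α := ℝ) (n := N))
  choose g M hg hM using fun i j => h i j (r + 1)
  have hb : ∀ (N : ℕ) i j x, ‖x‖ ≤ r → |pd (ebasis n) [i, j] (moll (η N) V) x| ≤ M i j := by
    intro N i j x hx
    refine abs_pd_moll_le (hg i j) (hη N) ?_
    filter_upwards [hM i j] with y hy hy'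
    exact hy (hy'.trans (add_le_add hx (mollRadius_le N)))
  have hcomp : ∀ j x x', ‖x‖ ≤ r → ‖x'‖ ≤ r →
      |gradient V x j - gradient V x' j| ≤ (∑ i, |M i j|) * ‖x - x'‖ := by
    intro j x x' hx hx'
    have ht : ∀ y, Tendsto (fun N => gradient (moll (η N) V) y j) atTop (𝓝 (gradient V y j)) := by
      intro y
      simp only [gradient_moll hV (hη _).test]
      exact tendsto_moll (continuous_gradient_apply hV j) hη y
    refine le_of_tendsto ((ht x).sub (ht x')).abs (Eventually.of_forall fun N => ?_)
    have hs : ContDiff ℝ ∞ (moll (η N) V) :=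
      contDiff_moll (hη N).test hV.continuous.locallyIntegrable
    simp only [gradient_apply]
    have := (convex_closedBall (0 : Conf n) r).norm_image_sub_le_of_norm_fderiv_le (𝕜 := ℝ)
      (f := fun y => fderiv ℝ (moll (η N) V) y (ebasis n j)) (C := ∑ i, |M i j|) (x := x')
      (y := x) (fun y _ => ((contDiff_fderiv_apply hs _).differentiable
        (by simp)).differentiableAt) ?_ (by simpa using hx') (by simpa using hx)
    · simpa using this
    · intro y hy
      refine (norm_fderiv_le_sum _ _).trans (Finset.sum_le_sum fun i _ => ?_)
      exact (hb N i j y (by simpa using hy)).trans (le_abs_self _)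
  refine ⟨∑ j, ∑ i, |M i j|, by positivity, fun x x' hx hx' => ?_⟩
  refine (norm_le_sum_abs _).trans ?_
  rw [Finset.sum_mul]
  exact Finset.sum_le_sum fun j _ => hcomp j x x' hx hx'

/-- Potentials with bounded derivatives have smooth approximations. -/
theorem exists_isSmoothApprox (hV : ContDiff ℝ 1 V) {m : ℕ} (hL : LipOnBalls (gradient V))
    (h : ∀ w : List (Fin n), 1 ≤ w.length → w.length ≤ m + 1 →
      ∃ g M, IsWDC w V g ∧ ∀ᵐ x, |g x| ≤ M) :
    ∃ W, IsSmoothApprox V m W := by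
  choose η hη using fun N : ℕ => exists_isMollifier (F := Conf n)
    (Nat.one_div_pos_of_nat (α := ℝ) (n := N))
  have hb : ∀ w : List (Fin n), 1 ≤ w.length → w.length ≤ m + 1 →
      ∃ M, ∀ N x, |pd (ebasis n) w (moll (η N) V) x| ≤ M := by
    intro w hw hw'
    obtain ⟨g, M, hg, hM⟩ := h w hw hw'
    refine ⟨M, fun N x => abs_pd_moll_le hg (hη N) ?_⟩
    filter_upwards [hM] with y hy _ using hy
  refine ⟨fun N => moll (η N) V,
    fun N => contDiff_moll (hη N).test hV.continuous.locallyIntegrable, ?_,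
    exists_gradient_moll_lip hV hL hη, fun r => ?_, fun w hw => hb w (by omega)⟩
  · choose M hM using fun j : Fin n => hb [j] le_rfl (by simp)
    refine ⟨∑ j, M j, fun N x => (norm_le_sum_abs _).trans (Finset.sum_le_sum fun j _ => ?_)⟩
    rw [gradient_apply]
    exact hM j N x
  · obtain ⟨L, hL0, hL⟩ := exists_gradient_moll_sub_le hV hL hη r
    refine ⟨_, ?_, hL⟩
    simpa using tendsto_one_div_add_atTop_nhds_zero_nat.const_mul L

end Lipschitz

end Liouville

end

noncomputable section

namespace Liouville

open Filter Topology

variable {n : ℕ}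

/-! ### Potentials given by their Fourier transform -/

/-- A test function as a complex Schwartz function. -/
def IsTest.schwartz {φ : Conf n → ℝ} (h : IsTest φ) : 𝓢(Conf n, ℂ) :=
  HasCompactSupport.toSchwartzMap (f := fun x => (φ x : ℂ))
    (h.2.comp_left (g := fun x : ℝ => (x : ℂ)) (by simp)) (Complex.ofRealCLM.contDiff.comp h.1)

theorem IsTest.schwartz_apply {φ : Conf n → ℝ} (h : IsTest φ) (x : Conf n) :
    h.schwartz x = φ x := rfl

/-- The Fourier symbol of the derivative along a word. -/
def symb : List (Fin n) → Conf n → ℂ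
  | [], _ => 1
  | i :: w, S => (2 * Real.pi * Complex.I) * (S i) * symb w S

theorem inner_ebasis (S : Conf n) (i : Fin n) : inner ℝ S (ebasis n i) = S i := by
  simp [ebasis, EuclideanSpace.inner_single_right]

open LineDeriv in
theorem IsTest.fourierInv_pd {φ : Conf n → ℝ} (h : IsTest φ) (w : List (Fin n)) (S : Conf n) :
    𝓕⁻ (h.pd (ebasis n) w).schwartz S = (-1) ^ w.length * symb w S * 𝓕⁻ h.schwartz S := by
  induction w with
  | nil =>
    simp only [symb, List.length_nil, pow_zero, one_mul]
    rfl
  | cons i w ih =>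
    have h1 : (h.pd (ebasis n) (i :: w)).schwartz =
        ∂_{ebasis n i} (h.pd (ebasis n) w).schwartz := by
      ext x
      rw [SchwartzMap.lineDerivOp_apply_eq_fderiv, IsTest.schwartz_apply]
      have h2 : HasFDerivAt (Liouville.pd (ebasis n) w φ)
          (fderiv ℝ (Liouville.pd (ebasis n) w φ) x) x :=
        (((h.pd (ebasis n) w).1.differentiable (by simp)) x).hasFDerivAt
      have h3 := (Complex.ofRealCLM.hasFDerivAt
        (x := Liouville.pd (ebasis n) w φ x)).comp x h2
      have h4 : ((h.pd (ebasis n) w).schwartz : Conf n → ℂ) =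
        Complex.ofRealCLM ∘ Liouville.pd (ebasis n) w φ := rfl
      rw [h4, h3.fderiv]
      rfl
    have h5 : (fun x : Conf n => inner ℝ x (ebasis n i)).HasTemperateGrowth := by fun_prop
    rw [h1, SchwartzMap.fourierInv_lineDerivOp_eq, smul_apply,
      SchwartzMap.smulLeftCLM_apply_apply h5, ih, inner_ebasis]
    simp only [symb, List.length_cons, pow_succ, smul_eq_mul, Complex.real_smul]
    ring

theorem continuous_symb (w : List (Fin n)) : Continuous (symb w) := by
  induction w with
  | nil => exact continuous_const
  | cons i w ih =>
    have : Continuous fun S : Conf n => ((S i : ℝ) : ℂ) :=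
      Complex.continuous_ofReal.comp (EuclideanSpace.proj (𝕜 := ℝ) i).continuous
    exact (continuous_const.mul this).mul ih

theorem norm_symb_le (w : List (Fin n)) (S : Conf n) :
    ‖symb w S‖ ≤ (2 * Real.pi * ‖S‖) ^ w.length := by
  induction w with
  | nil => simp [symb]
  | cons i w ih =>
    have h1 : ‖(2 * Real.pi * Complex.I : ℂ) * (S i : ℂ)‖ ≤ 2 * Real.pi * ‖S‖ := by
      simp only [norm_mul, Complex.norm_I, Complex.norm_real, Real.norm_eq_abs,
        abs_of_pos Real.pi_pos, Complex.norm_ofNat, mul_one]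
      exact mul_le_mul_of_nonneg_left (abs_apply_le_norm S i) (by positivity)
    simp only [symb, norm_mul ((2 * Real.pi * Complex.I : ℂ) * (S i : ℂ)), List.length_cons,
      pow_succ']
    exact mul_le_mul h1 ih (norm_nonneg _) (by positivity)

theorem IsFourierOf.integrable_symb {V : Conf n → ℝ} {Vhat : Conf n → ℂ}
    (hF : IsFourierOf V Vhat) {m : ℕ}
    (hI : Integrable (fun S => ((‖S‖ ^ (m + 1) : ℝ) : ℂ) * Vhat S)) {w : List (Fin n)}
    (hw : 1 ≤ w.length) (hw' : w.length ≤ m + 1) : Integrable (fun S => symb w S * Vhat S) := by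
  obtain ⟨l, w', rfl⟩ : ∃ l w', w = l :: w' := List.exists_cons_of_length_pos hw
  let b : ContDiffBump (0 : Conf n) := ⟨1, 2, one_pos, one_lt_two⟩
  have hφ : IsTest fun S : Conf n => S l * b S :=
    IsTest.mul_left ⟨b.contDiff, b.hasCompactSupport⟩ (EuclideanSpace.proj (𝕜 := ℝ) l).contDiff
  have h1 : Integrable (fun S => Vhat S * ((S l * b S : ℝ) : ℂ)) :=
    (hF hφ.schwartz (by simp [hφ.schwartz_apply])).2.1
  have hmeas : AEStronglyMeasurable (fun S => symb (l :: w') S * Vhat S) volume := by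
    have h2 : (fun S => symb (l :: w') S * Vhat S) = fun S =>
        (symb (l :: w') S * ((‖S‖ ^ (m + 1) : ℝ) : ℂ)⁻¹) *
          (((‖S‖ ^ (m + 1) : ℝ) : ℂ) * Vhat S) := by
      funext S
      rcases eq_or_ne S 0 with rfl | hS
      · simp [symb]
      · have : ((‖S‖ ^ (m + 1) : ℝ) : ℂ) ≠ 0 := by
          simpa using hS
        field_simp
    rw [h2]
    refine AEStronglyMeasurable.mul ?_ hI.1
    refine (continuous_symb _).aestronglyMeasurable.mul
      (Measurable.aestronglyMeasurable ?_)
    exact (Complex.measurable_ofReal.comp (measurable_norm.pow_const _)).inv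
  refine (((h1.norm.add hI.norm).const_mul ((2 * Real.pi) ^ (l :: w').length)).mono' hmeas
    (Eventually.of_forall fun S => ?_))
  simp only [norm_mul, Complex.norm_real, Real.norm_eq_abs, Pi.add_apply]
  rw [abs_of_nonneg (b.nonneg (x := S)), abs_of_nonneg (by positivity : (0 : ℝ) ≤ ‖S‖ ^ (m + 1))]
  rcases le_or_gt ‖S‖ 1 with hS | hS
  · have hb : b S = 1 := b.one_of_mem_closedBall (by simpa using hS)
    have h3 : ‖symb (l :: w') S‖ ≤ (2 * Real.pi) ^ (l :: w').length * |S l| := by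
      simp only [symb, norm_mul, Complex.norm_I, Complex.norm_real, Real.norm_eq_abs,
        abs_of_pos Real.pi_pos, Complex.norm_ofNat, mul_one, List.length_cons, pow_succ]
      have h4 : ‖symb w' S‖ ≤ (2 * Real.pi) ^ w'.length := by
        refine (norm_symb_le w' S).trans (pow_le_pow_left₀ (by positivity) ?_ _)
        exact mul_le_of_le_one_right (by positivity) hS
      calc 2 * Real.pi * |S l| * ‖symb w' S‖ ≤ 2 * Real.pi * |S l| * (2 * Real.pi) ^ w'.length := by
            gcongr
        _ = _ := by ring
    rw [hb, mul_one]
    calc ‖symb (l :: w') S‖ * ‖Vhat S‖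
        ≤ (2 * Real.pi) ^ (l :: w').length * |S l| * ‖Vhat S‖ := by gcongr
      _ = (2 * Real.pi) ^ (l :: w').length * (‖Vhat S‖ * |S l| + 0) := by ring
      _ ≤ _ := by gcongr; positivity
  · have h3 : ‖symb (l :: w') S‖ ≤ (2 * Real.pi) ^ (l :: w').length * ‖S‖ ^ (m + 1) := by
      refine (norm_symb_le _ S).trans ?_
      rw [mul_pow]
      gcongr
      exact hS.le
    calc ‖symb (l :: w') S‖ * ‖Vhat S‖
        ≤ (2 * Real.pi) ^ (l :: w').length * ‖S‖ ^ (m + 1) * ‖Vhat S‖ := by gcongr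
      _ = (2 * Real.pi) ^ (l :: w').length * (0 + ‖S‖ ^ (m + 1) * ‖Vhat S‖) := by ring
      _ ≤ _ := by
        gcongr
        exact mul_nonneg (norm_nonneg _) (mul_nonneg (abs_nonneg _) b.nonneg)

theorem symb_zero {w : List (Fin n)} (hw : 1 ≤ w.length) : symb w (0 : Conf n) = 0 := by
  obtain ⟨l, w', rfl⟩ : ∃ l w', w = l :: w' := List.exists_cons_of_length_pos hw
  simp [symb]

theorem integral_fourierInv_mul {f g : Conf n → ℂ} (hf : Integrable f) (hg : Integrable g) :
    ∫ S, 𝓕⁻ f S * g S = ∫ x, f x * 𝓕⁻ g x := by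
  have hc : Continuous fun p : Conf n × Conf n => (-innerₗ (Conf n)) p.1 p.2 := by
    exact (continuous_inner (𝕜 := ℝ) (E := Conf n)).neg
  have h1 := VectorFourier.integral_fourierIntegral_smul_eq_flip (μ := (volume : Measure (Conf n)))
    (ν := (volume : Measure (Conf n))) (L := -innerₗ (Conf n)) Real.continuous_fourierChar hc hf hg
  have h2 : (-innerₗ (Conf n)).flip = -innerₗ (Conf n) := by
    ext x y
    simp [real_inner_comm]
  rw [h2] at h1
  exact h1

theorem continuous_fourierInv {f : Conf n → ℂ} (hf : Integrable f) : Continuous (𝓕⁻ f) := by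
  have hc : Continuous fun p : Conf n × Conf n => (-innerₗ (Conf n)) p.1 p.2 := by
    exact (continuous_inner (𝕜 := ℝ) (E := Conf n)).neg
  exact VectorFourier.fourierIntegral_continuous Real.continuous_fourierChar hc hf

theorem norm_fourierInv_le (f : Conf n → ℂ) (x : Conf n) : ‖𝓕⁻ f x‖ ≤ ∫ S, ‖f S‖ := by
  rw [Real.fourierInv_eq]
  refine (norm_integral_le_integral_norm _).trans_eq ?_
  simp

/-- The weak derivatives of `V` are bounded when their Fourier transforms are integrable. -/
theorem IsFourierOf.exists_isWDC {V : Conf n → ℝ} (hV : Continuous V) {Vhat : Conf n → ℂ}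
    (hF : IsFourierOf V Vhat) {m : ℕ}
    (hI : Integrable (fun S => ((‖S‖ ^ (m + 1) : ℝ) : ℂ) * Vhat S)) {w : List (Fin n)}
    (hw : 1 ≤ w.length) (hw' : w.length ≤ m + 1) :
    ∃ g M, IsWDC w V g ∧ ∀ᵐ x, |g x| ≤ M := by
  have hi := hF.integrable_symb hI hw hw'
  set G := 𝓕⁻ fun S => symb w S * Vhat S with hG
  have hGc : Continuous G := continuous_fourierInv hi
  have hgc : Continuous fun x => (G x).re := Complex.continuous_re.comp hGc
  refine ⟨fun x => (G x).re, ∫ S, ‖symb w S * Vhat S‖,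
    ⟨hV.locallyIntegrable, hgc.locallyIntegrable, fun φ hφ => ?_⟩,
    Eventually.of_forall fun x => (Complex.abs_re_le_norm _).trans (norm_fourierInv_le _ x)⟩
  obtain ⟨-, -, h3⟩ := hF (𝓕⁻ (hφ.pd (ebasis n) w).schwartz) (by
    rw [hφ.fourierInv_pd, symb_zero hw]
    simp)
  rw [← SchwartzMap.fourier_coe, FourierTransform.fourier_fourierInv_eq] at h3
  simp only [hφ.fourierInv_pd, IsTest.schwartz_apply] at h3
  have h4 : ∫ S, Vhat S * ((-1) ^ w.length * symb w S * 𝓕⁻ hφ.schwartz S) =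
      (-1) ^ w.length * ∫ x, (φ x : ℂ) * G x := by
    have h5 := integral_fourierInv_mul hφ.schwartz.integrable hi
    simp only [IsTest.schwartz_apply] at h5
    rw [hG, ← h5, ← integral_const_mul, SchwartzMap.fourierInv_coe]
    congr 1
    funext S
    ring
  rw [h4] at h3
  have hφG : Integrable (fun x => (φ x : ℂ) * G x) := by
    simpa using hφ.integrable_smul hGc.locallyIntegrable
  have h6 : ((∫ x, V x * pd (ebasis n) w φ x : ℝ) : ℂ) =
      (-1) ^ w.length * ∫ x, (φ x : ℂ) * G x := by
    rw [← h3, ← integral_complex_ofReal]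
    simp
  have h7 : ∫ x, V x * pd (ebasis n) w φ x = (-1) ^ w.length * ∫ x, φ x * (G x).re := by
    have h8 := congr_arg Complex.re h6
    have h9 : (∫ x, (φ x : ℂ) * G x).re = ∫ x, φ x * (G x).re := by
      have := integral_re hφG
      simp only [RCLike.re_to_complex, Complex.re_ofReal_mul] at this
      exact this.symm
    rw [Complex.ofReal_re, show ((-1 : ℂ) ^ w.length) = (((-1) ^ w.length : ℝ) : ℂ) by simp,
      Complex.re_ofReal_mul, h9] at h8
    exact h8
  simp only [smul_eq_mul]
  calc ∫ x, (-1) ^ w.length * pd (ebasis n) w φ x * V x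
      = (-1) ^ w.length * ∫ x, V x * pd (ebasis n) w φ x := by
        rw [← integral_const_mul]
        congr 1
        funext x
        ring
    _ = _ := by rw [h7, ← mul_assoc, ← mul_pow, neg_one_mul, neg_neg, one_pow, one_mul]

theorem IsFourierOf.exists_isSmoothApprox {V : Conf n → ℝ} (hV : ContDiff ℝ 1 V)
    {Vhat : Conf n → ℂ} (hF : IsFourierOf V Vhat) {m : ℕ}
    (hI : Integrable (fun S => ((‖S‖ ^ (m + 1) : ℝ) : ℂ) * Vhat S))
    (hm : m = 0 → LocallyLipschitz (gradient V)) : ∃ W, IsSmoothApprox V m W := by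
  have hd := fun (w : List (Fin n)) (hw : 1 ≤ w.length) (hw' : w.length ≤ m + 1) =>
    hF.exists_isWDC hV.continuous hI hw hw'
  refine Liouville.exists_isSmoothApprox hV ?_ hd
  rcases Nat.eq_zero_or_pos m with h0 | h0
  · exact LocallyLipschitz.lipOnBalls (hm h0)
  · refine lipOnBalls_gradient hV fun i j r => ?_
    obtain ⟨g, M, hg, hM⟩ := hd [i, j] (by simp) (by simp; omega)
    exact ⟨g, M, hg, by filter_upwards [hM] with x hx _ using hx⟩

end Liouville

end

noncomputable section

namespace Liouville

open Filter Topology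

variable {n : ℕ}

/-! ### The transport operators acting on Sobolev functions -/

theorem tendsto_integral_moll_smul {η : ℕ → Conf n → ℝ}
    (hη : ∀ N : ℕ, IsMollifier (η N) (1 / ((N : ℝ) + 1))) {c : Conf n → ℝ} (hc : Continuous c)
    {χ : Phase n → ℝ} (hχ : IsTest χ) {f : Phase n → ℂ} (hf : LocallyIntegrable f volume) :
    Tendsto (fun N => ∫ z, (moll (η N) c z.1 * χ z) • f z) atTop
      (𝓝 (∫ z, (c z.1 * χ z) • f z)) := by
  obtain ⟨R, hR0, hR⟩ := hχ.exists_radius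
  obtain ⟨b, hb⟩ := (isCompact_closedBall (0 : Conf n) (R + 1)).exists_bound_of_continuousOn
    hc.continuousOn
  have hi := hχ.integrable_smul hf
  refine tendsto_integral_of_dominated_convergence (fun z => b * ‖χ z • f z‖) (fun N => ?_)
    (hi.norm.const_mul b) (fun N => Eventually.of_forall fun z => ?_)
    (Eventually.of_forall fun z => ?_)
  · have h1 : Continuous fun z : Phase n => moll (η N) c z.1 :=
      (contDiff_moll (hη N).test hc.locallyIntegrable).continuous.comp continuous_fst
    simp only [mul_smul]
    exact h1.aestronglyMeasurable.smul hi.1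
  · rw [mul_smul, norm_smul]
    by_cases h0 : χ z = 0
    · simp [h0]
    · refine mul_le_mul_of_nonneg_right ?_ (norm_nonneg _)
      have h1 := abs_moll_sub_le (hη N) hc.locallyIntegrable z.1 (a := 0) (b := b) fun y hy => by
        rw [sub_zero]
        refine hb _ (mem_closedBall_zero_iff.2 ?_)
        have h2 := (norm_fst_le z).trans (hR z h0)
        linarith [norm_sub_le z.1 y, hy.trans (mollRadius_le N)]
      rwa [sub_zero] at h1
  · exact ((tendsto_moll hc hη z.1).mul_const (χ z)).smul_const (f z)

/-- Weak derivatives in `k` may be tested with functions whose dependence on `x` is only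
continuous. -/
theorem IsWD.integral_mul_fst {i : Fin n} {f g : Phase n → ℂ} (h : IsWD [Sum.inr i] f g)
    {c : Conf n → ℝ} (hc : Continuous c) {φ : Phase n → ℝ} (hφ : IsTest φ) :
    ∫ z, (c z.1 * fderiv ℝ φ z (dir n (Sum.inr i))) • f z = -∫ z, (c z.1 * φ z) • g z := by
  rw [isWD_singleton_iff] at h
  choose η hη using fun N : ℕ => exists_isMollifier (F := Conf n)
    (Nat.one_div_pos_of_nat (α := ℝ) (n := N))
  refine tendsto_nhds_unique (tendsto_integral_moll_smul hη hc (hφ.fderiv_apply _) h.1)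
    ((tendsto_integral_moll_smul hη hc hφ h.2.1).neg.congr fun N => ?_)
  have hs := contDiff_moll (hη N).test hc.locallyIntegrable
  have hs' : ContDiff ℝ ∞ fun z : Phase n => moll (η N) c z.1 := hs.comp contDiff_fst
  rw [← h.2.2 _ (hφ.mul_left hs')]
  congr 1
  funext z
  congr 1
  rw [fderiv_fun_mul (hs'.differentiable (by simp)).differentiableAt
    (hφ.1.differentiable (by simp)).differentiableAt]
  simp only [add_apply, smul_apply, smul_eq_mul,
    fderiv_comp_fst (hs.differentiable (by simp)).differentiableAt]
  simp [dir]

theorem isWeakForce_of_isWD {V : Conf n → ℝ} (hV : ContDiff ℝ 1 V) {f : Phase n → ℂ}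
    (hf : LocallyIntegrable f volume) {G : Fin n → Phase n → ℂ}
    (h : ∀ i, IsWD [Sum.inr i] f (G i)) :
    IsWeakForce V f fun z => ∑ i, gradient V z.1 i • G i z := by
  have hc : ∀ i, Continuous fun z : Phase n => gradient V z.1 i := fun i =>
    (continuous_gradient_apply hV i).comp continuous_fst
  have hl : ∀ i, LocallyIntegrable (fun z => gradient V z.1 i • G i z) volume := fun i =>
    (h i).2.1.continuous_smul (hc i)
  refine ⟨hf, locallyIntegrable_finsetSum _ fun i _ => hl i, fun φ hφ => ?_⟩
  have h1 : ∀ z, (-fderiv ℝ φ z (0, gradient V z.1)) • f z =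
      ∑ i, -((gradient V z.1 i * fderiv ℝ φ z (dir n (Sum.inr i))) • f z) := by
    intro z
    have h2 : ((0, gradient V z.1) : Phase n) = ∑ i, gradient V z.1 i • dir n (Sum.inr i) := by
      rw [← sum_coord_smul_dir ((0, gradient V z.1) : Phase n), Fintype.sum_sum_type]
      simp [coord]
    rw [h2, map_sum, neg_smul, Finset.sum_smul, Finset.sum_neg_distrib]
    simp
  have hi : ∀ i, Integrable (fun z => -((gradient V z.1 i *
      fderiv ℝ φ z (dir n (Sum.inr i))) • f z)) volume := by
    intro i
    have := (hφ.fderiv_apply (dir n (Sum.inr i))).integrable_smul (hf.continuous_smul (hc i))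
    refine Integrable.neg (f := fun z => _ • f z) ?_
    simpa only [smul_smul, mul_comm] using this
  simp only [h1]
  rw [integral_finsetSum _ fun i _ => hi i]
  simp only [integral_neg, (h _).integral_mul_fst (continuous_gradient_apply hV _) hφ, neg_neg,
    Finset.smul_sum, smul_smul]
  rw [integral_finsetSum _ fun i _ => by
    simpa only [smul_smul] using hφ.integrable_smul (hl i)]
  simp only [mul_comm]

theorem isWeakKdx_of_isWD {f : Phase n → ℂ} (hf : LocallyIntegrable f volume)
    {G : Fin n → Phase n → ℂ} (h : ∀ i, IsWD [Sum.inl i] f (G i)) :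
    IsWeakKdx f fun z => ∑ i, z.2 i • G i z := by
  have hs : ∀ i, ContDiff ℝ ∞ (fun z : Phase n => z.2 i) := fun i => contDiff_coord (Sum.inr i)
  have hl : ∀ i, LocallyIntegrable (fun z => z.2 i • G i z) volume := fun i =>
    (h i).2.1.continuous_smul (hs i).continuous
  refine ⟨hf, locallyIntegrable_finsetSum _ fun i _ => hl i, fun φ hφ => ?_⟩
  have hd : ∀ i z, fderiv ℝ (fun z : Phase n => z.2 i * φ z) z (dir n (Sum.inl i)) =
      z.2 i * fderiv ℝ φ z (dir n (Sum.inl i)) := by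
    intro i z
    have h0 : fderiv ℝ (fun z : Phase n => z.2 i) z (dir n (Sum.inl i)) = 0 := by
      have : (fun z : Phase n => z.2 i) = coordL n (Sum.inr i) := rfl
      rw [this, ContinuousLinearMap.fderiv]
      simp [coordL, dir]
    rw [fderiv_fun_mul ((hs i).differentiable (by simp)).differentiableAt
      (hφ.1.differentiable (by simp)).differentiableAt]
    simp [h0]
  have h1 : ∀ z, (-fderiv ℝ φ z (z.2, 0)) • f z = ∑ i,
      -(fderiv ℝ (fun z : Phase n => z.2 i * φ z) z (dir n (Sum.inl i)) • f z) := by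
    intro z
    have h2 : ((z.2, 0) : Phase n) = ∑ i, z.2 i • dir n (Sum.inl i) := by
      rw [← sum_coord_smul_dir ((z.2, 0) : Phase n), Fintype.sum_sum_type]
      simp [coord]
    rw [h2, map_sum, neg_smul, Finset.sum_smul, Finset.sum_neg_distrib]
    simp [hd]
  have ht : ∀ i, IsTest fun z : Phase n => z.2 i * φ z := fun i => hφ.mul_left (hs i)
  have hi : ∀ i, Integrable (fun z => -(fderiv ℝ (fun z : Phase n => z.2 i * φ z) z
      (dir n (Sum.inl i)) • f z)) volume := fun i =>
    (((ht i).fderiv_apply _).integrable_smul hf).neg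
  simp only [h1]
  rw [integral_finsetSum _ fun i _ => hi i]
  simp only [integral_neg, (isWD_singleton_iff.1 (h _)).2.2 _ (ht _), neg_neg, Finset.smul_sum,
    smul_smul]
  rw [integral_finsetSum _ fun i _ => by
    simpa only [smul_smul] using hφ.integrable_smul (hl i)]
  simp only [mul_comm]

/-- The right-hand side of the Liouville equation, in terms of the first derivatives. -/
theorem integral_field_of_isWeak {V : Conf n → ℝ} (hV : Continuous (gradient V))
    {f g₁ g₂ : Phase n → ℂ}
    (h₁ : IsWeakKdx f g₁) (h₂ : IsWeakForce V f g₂) {φ : Phase n → ℝ} (hφ : IsTest φ) :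
    ∫ z, fderiv ℝ φ z (field V z) • f z =
      ∫ z, φ z • ((-(2 * Real.pi)) • g₁ z + (1 / (2 * Real.pi)) • g₂ z) := by
  have hfc : Continuous (fderiv ℝ φ) := hφ.1.continuous_fderiv (by simp)
  have hi : ∀ v : Phase n → Phase n, Continuous v →
      Integrable (fun z => (-fderiv ℝ φ z (v z)) • f z) volume := by
    intro v hv
    refine h₁.1.integrable_smul_left_of_hasCompactSupport (hfc.clm_apply hv).neg ?_
    refine (hφ.2.fderiv (𝕜 := ℝ)).mono' ?_
    intro z hz
    refine subset_tsupport _ ?_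
    intro h0
    simp [h0] at hz
  have e1 : ∀ z, fderiv ℝ φ z (field V z) • f z = (-(2 * Real.pi)) • ((-fderiv ℝ φ z (z.2, 0)) •
      f z) + (1 / (2 * Real.pi)) • ((-fderiv ℝ φ z (0, gradient V z.1)) • f z) := by
    intro z
    have : field V z = (2 * Real.pi) • ((z.2, 0) : Phase n) +
        (-(1 / (2 * Real.pi))) • ((0, gradient V z.1) : Phase n) := by
      simp [field]
    rw [this, map_add, map_smul, map_smul, smul_smul, smul_smul, ← add_smul]
    congr 1
    simp only [smul_eq_mul]
    ring
  simp only [e1, smul_add]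
  have i1 := hi (fun z => (z.2, 0)) (continuous_snd.prodMk continuous_const)
  have i2 := hi (fun z => (0, gradient V z.1)) (continuous_const.prodMk (hV.comp continuous_fst))
  have j1 := hφ.integrable_smul h₁.2.1
  have j2 := hφ.integrable_smul h₂.2.1
  rw [integral_add (f := fun z => _ • _ • f z) (g := fun z => _ • _ • f z) (i1.smul (-(2 * Real.pi)))
    (i2.smul (1 / (2 * Real.pi))), integral_smul, integral_smul]
  simp only [smul_comm (φ _)]
  rw [integral_add (f := fun z => _ • φ z • g₁ z) (g := fun z => _ • φ z • g₂ z) (j1.smul (-(2 * Real.pi)))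
    (j2.smul (1 / (2 * Real.pi))), integral_smul, integral_smul]
  have k1 := h₁.2.2 φ hφ
  have k2 := h₂.2.2 φ hφ
  rw [k1, k2]

/-! ### Multiplication by bounded functions -/

section Mul

variable {κ : Type*}

theorem exists_isWD_smul (m : ℕ) {c : κ → Phase n → ℝ} (hc : UnifBdd m c) (w : List (Ix n))
    (hw : w.length ≤ m) :
    ∃ l : List (List (Ix n) × (κ → Phase n → ℝ)),
      (∀ p ∈ l, p.1.length ≤ w.length ∧ UnifBdd (m - w.length) p.2) ∧
      ∀ (i : κ) (f : Phase n → ℂ) (F : List (Ix n) → Phase n → ℂ), IsJet m f F →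
        IsWD w (fun z => c i z • f z) (diffExpr l i F id) := by
  induction w with
  | nil =>
    refine ⟨[([], c)], by simpa using hc, fun i f F hF => ?_⟩
    have h1 : LocallyIntegrable (fun z => c i z • f z) volume :=
      (memLp_locInt hF.memLp).continuous_smul (hc.zero.1 i).continuous
    refine (isWD_nil h1).congr (Filter.EventuallyEq.refl _ _) ?_
    filter_upwards [hF.ae_eq] with z hz
    simp [diffExpr, hz]
  | cons σ w ih =>
    simp only [List.length_cons] at hw
    obtain ⟨l, hl, hl'⟩ := ih (by omega)
    have hj : m - w.length = (m - (w.length + 1)) + 1 := by omega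
    refine ⟨l.flatMap fun p => [(p.1, fun i z => fderiv ℝ (p.2 i) z (dir n σ)), (σ :: p.1, p.2)],
      ?_, fun i f F hF => ?_⟩
    · intro p hp
      simp only [List.mem_flatMap] at hp
      obtain ⟨q, hq, hp⟩ := hp
      obtain ⟨hq1, hq2⟩ := hl q hq
      rw [hj] at hq2
      simp only [List.mem_cons, List.not_mem_nil, or_false] at hp
      rcases hp with rfl | rfl
      · exact ⟨by simp; omega, hq2.2 σ⟩
      · exact ⟨by simp; omega, hq2.of_succ⟩
    · refine (hl' i f F hF).cons ?_
      have h2 := isWD_list_sum (w := [σ]) l (f := fun p z => p.2 i z • F p.1 z)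
        (g := fun p z => fderiv ℝ (p.2 i) z (dir n σ) • F p.1 z + p.2 i z • F (σ :: p.1) z)
        fun p hp => (hF.isWD_cons (by have := (hl p hp).1; omega) σ).mul ((hl p hp).2.zero.1 i)
      refine h2.congr (Filter.EventuallyEq.refl _ _) (Filter.Eventually.of_forall fun z => ?_)
      simp only [diffExpr_flatMap]
      simp [diffExpr]

theorem exists_sobolevNorm_smul_le (m : ℕ) {c : κ → Phase n → ℝ} (hc : UnifBdd m c) :
    ∃ C : ℝ, 0 ≤ C ∧ ∀ (i : κ) (f : Phase n → ℂ), sobolevNorm m f < ⊤ →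
      sobolevNorm m (fun z => c i z • f z) ≤ ENNReal.ofReal C * sobolevNorm m f := by
  have key : ∀ p ∈ multiIdx n m, ∃ C : ℝ, 0 ≤ C ∧ ∀ (i : κ) (f : Phase n → ℂ)
      (F : List (Ix n) → Phase n → ℂ), IsJet m f F →
      derivL2 p.1 p.2 (fun z => c i z • f z) ≤ ENNReal.ofReal C * sobolevNorm m f := by
    intro p hp
    have hlen := length_canon₂_le hp
    obtain ⟨l, hl, h⟩ := exists_isWD_smul m hc (canon₂ p.1 p.2) hlen
    obtain ⟨C, hC0, hC⟩ := exists_eLpNorm_diffExpr_le (m := m) l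
      fun q hq => ⟨(hl q hq).1.trans hlen, (hl q hq).2.zero⟩
    exact ⟨C, hC0, fun i f F hF => (iInf₂_le _ ((isWeakDeriv_iff_isWD _ _ _ _).2
      (h i f F hF))).trans (hC i f F _ hF (MeasurePreserving.id _)).2⟩
  choose! C hC0 hC using key
  refine ⟨∑ p ∈ multiIdx n m, C p, Finset.sum_nonneg hC0, fun i f hf => ?_⟩
  obtain ⟨F, hF⟩ := exists_isJet hf
  refine (Finset.sum_le_sum fun p hp => hC p hp i f F hF).trans_eq ?_
  rw [← Finset.sum_mul, ENNReal.ofReal_sum_of_nonneg hC0]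

end Mul

/-! ### Finiteness of the pairings -/

theorem IsJet.pairing {V : Conf n → ℝ} (hV : ContDiff ℝ 1 V) {m : ℕ} {f : Phase n → ℂ}
    {F : List (Ix n) → Phase n → ℂ} (hF : IsJet (m + 1) f F) {v : List (Ix n)}
    (hv : v.length ≤ m) :
    IsWeakKdx (F v) (fun z => ∑ i, z.2 i • F (Sum.inl i :: v) z) ∧
      IsWeakForce V (F v) (fun z => ∑ i, gradient V z.1 i • F (Sum.inr i :: v) z) :=
  ⟨isWeakKdx_of_isWD (memLp_locInt (hF v (by omega)).2) fun i => hF.isWD_cons (by omega) _,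
    isWeakForce_of_isWD hV (memLp_locInt (hF v (by omega)).2) fun i => hF.isWD_cons (by omega) _⟩

end Liouville

end

noncomputable section

namespace Liouville

open Filter Topology

variable {n : ℕ}

/-! ### Time differences of weak solutions -/

section Differences

variable {X : Phase n → Phase n} {t : ℝ} {u : ℝ → PhaseL2 n}

theorem IsTest.exists_radius_flux {φ : Phase n → ℝ} (hφ : IsTest φ) (X : Phase n → Phase n) :
    ∃ R, ∀ z, fderiv ℝ φ z (X z) ≠ 0 → ‖z‖ ≤ R := by
  obtain ⟨R, -, hR⟩ := hφ.exists_radius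
  refine ⟨R, fun z hz => ?_⟩
  by_contra h
  rw [fderiv_eq_zero_of_supp hR (not_le.1 h)] at hz
  simp at hz

theorem IsTest.continuous_flux {φ : Phase n → ℝ} (hφ : IsTest φ) (hX : Continuous X) :
    Continuous fun z => fderiv ℝ φ z (X z) :=
  (hφ.1.continuous_fderiv (by simp)).clm_apply hX

theorem IsTest.flux_sub {φ : Phase n → ℝ} (hφ : IsTest φ) (hX : Continuous X)
    (w w' : PhaseL2 n) : ∫ z, fderiv ℝ φ z (X z) • (w - w') z =
      (∫ z, fderiv ℝ φ z (X z) • w z) - ∫ z, fderiv ℝ φ z (X z) • w' z := by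
  obtain ⟨R, hR⟩ := hφ.exists_radius_flux X
  exact pair_sub (hφ.continuous_flux hX) hR w w'

theorem IsTest.pair_sub {φ : Phase n → ℝ} (hφ : IsTest φ) (w w' : PhaseL2 n) :
    ∫ z, φ z • (w - w') z = (∫ z, φ z • w z) - ∫ z, φ z • w' z := by
  obtain ⟨R, -, hR⟩ := hφ.exists_radius
  exact Liouville.pair_sub hφ.continuous hR w w'

theorem IsTest.continuousOn_flux {φ : Phase n → ℝ} (hφ : IsTest φ) (hX : Continuous X)
    {S : Set ℝ} (hu : ContinuousOn u S) :
    ContinuousOn (fun r => ∫ z, fderiv ℝ φ z (X z) • u r z) S := by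
  obtain ⟨R, hR⟩ := hφ.exists_radius_flux X
  exact continuousOn_pair (hφ.continuous_flux hX) hR hu

theorem IsWeakSolution.sub_initial (hu : IsWeakSolution X 0 t u) (hX : Continuous X)
    {f : PhaseL2 n} (hf : ∀ φ : Phase n → ℝ, IsTest φ →
      ∫ z, fderiv ℝ φ z (X z) • u 0 z = ∫ z, φ z • f z) :
    IsWeakSolution X f t fun s => u s - u 0 := by
  refine ⟨hu.continuousOn.sub continuousOn_const, fun φ hφ s hs => ?_⟩
  have h1 := hu.weak φ hφ s hs
  simp only [pair_zero, add_zero] at h1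
  simp only [sub_self, pair_zero, sub_zero, hφ.pair_sub, hφ.flux_sub hX, hf φ hφ, sub_add_cancel,
    h1]

theorem IsWeakSolution.translate_sub (hu : IsWeakSolution X 0 t u) (hX : Continuous X) {h : ℝ}
    (h0 : 0 ≤ h) : IsWeakSolution X 0 (t - h) fun s => u (s + h) - u s := by
  have hmaps : Set.MapsTo (fun s => s + h) (Set.Icc 0 (t - h)) (Set.Icc 0 t) := fun s hs =>
    ⟨by linarith [hs.1], by linarith [hs.2]⟩
  have hsub : Set.Icc 0 (t - h) ⊆ Set.Icc 0 t := Set.Icc_subset_Icc_right (by linarith)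
  refine ⟨(hu.continuousOn.comp (continuous_add_const h).continuousOn hmaps).sub
    (hu.continuousOn.mono hsub), fun φ hφ s hs => ?_⟩
  set P : ℝ → ℂ := fun r => ∫ z, fderiv ℝ φ z (X z) • u r z with hP
  have hPc : ContinuousOn P (Set.Icc 0 t) := hφ.continuousOn_flux hX hu.continuousOn
  have hI : ∀ a b, 0 ≤ a → a ≤ b → b ≤ t → IntervalIntegrable P volume a b := fun a b ha hab hb =>
    (hPc.mono (Set.Icc_subset_Icc ha hb)).intervalIntegrable_of_Icc hab
  have hst : s + h ≤ t := (hmaps hs).2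
  have hst' : s ≤ t := (hsub hs).2
  have w : ∀ r ∈ Set.Icc 0 t, (∫ z, φ z • u r z) - ∫ z, φ z • u 0 z = ∫ q in (0 : ℝ)..r, P q := by
    intro r hr
    have := hu.weak φ hφ r hr
    simpa only [pair_zero, add_zero] using this
  have w1 := w (s + h) (hmaps hs)
  have w2 := w s (hsub hs)
  have w3 := w h ⟨h0, by linarith [hs.1]⟩
  simp only [pair_zero, add_zero, hφ.pair_sub, hφ.flux_sub hX, zero_add]
  change _ = ∫ r in (0 : ℝ)..s, (P (r + h) - P r)
  have hI2 : IntervalIntegrable (fun r => P (r + h)) volume 0 s := by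
    have := (hI h (s + h) h0 (by linarith [hs.1]) hst).comp_add_right h
    simpa using this
  have e := intervalIntegral.integral_add_adjacent_intervals
    (hI 0 h le_rfl h0 (by linarith [hs.1])) (hI h (s + h) h0 (by linarith [hs.1]) hst)
  rw [intervalIntegral.integral_sub hI2 (hI 0 s le_rfl hs.1 hst'),
    intervalIntegral.integral_comp_add_right, zero_add, ← w2, eq_sub_of_add_eq' e, ← w1, ← w3]
  ring

theorem IsWeakSolution.tendsto_quotient (hu : IsWeakSolution X 0 t u) (hX : Continuous X)
    (ht : 0 < t) {φ : Phase n → ℝ} (hφ : IsTest φ) :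
    Tendsto (fun N : ℕ => ∫ z, φ z • (((t / (N + 1))⁻¹ : ℝ) • (u t - u (t - t / (N + 1))) z))
      atTop (𝓝 (∫ z, fderiv ℝ φ z (X z) • u t z)) := by
  set P : ℝ → ℂ := fun r => ∫ z, fderiv ℝ φ z (X z) • u r z with hP
  have hPc : ContinuousOn P (Set.Icc 0 t) := hφ.continuousOn_flux hX hu.continuousOn
  have w : ∀ r ∈ Set.Icc 0 t, (∫ z, φ z • u r z) - ∫ z, φ z • u 0 z = ∫ q in (0 : ℝ)..r, P q := by
    intro r hr
    have := hu.weak φ hφ r hr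
    simpa only [pair_zero, add_zero] using this
  have hI : ∀ a b, 0 ≤ a → a ≤ b → b ≤ t → IntervalIntegrable P volume a b := fun a b ha hab hb =>
    (hPc.mono (Set.Icc_subset_Icc ha hb)).intervalIntegrable_of_Icc hab
  rw [Metric.tendsto_atTop]
  intro ε hε
  obtain ⟨δ, hδ, hd⟩ := Metric.continuousOn_iff.1 hPc t ⟨ht.le, le_rfl⟩ (ε / 2) (by positivity)
  obtain ⟨N₀, hN₀⟩ := (Metric.tendsto_atTop.1 (tendsto_step t)) δ hδ
  refine ⟨N₀, fun N hN => ?_⟩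
  have hh0 : 0 < t / ((N : ℝ) + 1) := by positivity
  have hhδ : t / ((N : ℝ) + 1) < δ := by
    have := hN₀ N hN
    rwa [Real.dist_eq, sub_zero, abs_of_pos hh0] at this
  have hht : t / ((N : ℝ) + 1) ≤ t := by
    simpa using step_mul_le ht.le (N := N) (j := 1) (by omega)
  generalize t / ((N : ℝ) + 1) = h at *
  have w1 := w t ⟨ht.le, le_rfl⟩
  have w2 := w (t - h) ⟨by linarith, by linarith⟩
  have e := intervalIntegral.integral_add_adjacent_intervals
    (hI 0 (t - h) le_rfl (by linarith) (by linarith))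
    (hI (t - h) t (by linarith) (by linarith) le_rfl)
  have e1 : ∫ z, φ z • ((h⁻¹ : ℝ) • (u t - u (t - h)) z) = (h⁻¹ : ℝ) • ∫ q in (t - h)..t, P q := by
    simp only [smul_comm (φ _)]
    rw [integral_smul, hφ.pair_sub, eq_sub_of_add_eq' e, ← w1, ← w2]
    congr 1
    ring
  have e2 : (h⁻¹ : ℝ) • (∫ q in (t - h)..t, P q) - P t =
      (h⁻¹ : ℝ) • ∫ q in (t - h)..t, (P q - P t) := by
    rw [intervalIntegral.integral_sub (hI (t - h) t (by linarith) (by linarith) le_rfl)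
      intervalIntegrable_const, intervalIntegral.integral_const, smul_sub, smul_smul,
      sub_sub_cancel, inv_mul_cancel₀ hh0.ne', one_smul]
  have e3 : ‖∫ q in (t - h)..t, (P q - P t)‖ ≤ ε / 2 * |t - (t - h)| := by
    refine intervalIntegral.norm_integral_le_of_norm_le_const fun q hq => ?_
    rw [Set.uIoc_of_le (by linarith)] at hq
    have := hd q ⟨by linarith [hq.1], hq.2⟩ (by
      rw [Real.dist_eq, abs_sub_comm, abs_of_nonneg (by linarith [hq.2])]
      linarith [hq.1])
    rw [← dist_eq_norm]
    exact this.le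
  rw [dist_eq_norm, e1, e2, norm_smul, Real.norm_eq_abs, abs_of_pos (inv_pos.2 hh0)]
  rw [sub_sub_cancel, abs_of_pos hh0] at e3
  calc h⁻¹ * ‖∫ q in (t - h)..t, (P q - P t)‖ ≤ h⁻¹ * (ε / 2 * h) := by gcongr
    _ = ε / 2 := by field_simp
    _ < ε := by linarith

end Differences

/-- For a solution with `H^m` time derivative at time `0`, the time derivative stays in `H^m`. -/
theorem IsSmoothApprox.sobolevNorm_time_deriv_lt_top {V : Conf n → ℝ} (hV : ContDiff ℝ 1 V)
    {m : ℕ} {W : ℕ → Conf n → ℝ} (hW : IsSmoothApprox V m W) {t : ℝ} (ht : 0 < t)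
    {u : ℝ → PhaseL2 n} (hu : IsWeakSolution (field V) 0 t u) {v₀ v : Phase n → ℂ}
    (hv₀ : ∀ φ : Phase n → ℝ, IsTest φ →
      ∫ z, fderiv ℝ φ z (field V z) • u 0 z = ∫ z, φ z • v₀ z)
    (hm : sobolevNorm m v₀ < ⊤) (hvl : LocallyIntegrable v volume)
    (hv : ∀ φ : Phase n → ℝ, IsTest φ →
      ∫ z, fderiv ℝ φ z (field V z) • u t z = ∫ z, φ z • v z) : sobolevNorm m v < ⊤ := by
  obtain ⟨C, hC0, hC⟩ := hW.exists_sobolevNorm_le hV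
  have hX := continuous_field hV
  set f : PhaseL2 n := (memLp_of_sobolevNorm_lt_top hm).toLp v₀ with hf
  have hfe : f =ᵐ[volume] v₀ := (memLp_of_sobolevNorm_lt_top hm).coeFn_toLp
  have hτ := hu.sub_initial hX (f := f) fun φ hφ => by
    rw [hv₀ φ hφ]
    refine integral_congr_ae ?_
    filter_upwards [hfe] with z hz
    rw [hz]
  have hfin : sobolevNorm m f < ⊤ := by rwa [sobolevNorm_congr hfe]
  set B := ENNReal.ofReal (Real.exp (t * C)) *
    (ENNReal.ofReal (Real.exp (t * C)) * sobolevNorm m f) with hB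
  have hBt : B < ⊤ := ENNReal.mul_lt_top ENNReal.ofReal_lt_top
    (ENNReal.mul_lt_top ENNReal.ofReal_lt_top hfin)
  refine (sobolevNorm_le_of_tendsto (B := B) hvl (vN := fun N : ℕ => fun z =>
    ((t / (N + 1))⁻¹ : ℝ) • (u t - u (t - t / (N + 1))) z) (fun N => ?_) fun φ hφ => ?_).trans_lt
    hBt
  · have hh0 : 0 < t / ((N : ℝ) + 1) := by positivity
    have hht : t / ((N : ℝ) + 1) ≤ t := by
      simpa using step_mul_le ht.le (N := N) (j := 1) (by omega)
    generalize t / ((N : ℝ) + 1) = h at *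
    have hexp : ∀ s, s ≤ t → ENNReal.ofReal (Real.exp (s * C)) ≤
        ENNReal.ofReal (Real.exp (t * C)) := fun s hs =>
      ENNReal.ofReal_le_ofReal (Real.exp_le_exp.2 (mul_le_mul_of_nonneg_right hs hC0))
    have b1 : sobolevNorm m (u h - u 0 : PhaseL2 n) ≤
        ENNReal.ofReal (Real.exp (t * C)) * (ENNReal.ofReal h * sobolevNorm m f) := by
      have h1 := hC h hh0.le f (fun s => u s - u 0)
        ⟨hτ.continuousOn.mono (Set.Icc_subset_Icc_right hht),
          fun φ hφ s hs => hτ.weak φ hφ s ⟨hs.1, hs.2.trans hht⟩⟩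
      simp only [sub_self, sobolevNorm_zero, zero_add] at h1
      exact h1.trans (mul_le_mul' (hexp h hht) le_rfl)
    have b2 : sobolevNorm m (u t - u (t - h) : PhaseL2 n) ≤ ENNReal.ofReal h * B := by
      have h1 := hC (t - h) (by linarith) 0 (fun s => u (s + h) - u s)
        (hu.translate_sub hX hh0.le)
      simp only [sobolevNorm_zero, mul_zero, add_zero, zero_add, sub_add_cancel] at h1
      refine h1.trans ((mul_le_mul' (hexp _ (by linarith)) b1).trans_eq ?_)
      rw [hB]
      ring
    refine (sobolevNorm_smul_le m _ _ (b2.trans_lt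
      (ENNReal.mul_lt_top ENNReal.ofReal_lt_top hBt))).trans ?_
    rw [abs_of_pos (inv_pos.2 hh0)]
    refine (mul_le_mul' le_rfl b2).trans_eq ?_
    rw [← mul_assoc, ← ENNReal.ofReal_mul (inv_pos.2 hh0).le, inv_mul_cancel₀ hh0.ne',
      ENNReal.ofReal_one, one_mul]
  · rw [← hv φ hφ]
    exact hu.tendsto_quotient hX ht hφ

end Liouville

end

noncomputable section

namespace Liouville

open Filter Topology

variable {n : ℕ}

/-! ### Potentials with bounded derivatives -/

theorem exists_ae_le_of_memLp_top {α : Type*} [MeasurableSpace α] {μ : Measure α} {g : α → ℝ}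
    (h : MemLp g ∞ μ) : ∃ M : ℝ, ∀ᵐ x ∂μ, |g x| ≤ M := by
  refine ⟨(eLpNorm g ∞ μ).toReal, ?_⟩
  rw [eLpNorm_exponent_top]
  filter_upwards [ae_le_eLpNormEssSup (f := g) (μ := μ)] with x hx
  have := ENNReal.toReal_mono (by rw [← eLpNorm_exponent_top]; exact h.eLpNorm_ne_top) hx
  simpa using this

theorem DerivsBounded.exists_isSmoothApprox {V : Conf n → ℝ} (hV : ContDiff ℝ 1 V) {m : ℕ}
    (h : DerivsBounded V (m + 2)) : ∃ W, IsSmoothApprox V (m + 1) W := by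
  have hd : ∀ w : List (Fin n), w.length ≤ m + 2 → ∃ g M, IsWDC w V g ∧ ∀ᵐ x, |g x| ≤ M := by
    intro w hw
    obtain ⟨g, hg, hb⟩ := h (fun i => w.count i) (by rwa [sum_count])
    obtain ⟨M, hM⟩ := exists_ae_le_of_memLp_top hb
    exact ⟨g, M, (isWeakDerivConf_count w V g).1 hg, hM⟩
  refine Liouville.exists_isSmoothApprox hV (lipOnBalls_gradient hV fun i j r => ?_)
    fun w _ hw => hd w hw
  obtain ⟨g, M, hg, hM⟩ := hd [i, j] (by simp)
  exact ⟨g, M, hg, by filter_upwards [hM] with x hx _ using hx⟩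

theorem IsSmoothApprox.mono {V : Conf n → ℝ} {m m' : ℕ} {W : ℕ → Conf n → ℝ}
    (hW : IsSmoothApprox V m W) (h : m' ≤ m) : IsSmoothApprox V m' W :=
  ⟨hW.smooth, hW.bound, hW.lip, hW.tendsto, fun w hw hw' => hW.deriv w hw (by omega)⟩

theorem IsSmoothApprox.tendsto_gradient {V : Conf n → ℝ} {m : ℕ} {W : ℕ → Conf n → ℝ}
    (hW : IsSmoothApprox V m W) (x : Conf n) :
    Tendsto (fun N => gradient (W N) x) atTop (𝓝 (gradient V x)) := by
  obtain ⟨θ, hθ, h⟩ := hW.tendsto ‖x‖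
  rw [tendsto_iff_norm_sub_tendsto_zero]
  exact squeeze_zero (fun N => norm_nonneg _) (fun N => h N x le_rfl) hθ

theorem IsSmoothApprox.exists_norm_gradient_le {V : Conf n → ℝ} {m : ℕ} {W : ℕ → Conf n → ℝ}
    (hW : IsSmoothApprox V m W) : ∃ M, ∀ x, ‖gradient V x‖ ≤ M := by
  obtain ⟨M, hM⟩ := hW.bound
  exact ⟨M, fun x => le_of_tendsto (hW.tendsto_gradient x).norm
    (Eventually.of_forall fun N => hM N x)⟩

theorem IsSmoothApprox.sobolevNorm_gradient_smul_lt_top {V : Conf n → ℝ} (hV : ContDiff ℝ 1 V)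
    {m : ℕ} {W : ℕ → Conf n → ℝ} (hW : IsSmoothApprox V m W) (i : Fin n) {f : Phase n → ℂ}
    (hf : sobolevNorm m f < ⊤) : sobolevNorm m (fun z => gradient V z.1 i • f z) < ⊤ := by
  obtain ⟨M, hM⟩ := hW.bound
  have hc : UnifBdd m fun N (z : Phase n) => pd (ebasis n) [i] (W N) z.1 := by
    refine UnifBdd.of_conf (fun N => contDiff_pd _ _ (hW.smooth N)) fun w hw => ?_
    simp only [← pd_append]
    rcases w with _ | ⟨j, w⟩
    · refine ⟨M, fun N x => ?_⟩
      have := abs_apply_le_norm (gradient (W N) x) i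
      rw [gradient_apply] at this
      exact this.trans (hM N x)
    · exact hW.deriv _ (by simp) (by simpa using hw)
  obtain ⟨C, -, hC⟩ := exists_sobolevNorm_smul_le m hc
  have hfl := memLp_locInt (memLp_of_sobolevNorm_lt_top hf)
  refine (sobolevNorm_le_of_tendsto (hfl.continuous_smul
    ((continuous_gradient_apply hV i).comp continuous_fst)) (fun N => hC N f hf)
    fun φ hφ => ?_).trans_lt (ENNReal.mul_lt_top ENNReal.ofReal_lt_top hf)
  have hi := hφ.integrable_smul hfl
  refine tendsto_integral_of_dominated_convergence (fun z => M * ‖φ z • f z‖) (fun N => ?_)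
    (hi.norm.const_mul M) (fun N => Eventually.of_forall fun z => ?_)
    (Eventually.of_forall fun z => ?_)
  · have h1 : Continuous fun z : Phase n => pd (ebasis n) [i] (W N) z.1 :=
      (contDiff_pd _ _ (hW.smooth N)).continuous.comp continuous_fst
    simp only [smul_comm (φ _)]
    exact h1.aestronglyMeasurable.smul hi.1
  · rw [smul_comm, norm_smul]
    refine mul_le_mul_of_nonneg_right ?_ (norm_nonneg _)
    have := abs_apply_le_norm (gradient (W N) z.1) i
    rw [gradient_apply] at this
    exact this.trans (hM N z.1)
  · have h1 : Tendsto (fun N => gradient (W N) z.1 i) atTop (𝓝 (gradient V z.1 i)) :=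
      ((EuclideanSpace.proj (𝕜 := ℝ) i).continuous.tendsto _).comp (hW.tendsto_gradient z.1)
    simp only [gradient_apply (W _)] at h1
    exact (h1.smul_const (f z)).const_smul (φ z)

/-! ### Derivatives of `k · ∂ₓ f` -/

theorem fderiv_coord (i : Fin n) (z v : Phase n) :
    fderiv ℝ (fun z : Phase n => z.2 i) z v = v.2 i := by
  have : (fun z : Phase n => z.2 i) = coordL n (Sum.inr i) := rfl
  rw [this, ContinuousLinearMap.fderiv]
  simp [coordL]

theorem IsJet.isWD_kdx {m : ℕ} {f : Phase n → ℂ} {F : List (Ix n) → Phase n → ℂ}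
    (hF : IsJet (m + 1) f F) (v : List (Ix n)) (hv : v.length ≤ m) :
    ∃ l : List (List (Ix n)), (∀ w ∈ l, w.length ≤ v.length) ∧
      IsWD v (fun z => ∑ i, z.2 i • F [Sum.inl i] z)
        fun z => (∑ i, z.2 i • F (Sum.inl i :: v) z) + (l.map fun w => F w z).sum := by
  have hs : ∀ i, ContDiff ℝ ∞ (fun z : Phase n => z.2 i) := fun i => contDiff_coord (Sum.inr i)
  induction v with
  | nil =>
    refine ⟨[], by simp, ?_⟩
    have h1 : LocallyIntegrable (fun z => ∑ i, z.2 i • F [Sum.inl i] z) volume :=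
      locallyIntegrable_finsetSum _ fun i _ =>
        (memLp_locInt (hF [Sum.inl i] (by simp)).2).continuous_smul (hs i).continuous
    simpa using isWD_nil h1
  | cons σ v ih =>
    simp only [List.length_cons] at hv
    obtain ⟨l, hl, hl'⟩ := ih (by omega)
    refine ⟨(match σ with
      | Sum.inl _ => []
      | Sum.inr k => [Sum.inl k :: v]) ++ l.map (σ :: ·), ?_, hl'.cons ?_⟩
    · intro w hw
      rw [List.mem_append, List.mem_map] at hw
      rcases hw with hw | ⟨w', hw', rfl⟩
      · rcases σ with j | k
        · simp at hw
        · simp only [List.mem_singleton] at hw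
          simp [hw]
      · simpa using hl w' hw'
    · have h1 : ∀ i, IsWD [σ] (F (Sum.inl i :: v)) (F (Sum.inl i :: σ :: v)) := fun i =>
        (hF (Sum.inl i :: v) (by simp; omega)).1.of_cons
          ((hF (Sum.inl i :: σ :: v) (by simp; omega)).1.perm (List.Perm.swap _ _ _))
      have h2 := (isWD_sum Finset.univ fun i _ => (h1 i).mul (hs i)).add
        (isWD_list_sum (w := [σ]) l (f := fun w z => F w z) (g := fun w z => F (σ :: w) z)
          fun w hw => hF.isWD_cons (by have := hl w hw; omega) σ)
      refine h2.congr (EventuallyEq.refl _ _) (Eventually.of_forall fun z => ?_)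
      simp only [fderiv_coord, Finset.sum_add_distrib, List.map_append, List.sum_append,
        List.map_map, Function.comp_def]
      rw [add_comm (∑ i, _ • F (Sum.inl i :: v) z), add_assoc]
      congr 2
      rcases σ with j | k
      · simp [dir]
      · simp [dir, ebasis, ite_smul]

theorem IsJet.memLp_list_sum {m : ℕ} {f : Phase n → ℂ} {F : List (Ix n) → Phase n → ℂ}
    (hF : IsJet m f F) (l : List (List (Ix n))) (hl : ∀ w ∈ l, w.length ≤ m) :
    MemLp (fun z => (l.map fun w => F w z).sum) 2 volume := by
  induction l with
  | nil => simp
  | cons w l ih =>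
    simp only [List.map_cons, List.sum_cons]
    exact (hF w (hl w (by simp))).2.add (ih fun w' h => hl w' (by simp [h]))

theorem IsJet.sobolevNorm_kdx_lt_top_iff {m : ℕ} {f : Phase n → ℂ}
    {F : List (Ix n) → Phase n → ℂ} (hF : IsJet (m + 1) f F) :
    sobolevNorm m (fun z => ∑ i, z.2 i • F [Sum.inl i] z) < ⊤ ↔
      ∀ v : List (Ix n), v.length ≤ m →
        MemLp (fun z => ∑ i, z.2 i • F (Sum.inl i :: v) z) 2 volume := by
  constructor
  · intro h v hv
    obtain ⟨G, hG⟩ := exists_isJet h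
    obtain ⟨l, hl, hl'⟩ := hF.isWD_kdx v hv
    have h1 := hF.memLp_list_sum l fun w hw => by have := hl w hw; omega
    refine ((hG v hv).2.sub h1).ae_eq ?_
    filter_upwards [WeakEq.ae_unique (hG v hv).1 hl' (EventuallyEq.refl _ _)] with z hz
    rw [Pi.sub_apply, hz, add_sub_cancel_right]
  · intro h
    have : ∀ v : List (Ix n), ∃ g, v.length ≤ m →
        IsWD v (fun z => ∑ i, z.2 i • F [Sum.inl i] z) g ∧ MemLp g 2 volume := by
      intro v
      by_cases hv : v.length ≤ m
      · obtain ⟨l, hl, hl'⟩ := hF.isWD_kdx v hv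
        exact ⟨_, fun _ => ⟨hl', (h v hv).add
          (hF.memLp_list_sum l fun w hw => by have := hl w hw; omega)⟩⟩
      · exact ⟨0, fun h => absurd h hv⟩
    choose G hG using this
    exact IsJet.sobolevNorm_lt_top (F := G) hG

/-! ### Finiteness of the pairings for bounded derivatives of the potential -/

theorem KdxDerivsL2.memLp {m : ℕ} {ρ₀ : PhaseL2 n} (h : KdxDerivsL2 m ρ₀)
    {F : List (Ix n) → Phase n → ℂ} (hF : IsJet (m + 1) ρ₀ F) {v : List (Ix n)}
    (hv : v.length ≤ m) : MemLp (fun z => ∑ i, z.2 i • F (Sum.inl i :: v) z) 2 volume := by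
  obtain ⟨w, g, hw, hg, hg2⟩ := h (cnt v).1 (cnt v).2
    ((mem_multiIdx _).1 (cnt_mem_multiIdx.2 hv))
  have h1 : w =ᵐ[volume] F v := WeakEq.ae_unique ((isWeakDeriv_cnt v _ _).1 hw)
    (hF v (by omega)).1 (EventuallyEq.refl _ _)
  have h2 : IsWeakKdx (F v) fun z => ∑ i, z.2 i • F (Sum.inl i :: v) z :=
    isWeakKdx_of_isWD (memLp_locInt (hF v (by omega)).2) fun i => hF.isWD_cons (by omega) _
  exact hg2.ae_eq (WeakEq.ae_unique hg h2 h1)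

/-- The time derivative of a solution, in terms of a jet. -/
def timeDeriv (V : Conf n → ℝ) (F : List (Ix n) → Phase n → ℂ) (z : Phase n) : ℂ :=
  (-(2 * Real.pi)) • (∑ i, z.2 i • F [Sum.inl i] z) +
    (1 / (2 * Real.pi)) • (∑ i, gradient V z.1 i • F [Sum.inr i] z)

theorem IsJet.integral_field {V : Conf n → ℝ} (hV : ContDiff ℝ 1 V) {m : ℕ} {f : Phase n → ℂ}
    {F : List (Ix n) → Phase n → ℂ} (hF : IsJet (m + 1) f F) {φ : Phase n → ℝ} (hφ : IsTest φ) :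
    ∫ z, fderiv ℝ φ z (field V z) • f z = ∫ z, φ z • timeDeriv V F z := by
  obtain ⟨h1, h2⟩ := hF.pairing hV (v := []) (Nat.zero_le _)
  refine Eq.trans ?_ (integral_field_of_isWeak (continuous_gradient hV) h1 h2 hφ)
  refine integral_congr_ae ?_
  filter_upwards [hF.ae_eq] with z hz
  rw [hz]

theorem IsJet.locallyIntegrable_timeDeriv {V : Conf n → ℝ} (hV : ContDiff ℝ 1 V) {m : ℕ}
    {f : Phase n → ℂ} {F : List (Ix n) → Phase n → ℂ} (hF : IsJet (m + 1) f F) :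
    LocallyIntegrable (timeDeriv V F) volume := by
  obtain ⟨h1, h2⟩ := hF.pairing hV (v := []) (Nat.zero_le _)
  exact (h1.2.1.smul (-(2 * Real.pi))).add (h2.2.1.smul (1 / (2 * Real.pi)))

theorem IsSmoothApprox.sobolevNorm_force_lt_top {V : Conf n → ℝ} (hV : ContDiff ℝ 1 V) {m : ℕ}
    {W : ℕ → Conf n → ℝ} (hW : IsSmoothApprox V m W) {f : Phase n → ℂ}
    {F : List (Ix n) → Phase n → ℂ} (hF : IsJet (m + 1) f F) :
    sobolevNorm m (fun z => ∑ i, gradient V z.1 i • F [Sum.inr i] z) < ⊤ := by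
  refine (sobolevNorm_sum_le m Finset.univ
    fun i z => gradient V z.1 i • F [Sum.inr i] z).trans_lt (ENNReal.sum_lt_top.2 fun i _ => ?_)
  exact hW.sobolevNorm_gradient_smul_lt_top hV i
    (hF.tail (m' := m) (v := [Sum.inr i]) (by simp)).sobolevNorm_lt_top

theorem IsSmoothApprox.sobolevNorm_timeDeriv_lt_top_iff {V : Conf n → ℝ} (hV : ContDiff ℝ 1 V)
    {m : ℕ} {W : ℕ → Conf n → ℝ} (hW : IsSmoothApprox V m W) {f : Phase n → ℂ}
    {F : List (Ix n) → Phase n → ℂ} (hF : IsJet (m + 1) f F) :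
    sobolevNorm m (timeDeriv V F) < ⊤ ↔
      sobolevNorm m (fun z => ∑ i, z.2 i • F [Sum.inl i] z) < ⊤ := by
  have hforce := hW.sobolevNorm_force_lt_top hV hF
  have hsmul : ∀ (c : ℝ) (g : Phase n → ℂ), sobolevNorm m g < ⊤ →
      sobolevNorm m (fun z => c • g z) < ⊤ := fun c g hg =>
    (sobolevNorm_smul_le m c g hg).trans_lt (ENNReal.mul_lt_top ENNReal.ofReal_lt_top hg)
  constructor
  · intro h
    have h1 := hsmul (-(1 / (2 * Real.pi))) _ ((sobolevNorm_add_le m _ _).trans_lt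
      (ENNReal.add_lt_top.2 ⟨h, hsmul (-(1 / (2 * Real.pi))) _ hforce⟩))
    convert h1 using 2
    funext z
    have : 2 * Real.pi ≠ 0 := by positivity
    rw [timeDeriv, neg_smul (1 / (2 * Real.pi)) (∑ i, gradient V z.1 i • F [Sum.inr i] z),
      add_neg_cancel_right, smul_smul, neg_mul_neg, one_div_mul_cancel this, one_smul]
  · intro h
    exact (sobolevNorm_add_le m _ _).trans_lt
      (ENNReal.add_lt_top.2 ⟨hsmul _ _ h, hsmul _ _ hforce⟩)

theorem IsSmoothApprox.memLp_force {V : Conf n → ℝ} (hV : ContDiff ℝ 1 V) {m : ℕ}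
    {W : ℕ → Conf n → ℝ} (hW : IsSmoothApprox V m W) {G : Fin n → Phase n → ℂ}
    (hG : ∀ i, MemLp (G i) 2 volume) :
    MemLp (fun z => ∑ i, gradient V z.1 i • G i z) 2 volume := by
  obtain ⟨M, hM⟩ := hW.exists_norm_gradient_le
  refine memLp_finsetSum _ fun i _ => ⟨?_, ?_⟩
  · exact ((continuous_gradient_apply hV i).comp continuous_fst).aestronglyMeasurable.smul (hG i).1
  · exact (eLpNorm_smul_le_of_bdd (c := fun z => gradient V z.1 i) fun z =>
      (abs_apply_le_norm _ i).trans (hM z.1)).trans_lt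
      (ENNReal.mul_lt_top ENNReal.ofReal_lt_top (hG i).eLpNorm_lt_top)

theorem integrable_conj_mul {f g : Phase n → ℂ} (hf : MemLp f 2 volume) (hg : MemLp g 2 volume) :
    Integrable (fun z => starRingEnd ℂ (f z) * g z) :=
  hf.star.integrable_mul hg

theorem pairingsFinite_of_derivsBounded {V : Conf n → ℝ} (hV : ContDiff ℝ 1 V) {m : ℕ}
    (h : DerivsBounded V (m + 2)) {T : ℝ} {ρ₀ : PhaseL2 n} {ρ : ℝ → PhaseL2 n}
    (hρ : IsSolution V T ρ₀ ρ) (hm : sobolevNorm (m + 1) ρ₀ < ⊤) (hk : KdxDerivsL2 m ρ₀) :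
    PairingsFinite V m T ρ := by
  intro t ht A B hAB
  obtain ⟨W, hW⟩ := h.exists_isSmoothApprox hV
  have hWm := hW.mono (Nat.le_succ m)
  obtain ⟨C, -, hC⟩ := hW.exists_isSolution_le hV
  obtain ⟨F₀, hF₀⟩ := exists_isJet hm
  have hk0 := hF₀.sobolevNorm_kdx_lt_top_iff.2 fun v hv => hk.memLp hF₀ hv
  obtain ⟨F, hF⟩ := exists_isJet ((hC T ρ₀ ρ hρ t ht).trans_lt
    (ENNReal.mul_lt_top ENNReal.ofReal_lt_top hm))
  have hkt : ∀ v : List (Ix n), v.length ≤ m →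
      MemLp (fun z => ∑ i, z.2 i • F (Sum.inl i :: v) z) 2 volume := by
    rcases ht.1.eq_or_lt with h0 | h0
    · intro v hv
      rw [← h0, hρ.initial] at hF
      exact hk.memLp hF hv
    · refine hF.sobolevNorm_kdx_lt_top_iff.1
        ((hWm.sobolevNorm_timeDeriv_lt_top_iff hV hF).1 ?_)
      refine hWm.sobolevNorm_time_deriv_lt_top hV h0 (hρ.isWeakSolution ht.2)
        (v₀ := timeDeriv V F₀) (fun φ hφ => ?_)
        ((hWm.sobolevNorm_timeDeriv_lt_top_iff hV hF₀).2 hk0)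
        (hF.locallyIntegrable_timeDeriv hV) fun φ hφ => hF.integral_field hV hφ
      rw [hρ.initial]
      exact hF₀.integral_field hV hφ
  have hlen : (canon₂ A B).length ≤ m := by rwa [length_canon₂]
  obtain ⟨h1, h2⟩ := hF.pairing hV hlen
  have hw := (hF (canon₂ A B) (by omega)).2
  refine ⟨F (canon₂ A B), (isWeakDeriv_iff_isWD _ _ _ _).2 (hF _ (by omega)).1, hw,
    ⟨_, h1, integrable_conj_mul hw (hkt _ hlen)⟩, ⟨_, h2, integrable_conj_mul hw ?_⟩⟩
  exact hWm.memLp_force hV fun i => (hF (Sum.inr i :: canon₂ A B) (by simp; omega)).2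

end Liouville

end

noncomputable section

namespace Liouville

open Filter Topology

/-! ### Trajectories of locally Lipschitz vector fields -/

section Trajectories

variable {E : Type*} [NormedAddCommGroup E]

theorem LipOnBalls.neg {G : Type*} [NormedAddCommGroup G] {X : E → G} (hX : LipOnBalls X) :
    LipOnBalls fun z => -X z := by
  intro r
  obtain ⟨L, hL0, hL⟩ := hX r
  refine ⟨L, hL0, fun x x' hx hx' => ?_⟩
  rw [neg_sub_neg, norm_sub_rev]
  exact hL x x' hx hx'

theorem LipOnBalls.continuous {G : Type*} [NormedAddCommGroup G] {X : E → G}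
    (hX : LipOnBalls X) : Continuous X := by
  refine continuous_iff_continuousAt.2 fun x => ?_
  obtain ⟨L, hL0, hL⟩ := hX (‖x‖ + 1)
  rw [ContinuousAt, tendsto_iff_norm_sub_tendsto_zero]
  have h1 : Tendsto (fun y => L * ‖y - x‖) (𝓝 x) (𝓝 0) := by
    have := ((continuous_id.sub continuous_const).norm.const_mul L).tendsto (x := x)
      (f := fun y => L * ‖y - x‖)
    simpa using this
  refine squeeze_zero' (Eventually.of_forall fun y => norm_nonneg _) ?_ h1
  filter_upwards [Metric.closedBall_mem_nhds x one_pos] with y hy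
  rw [mem_closedBall_iff_norm] at hy
  refine hL y x ?_ (by linarith)
  have := norm_add_le (y - x) x
  rw [sub_add_cancel] at this
  linarith

variable [NormedSpace ℝ E] {X : E → E}

/-- `γ` is a global trajectory of the vector field `X`. -/
def IsTraj (X : E → E) (γ : ℝ → E) : Prop := ∀ t, HasDerivAt γ (X (γ t)) t

namespace IsTraj

variable {γ γ' : ℝ → E}

theorem reverse (h : IsTraj X γ) (s : ℝ) : IsTraj (fun z => -X z) fun t => γ (s - t) :=
  fun t => HasDerivAt.comp_const_sub s t (h (s - t))

theorem shift (h : IsTraj X γ) (s : ℝ) : IsTraj X fun t => γ (t + s) :=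
  fun t => HasDerivAt.comp_add_const t s (h (t + s))

theorem continuous (h : IsTraj X γ) : Continuous γ :=
  continuous_iff_continuousAt.2 fun t => (h t).continuousAt

theorem norm_sub_le {R L : ℝ} (hL0 : 0 ≤ L)
    (hL : ∀ x x', ‖x‖ ≤ R → ‖x'‖ ≤ R → ‖X x - X x'‖ ≤ L * ‖x - x'‖)
    (h : IsTraj X γ) (h' : IsTraj X γ') {T : ℝ} (hγ : ∀ s, 0 ≤ s → s < T → ‖γ s‖ ≤ R)
    (hγ' : ∀ s, 0 ≤ s → s < T → ‖γ' s‖ ≤ R) {s : ℝ} (hs : 0 ≤ s) (hsT : s ≤ T) :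
    ‖γ s - γ' s‖ ≤ Real.exp (L * s) * ‖γ 0 - γ' 0‖ := by
  have h1 := dist_le_of_trajectories_ODE_of_mem (v := fun _ => X) (K := L.toNNReal)
    (s := fun _ => Metric.closedBall 0 R) (f := γ) (g := γ') (a := 0) (b := T)
    (δ := ‖γ 0 - γ' 0‖) (fun _ _ => LipschitzOnWith.of_dist_le_mul fun x hx y hy => by
      rw [dist_eq_norm, dist_eq_norm, Real.coe_toNNReal _ hL0]
      exact hL x y (by simpa using hx) (by simpa using hy))
    h.continuous.continuousOn (fun t _ => (h t).hasDerivWithinAt)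
    (fun t ht => by simpa using hγ t ht.1 ht.2) h'.continuous.continuousOn
    (fun t _ => (h' t).hasDerivWithinAt) (fun t ht => by simpa using hγ' t ht.1 ht.2)
    (dist_eq_norm _ _).le s ⟨hs, hsT⟩
  rwa [dist_eq_norm, Real.coe_toNNReal _ hL0, sub_zero, mul_comm] at h1

theorem exists_bound (h : IsTraj X γ) (T : ℝ) : ∃ R, ∀ s, 0 ≤ s → s ≤ T → ‖γ s‖ ≤ R := by
  obtain ⟨R, hR⟩ := (isCompact_Icc (a := (0 : ℝ)) (b := T)).exists_bound_of_continuousOn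
    h.continuous.continuousOn
  exact ⟨R, fun s hs hsT => hR s ⟨hs, hsT⟩⟩

theorem eq_of_eq (hX : LipOnBalls X) (h : IsTraj X γ) (h' : IsTraj X γ') (h0 : γ 0 = γ' 0)
    {s : ℝ} (hs : 0 ≤ s) : γ s = γ' s := by
  obtain ⟨R, hR⟩ := h.exists_bound s
  obtain ⟨R', hR'⟩ := h'.exists_bound s
  obtain ⟨L, hL0, hL⟩ := hX (max R R')
  have := norm_sub_le hL0 hL h h' (fun q hq hqs => (hR q hq hqs.le).trans (le_max_left _ _))
    (fun q hq hqs => (hR' q hq hqs.le).trans (le_max_right _ _)) hs le_rfl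
  rw [h0, sub_self, norm_zero, mul_zero] at this
  exact sub_eq_zero.1 (norm_le_zero_iff.1 this)

end IsTraj

/-- The trajectories starting in a ball stay bounded for bounded times, if the flow is complete. -/
theorem exists_reach_bound [ProperSpace E] (hX : LipOnBalls X)
    (hc : ∀ z, ∃ γ, γ 0 = z ∧ IsTraj X γ) (r T : ℝ) :
    ∃ R, ∀ γ, IsTraj X γ → ‖γ 0‖ ≤ r → ∀ s, 0 ≤ s → s ≤ T → ‖γ s‖ ≤ R := by
  suffices h : ∃ R, ∀ γ, IsTraj X γ → γ 0 ∈ Metric.closedBall (0 : E) r →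
      ∀ s, 0 ≤ s → s ≤ T → ‖γ s‖ ≤ R by
    simpa using h
  refine IsCompact.induction_on (p := fun S : Set E => ∃ R, ∀ γ, IsTraj X γ → γ 0 ∈ S →
    ∀ s, 0 ≤ s → s ≤ T → ‖γ s‖ ≤ R) (isCompact_closedBall (0 : E) r) ?_ ?_ ?_ ?_
  · exact ⟨0, fun γ _ h => absurd h (Set.notMem_empty _)⟩
  · rintro S S' hS ⟨R, hR⟩
    exact ⟨R, fun γ hγ h => hR γ hγ (hS h)⟩
  · rintro S S' ⟨R, hR⟩ ⟨R', hR'⟩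
    refine ⟨max R R', fun γ hγ h s hs hsT => ?_⟩
    rcases h with h | h
    · exact (hR γ hγ h s hs hsT).trans (le_max_left _ _)
    · exact (hR' γ hγ h s hs hsT).trans (le_max_right _ _)
  · intro z _
    obtain ⟨γ₀, h0, hγ₀⟩ := hc z
    obtain ⟨M, hM⟩ := hγ₀.exists_bound T
    obtain ⟨L, hL0, hL⟩ := hX (M + 1)
    refine ⟨Metric.ball z (Real.exp (-(L * T))),
      mem_nhdsWithin_of_mem_nhds (Metric.ball_mem_nhds z (Real.exp_pos _)), M + 1,
      fun γ hγ hz s hs hsT => ?_⟩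
    have hT : 0 ≤ T := hs.trans hsT
    have hz' : ‖γ 0 - γ₀ 0‖ < Real.exp (-(L * T)) := by
      rw [h0, ← dist_eq_norm]
      exact hz
    have key : ∀ q ∈ Set.Icc 0 T, ‖γ q - γ₀ q‖ < 1 := by
      by_contra! hex
      obtain ⟨q, ⟨⟨hq0, hqT⟩, hq1⟩, hleast⟩ := IsCompact.exists_isLeast
        (s := {q | q ∈ Set.Icc 0 T ∧ 1 ≤ ‖γ q - γ₀ q‖})
        ((isCompact_Icc).inter_right (isClosed_le continuous_const
          (hγ.continuous.sub hγ₀.continuous).norm)) (by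
          obtain ⟨q, hq, hq'⟩ := hex
          exact ⟨q, hq, hq'⟩)
      have hlt : ∀ p, 0 ≤ p → p < q → ‖γ p - γ₀ p‖ < 1 := fun p hp hpq => by
        by_contra! hge
        exact absurd (hleast ⟨⟨hp, hpq.le.trans hqT⟩, hge⟩) (not_le.2 hpq)
      have h1 := IsTraj.norm_sub_le hL0 hL hγ hγ₀ (T := q) (fun p hp hpq => by
          have e1 := norm_add_le (γ p - γ₀ p) (γ₀ p)
          rw [sub_add_cancel] at e1
          linarith [hlt p hp hpq, hM p hp (hpq.le.trans hqT)])
        (fun p hp hpq => by linarith [hM p hp (hpq.le.trans hqT)]) hq0 le_rfl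
      have h2 : Real.exp (L * q) * ‖γ 0 - γ₀ 0‖ < 1 := by
        calc Real.exp (L * q) * ‖γ 0 - γ₀ 0‖ < Real.exp (L * q) * Real.exp (-(L * T)) := by
              gcongr
          _ ≤ Real.exp (L * T) * Real.exp (-(L * T)) := by gcongr
          _ = 1 := by rw [← Real.exp_add, add_neg_cancel, Real.exp_zero]
      linarith
    have e1 := norm_add_le (γ s - γ₀ s) (γ₀ s)
    rw [sub_add_cancel] at e1
    linarith [key s ⟨hs, hsT⟩, hM s hs hsT]

end Trajectories

variable {n : ℕ}

/-! ### The exact flow as an approximate flow -/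

section Flow

variable {X : Phase n → Phase n} {Γ : Phase n → ℝ → Phase n}

theorem flow_iterate (hX : LipOnBalls X) (h0 : ∀ z, Γ z 0 = z) (hΓ : ∀ z, IsTraj X (Γ z))
    {h : ℝ} (hh : 0 ≤ h) (j : ℕ) (z : Phase n) : (fun z => Γ z h)^[j] z = Γ z (j * h) := by
  induction j with
  | zero => simp [h0]
  | succ j ih =>
    rw [Function.iterate_succ_apply', ih]
    have h1 := IsTraj.eq_of_eq hX (hΓ (Γ z (j * h))) ((hΓ z).shift (j * h)) (by simp [h0]) hh
    rw [h1]
    congr 1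
    push_cast
    ring

theorem flow_isApproxFlow (hX : LipOnBalls X) (h0 : ∀ z, Γ z 0 = z) (hΓ : ∀ z, IsTraj X (Γ z))
    {ψ : Phase n → ℝ} (hψ : IsTest ψ) {t : ℝ} (ht : 0 ≤ t) :
    ∃ R, IsApproxFlow X ψ t R fun N z => Γ z (t / (N + 1)) := by
  obtain ⟨r, hr0, hr⟩ := hψ.exists_radius
  obtain ⟨Λ, hΛ0, hΛ⟩ := hψ.exists_lipschitz
  obtain ⟨b, hb⟩ := hψ.2.exists_bound_of_continuous hψ.continuous
  have hcompl : ∀ z, ∃ γ, γ 0 = z ∧ IsTraj X γ := fun z => ⟨Γ z, h0 z, hΓ z⟩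
  obtain ⟨R, hR⟩ := exists_reach_bound hX.neg (fun z => ⟨fun s => Γ z (0 - s), by simp [h0],
    (hΓ z).reverse 0⟩) r t
  have hreach : ∀ r' : ℝ, ∃ R', ∀ z : Phase n, ‖z‖ ≤ r' → ∀ s, 0 ≤ s → s ≤ t →
      ‖Γ z s‖ ≤ R' := fun r' => by
    obtain ⟨R', hR'⟩ := exists_reach_bound hX hcompl r' t
    exact ⟨R', fun z hz => hR' (Γ z) (hΓ z) (by rwa [h0])⟩
  have hlip : ∀ r' : ℝ, ∃ C : ℝ, 0 ≤ C ∧ ∀ z z' : Phase n, ‖z‖ ≤ r' → ‖z'‖ ≤ r' →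
      ∀ s, 0 ≤ s → s ≤ t → ‖Γ z s - Γ z' s‖ ≤ C * ‖z - z'‖ := by
    intro r'
    obtain ⟨R', hR'⟩ := hreach r'
    obtain ⟨L, hL0, hL⟩ := hX R'
    refine ⟨Real.exp (L * t), (Real.exp_pos _).le, fun z z' hz hz' s hs hst => ?_⟩
    have h1 := IsTraj.norm_sub_le hL0 hL (hΓ z) (hΓ z') (T := t)
      (fun q hq hqt => hR' z hz q hq hqt.le) (fun q hq hqt => hR' z' hz' q hq hqt.le) hs hst
    rw [h0, h0] at h1
    refine h1.trans (mul_le_mul_of_nonneg_right (Real.exp_le_exp.2 ?_) (norm_nonneg _))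
    gcongr
  have hh : ∀ N : ℕ, 0 ≤ t / ((N : ℝ) + 1) := fun N => by positivity
  have hht : ∀ N : ℕ, t / ((N : ℝ) + 1) ≤ t := fun N => by
    simpa using step_mul_le ht (N := N) (j := 1) (by omega)
  have hit : ∀ (N j : ℕ) (z : Phase n), (fun z => Γ z (t / ((N : ℝ) + 1)))^[j] z =
      Γ z (j * (t / ((N : ℝ) + 1))) := fun N j z => flow_iterate hX h0 hΓ (hh N) j z
  have hsupp : ∀ s, 0 ≤ s → s ≤ t → ∀ z, ψ (Γ z s) ≠ 0 → ‖z‖ ≤ R := by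
    intro s hs hst z hz
    have := hR _ ((hΓ z).reverse s) (by simpa using hr _ hz) s hs hst
    simpa [h0] using this
  refine ⟨R, fun N => ?_, fun N j z hj hz => ?_, ?_, ?_, ?_⟩
  · refine LipOnBalls.continuous fun r' => ?_
    obtain ⟨C, hC0, hC⟩ := hlip r'
    exact ⟨C, hC0, fun z z' hz hz' => hC z z' hz hz' _ (hh N) (hht N)⟩
  · rw [hit] at hz
    exact hsupp _ (by have := hh N; positivity) (step_mul_le ht hj) z hz
  · obtain ⟨C, hC0, hC⟩ := hlip (R + 2)
    refine ⟨Λ * C + b, ?_, fun N j hj => ?_⟩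
    · have : 0 ≤ b := (norm_nonneg _).trans (hb 0)
      positivity
    · simp only [hit]
      have hs0 : 0 ≤ j * (t / ((N : ℝ) + 1)) := by have := hh N; positivity
      refine abs_sub_le_of_supp (G := fun z => ψ (Γ z (j * (t / ((N : ℝ) + 1)))))
        (hsupp _ hs0 (step_mul_le ht hj)) (fun z => hb _) (by positivity)
        fun z z' hz hz' => ?_
      rw [mul_assoc]
      exact (hΛ _ _).trans (mul_le_mul_of_nonneg_left
        (hC z z' hz hz' _ hs0 (step_mul_le ht hj)) hΛ0)
  · obtain ⟨R', hR'⟩ := hreach (R + 2)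
    obtain ⟨L, hL0, hL⟩ := hX R'
    obtain ⟨C, hC0, hC⟩ := hlip (R + 2)
    refine ⟨L * C, by positivity, fun N z z' hz hz' => ?_⟩
    have h1 := norm_image_sub_le_of_norm_deriv_le_segment' (a := 0) (b := t / ((N : ℝ) + 1))
      (f := fun s => Γ z s - Γ z' s) (f' := fun s => X (Γ z s) - X (Γ z' s))
      (C := L * (C * ‖z - z'‖)) (fun s _ => ((hΓ z s).sub (hΓ z' s)).hasDerivWithinAt)
      (fun s hs => by
        have hst : s ≤ t := hs.2.le.trans (hht N)
        exact (hL _ _ (hR' z hz s hs.1 hst) (hR' z' hz' s hs.1 hst)).trans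
          (mul_le_mul_of_nonneg_left (hC z z' hz hz' s hs.1 hst) hL0))
      _ ⟨hh N, le_rfl⟩
    simp only [h0, sub_zero] at h1
    rw [sub_sub_sub_comm]
    refine h1.trans_eq ?_
    ring
  · obtain ⟨R', hR'⟩ := hreach (R + 2)
    obtain ⟨L, hL0, hL⟩ := hX (max R' (R + 2))
    obtain ⟨M, hM⟩ := (isCompact_closedBall (0 : Phase n) R').exists_bound_of_continuousOn
      hX.continuous.continuousOn
    refine ⟨fun N => L * (|M| * (t / (N + 1))), ?_, fun N z hz => ?_⟩
    · simpa using ((tendsto_step t).const_mul |M|).const_mul L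
    have hdisp : ∀ s, 0 ≤ s → s ≤ t / ((N : ℝ) + 1) → ‖Γ z s - z‖ ≤ |M| * s := by
      intro s hs hst
      have h1 := norm_image_sub_le_of_norm_deriv_le_segment' (a := 0) (b := s)
        (f := Γ z) (f' := fun s => X (Γ z s)) (C := |M|)
        (fun q _ => (hΓ z q).hasDerivWithinAt) (fun q hq => by
          refine (hM _ ?_).trans (le_abs_self M)
          simpa using hR' z hz q hq.1 (hq.2.le.trans (hst.trans (hht N))))
        s ⟨hs, le_rfl⟩
      simpa [h0] using h1
    have h2 := norm_image_sub_le_of_norm_deriv_le_segment' (a := 0) (b := t / ((N : ℝ) + 1))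
      (f := fun s => Γ z s - s • X z) (f' := fun s => X (Γ z s) - (1 : ℝ) • X z)
      (C := L * (|M| * (t / ((N : ℝ) + 1))))
      (fun s _ => ((hΓ z s).sub ((hasDerivAt_id s).smul_const (X z))).hasDerivWithinAt)
      (fun s hs => by
        rw [one_smul]
        refine (hL _ _ ((hR' z hz s hs.1 (hs.2.le.trans (hht N))).trans (le_max_left _ _))
          (hz.trans (le_max_right _ _))).trans (mul_le_mul_of_nonneg_left ?_ hL0)
        refine (hdisp s hs.1 hs.2.le).trans (mul_le_mul_of_nonneg_left hs.2.le (abs_nonneg M)))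
      _ ⟨hh N, le_rfl⟩
    simp only [h0, zero_smul, sub_zero] at h2
    rw [sub_right_comm]
    refine h2.trans_eq ?_
    ring

/-- Weak solutions are transported by the flow. -/
theorem IsWeakSolution.ae_eq_zero (hX : LipOnBalls X) (h0 : ∀ z, Γ z 0 = z)
    (hΓ : ∀ z, IsTraj X (Γ z)) {t R R₀ : ℝ} (ht : 0 ≤ t) {u : ℝ → PhaseL2 n}
    (hu : IsWeakSolution X 0 t u) (hu0 : ∀ᵐ z, R₀ < ‖z‖ → u 0 z = 0)
    (hR : ∀ z, ‖z‖ ≤ R₀ → ‖Γ z t‖ ≤ R) : ∀ᵐ z, R < ‖z‖ → u t z = 0 := by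
  have hopen : IsOpen {z : Phase n | R < ‖z‖} := isOpen_lt continuous_const continuous_norm
  refine hopen.ae_eq_zero_of_integral_contDiff_smul_eq_zero
    ((memLp_locInt (Lp.memLp (u t))).locallyIntegrableOn _) fun ψ hψ hψc hψs => ?_
  obtain ⟨R', hR'⟩ := flow_isApproxFlow hX h0 hΓ ⟨hψ, hψc⟩ ht
  have h1 := hu.tendsto_duality hX.continuous ht ⟨hψ, hψc⟩ hR'
  refine tendsto_nhds_unique h1 (tendsto_const_nhds.congr fun N => ?_)
  simp only [pair_zero, mul_zero, Finset.sum_const_zero, add_zero]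
  symm
  refine integral_eq_zero_of_ae ?_
  filter_upwards [hu0] with z hz
  rcases le_or_gt ‖z‖ R₀ with hz' | hz'
  · have h2 : (fun z => Γ z (t / ((N : ℝ) + 1)))^[N + 1] z = Γ z t := by
      rw [flow_iterate hX h0 hΓ (by positivity)]
      congr 1
      push_cast
      field_simp
    have h3 : ψ (Γ z t) = 0 := by
      by_contra h
      have : R < ‖Γ z t‖ := hψs (subset_tsupport ψ h)
      linarith [hR z hz']
    simp only [h2, h3, zero_smul, Pi.zero_apply]
  · simp [hz hz']

end Flow

end Liouville

end

noncomputable section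

namespace Liouville

open Filter Topology

variable {n : ℕ}

/-! ### Truncated potentials -/

theorem pd_add {F ι : Type*} [NormedAddCommGroup F] [NormedSpace ℝ F] (e : ι → F) (w : List ι)
    {f g : F → ℝ} (hf : ContDiff ℝ ∞ f) (hg : ContDiff ℝ ∞ g) :
    pd e w (fun x => f x + g x) = fun x => pd e w f x + pd e w g x := by
  induction w with
  | nil => rfl
  | cons i w ih =>
    funext x
    simp only [pd, ih]
    rw [fderiv_fun_add ((contDiff_pd e w hf).differentiable (by simp)).differentiableAt
      ((contDiff_pd e w hg).differentiable (by simp)).differentiableAt]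
    rfl

theorem tsupport_pd_subset {F ι : Type*} [NormedAddCommGroup F] [NormedSpace ℝ F] (e : ι → F)
    (w : List ι) (φ : F → ℝ) : tsupport (pd e w φ) ⊆ tsupport φ := by
  induction w with
  | nil => exact subset_rfl
  | cons i w ih => exact (tsupport_fderiv_apply_subset ℝ (e i)).trans ih

theorem exists_pd_mul_bound {κ : Type*} {r : ℝ} (j : ℕ) {χ : Conf n → ℝ} (hχ : IsTest χ)
    (hs : tsupport χ ⊆ Metric.closedBall 0 r) {g : κ → Conf n → ℝ} (hg : ∀ i, ContDiff ℝ ∞ (g i))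
    (h : ∀ w : List (Fin n), w.length ≤ j →
      ∃ M, ∀ i x, ‖x‖ ≤ r → |pd (ebasis n) w (g i) x| ≤ M) (w : List (Fin n)) (hw : w.length ≤ j) :
    ∃ M, ∀ i x, |pd (ebasis n) w (fun y => χ y * g i y) x| ≤ M := by
  induction j generalizing χ g w with
  | zero =>
    obtain rfl := List.length_eq_zero_iff.1 (Nat.le_zero.1 hw)
    obtain ⟨M, hM⟩ := h [] le_rfl
    obtain ⟨b, hb⟩ := hχ.2.exists_bound_of_continuous hχ.continuous
    have hb0 : 0 ≤ b := (norm_nonneg _).trans (hb 0)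
    refine ⟨b * |M|, fun i x => ?_⟩
    simp only [pd, abs_mul]
    by_cases hx : χ x = 0
    · rw [hx, abs_zero, zero_mul]
      positivity
    · exact mul_le_mul (hb x) ((hM i x (by simpa using hs (subset_tsupport χ hx))).trans
        (le_abs_self M)) (abs_nonneg _) hb0
  | succ j ih =>
    rcases List.eq_nil_or_concat w with rfl | ⟨w', l, rfl⟩
    · exact ih hχ hs hg (fun w hw => h w (by omega)) [] (Nat.zero_le _)
    · rw [List.concat_eq_append] at hw ⊢
      simp only [List.length_append, List.length_singleton] at hw
      obtain ⟨M₁, hM₁⟩ := ih (hχ.fderiv_apply (ebasis n l))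
        ((tsupport_fderiv_apply_subset ℝ (ebasis n l)).trans hs) hg (fun w hw => h w (by omega))
        w' (by omega)
      obtain ⟨M₂, hM₂⟩ := ih hχ hs (g := fun i y => fderiv ℝ (g i) y (ebasis n l))
        (fun i => contDiff_fderiv_apply (hg i) _) (fun w hw => by
          obtain ⟨M, hM⟩ := h (w ++ [l]) (by simpa using hw)
          refine ⟨M, fun i x hx => ?_⟩
          have := hM i x hx
          rwa [pd_append] at this) w' (by omega)
      refine ⟨M₁ + M₂, fun i x => ?_⟩
      have e1 : pd (ebasis n) [l] (fun y => χ y * g i y) = fun y =>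
          fderiv ℝ χ y (ebasis n l) * g i y + χ y * fderiv ℝ (g i) y (ebasis n l) := by
        funext y
        simp only [pd]
        rw [fderiv_fun_mul (hχ.1.differentiable (by simp)).differentiableAt
          ((hg i).differentiable (by simp)).differentiableAt]
        simp only [add_apply, smul_apply, smul_eq_mul]
        ring
      rw [pd_append, e1, pd_add _ _ ((contDiff_fderiv_apply hχ.1 _).mul (hg i))
        (hχ.1.mul (contDiff_fderiv_apply (hg i) _))]
      exact (abs_add_le _ _).trans (add_le_add (hM₁ i x) (hM₂ i x))

theorem abs_fderiv_apply_sub_le {f : Conf n → ℝ} (hf : ContDiff ℝ ∞ f) {j : Fin n}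
    {M : Fin n → ℝ} (hM : ∀ i x, |pd (ebasis n) [i, j] f x| ≤ M i) (x x' : Conf n) :
    |fderiv ℝ f x (ebasis n j) - fderiv ℝ f x' (ebasis n j)| ≤ (∑ i, M i) * ‖x - x'‖ :=
  (convex_univ).norm_image_sub_le_of_norm_fderiv_le (𝕜 := ℝ)
    (f := fun y => fderiv ℝ f y (ebasis n j)) (x := x') (y := x)
    (fun y _ => ((contDiff_fderiv_apply hf _).differentiable (by simp)).differentiableAt)
    (fun y _ => (norm_fderiv_le_sum _ _).trans (Finset.sum_le_sum fun i _ => hM i y))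
    (Set.mem_univ _) (Set.mem_univ _)

theorem exists_isSmoothApprox_mul {V : Conf n → ℝ} (hV : ContDiff ℝ 1 V) {m : ℕ}
    (hd : ∀ w : List (Fin n), w.length ≤ m + 2 → ∀ r : ℝ, ∃ g M, IsWDC w V g ∧
      ∀ᵐ x, ‖x‖ ≤ r → |g x| ≤ M) {χ : Conf n → ℝ} (hχ : IsTest χ) :
    ∃ W, IsSmoothApprox (fun x => χ x * V x) (m + 1) W := by
  obtain ⟨r, hr⟩ := hχ.2.isBounded.exists_norm_le
  have hs : tsupport χ ⊆ Metric.closedBall 0 r := fun x hx => by simpa using hr x hx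
  choose η hη using fun N : ℕ => exists_isMollifier (F := Conf n)
    (Nat.one_div_pos_of_nat (α := ℝ) (n := N))
  have hsm : ∀ N, ContDiff ℝ ∞ (moll (η N) V) := fun N =>
    contDiff_moll (hη N).test hV.continuous.locallyIntegrable
  have hb := exists_pd_mul_bound (m + 2) hχ hs hsm fun w hw => by
    obtain ⟨g, M, hg, hM⟩ := hd w hw (r + 1)
    refine ⟨M, fun N x hx => abs_pd_moll_le hg (hη N) ?_⟩
    filter_upwards [hM] with y hy hy'
    exact hy (hy'.trans (add_le_add hx (mollRadius_le N)))
  have hWs : ∀ N, ContDiff ℝ ∞ fun x => χ x * moll (η N) V x := fun N => hχ.1.mul (hsm N)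
  refine ⟨fun N x => χ x * moll (η N) V x, hWs, ?_, fun _ => ?_, fun _ => ?_,
    fun w _ hw => hb w hw⟩
  · choose M hM using fun j : Fin n => hb [j] (by simp)
    refine ⟨∑ j, M j, fun N x => (norm_le_sum_abs _).trans (Finset.sum_le_sum fun j _ => ?_)⟩
    rw [gradient_apply]
    exact hM j N x
  · choose M hM using fun i j : Fin n => hb [i, j] (by simp)
    refine ⟨∑ j, ∑ i, |M i j|, by positivity, fun N x x' _ _ => ?_⟩
    refine (norm_le_sum_abs _).trans ?_
    rw [Finset.sum_mul]
    refine Finset.sum_le_sum fun j _ => ?_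
    rw [PiLp.sub_apply, gradient_apply, gradient_apply]
    exact abs_fderiv_apply_sub_le (hWs N) (fun i x => (hM i j N x).trans (le_abs_self _)) x x'
  · obtain ⟨b, hb⟩ := hχ.2.exists_bound_of_continuous hχ.continuous
    choose b' hb' using fun j => (hχ.fderiv_apply (ebasis n j)).2.exists_bound_of_continuous
      (hχ.fderiv_apply (ebasis n j)).continuous
    obtain ⟨L₀, hL₀0, hL₀⟩ := LocallyLipschitz.lipOnBalls hV.locallyLipschitz (r + 1)
    obtain ⟨L₁, hL₁0, hL₁⟩ := exists_gradient_moll_sub_le hV (lipOnBalls_gradient hV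
      fun i j => hd [i, j] (by simp)) hη r
    refine ⟨fun N => ∑ j, (b * (L₁ * (1 / ((N : ℝ) + 1))) + b' j * (L₀ * (1 / ((N : ℝ) + 1)))),
      ?_, fun N x _ => (norm_le_sum_abs _).trans (Finset.sum_le_sum fun j _ => ?_)⟩
    · have h0 := tendsto_one_div_add_atTop_nhds_zero_nat (𝕜 := ℝ)
      have h1 := tendsto_finsetSum (Finset.univ : Finset (Fin n)) fun j _ =>
        ((h0.const_mul L₁).const_mul b).add ((h0.const_mul L₀).const_mul (b' j))
      simpa using h1
    have hb0 : 0 ≤ b := (norm_nonneg _).trans (hb 0)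
    have hb'0 : 0 ≤ b' j := (norm_nonneg _).trans (hb' j 0)
    have e : ∀ f : Conf n → ℝ, DifferentiableAt ℝ f x →
        gradient (fun y => χ y * f y) x j = χ x * gradient f x j +
          fderiv ℝ χ x (ebasis n j) * f x := by
      intro f hf
      rw [gradient_apply, gradient_apply,
        fderiv_fun_mul (hχ.1.differentiable (by simp)).differentiableAt hf]
      simp only [add_apply, smul_apply, smul_eq_mul]
      ring
    rw [PiLp.sub_apply, e _ ((hsm N).differentiable (by simp)).differentiableAt,
      e _ (hV.differentiable one_ne_zero).differentiableAt,
      show ∀ a b c d e f : ℝ, a * b + c * d - (a * e + c * f) = a * (b - e) + c * (d - f) by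
        intros; ring]
    by_cases hx : x ∈ tsupport χ
    · have hxr := hr x hx
      refine (abs_add_le _ _).trans (add_le_add ?_ ?_)
      · rw [abs_mul]
        exact mul_le_mul (hb x) ((abs_apply_le_norm (gradient (moll (η N) V) x - gradient V x)
          j).trans (hL₁ N x hxr)) (abs_nonneg _) hb0
      · rw [abs_mul]
        refine mul_le_mul (hb' j x) ?_ (abs_nonneg _) hb'0
        refine abs_moll_sub_le (hη N) hV.continuous.locallyIntegrable x fun y hy => ?_
        have hy1 := hy.trans (mollRadius_le N)
        have h1 := hL₀ (x - y) x (by linarith [norm_sub_le x y]) (by linarith)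
        rw [sub_sub_cancel_left, norm_neg] at h1
        exact h1.trans (mul_le_mul_of_nonneg_left hy hL₀0)
    · have hx1 : χ x = 0 := image_eq_zero_of_notMem_tsupport hx
      have hx2 : fderiv ℝ χ x (ebasis n j) = 0 := image_eq_zero_of_notMem_tsupport
        (f := fun x => fderiv ℝ χ x (ebasis n j))
        fun h => hx (tsupport_fderiv_apply_subset ℝ (ebasis n j) h)
      rw [hx1, hx2, zero_mul, zero_mul, add_zero, abs_zero]
      positivity

theorem lipOnBalls_field {V : Conf n → ℝ} (h : LipOnBalls (gradient V)) :
    LipOnBalls (field V) := by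
  intro r
  obtain ⟨L, hL0, hL⟩ := h r
  refine ⟨2 * Real.pi + L, by positivity, fun z z' hz hz' => ?_⟩
  rw [field_eq, field_eq, add_sub_add_comm, add_mul]
  refine (norm_add_le _ _).trans (add_le_add (norm_drift_sub_le z z')
    ((norm_kick_sub_le V V z z').trans ((hL _ _ ((norm_fst_le z).trans hz)
      ((norm_fst_le z').trans hz')).trans (mul_le_mul_of_nonneg_left ?_ hL0))))
  exact norm_fst_le (z - z')

/-! ### Finiteness of the pairings for compactly supported data -/

theorem DerivsLocallyBounded.exists_isWDC {V : Conf n → ℝ} {m : ℕ}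
    (h : DerivsLocallyBounded V m) (w : List (Fin n)) (hw : w.length ≤ m) (r : ℝ) :
    ∃ g M, IsWDC w V g ∧ ∀ᵐ x, ‖x‖ ≤ r → |g x| ≤ M := by
  obtain ⟨g, hg, hb⟩ := h (fun i => w.count i) (by rwa [sum_count])
  obtain ⟨M, hM⟩ := exists_ae_le_of_memLp_top (hb _ (isCompact_closedBall 0 r))
  refine ⟨g, M, (isWeakDerivConf_count w V g).1 hg, ?_⟩
  filter_upwards [(ae_restrict_iff' measurableSet_closedBall).1 hM] with x hx hxr
  exact hx (by simpa using hxr)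

theorem IsWD.ae_eq_zero {w : List (Ix n)} {f g : Phase n → ℂ} (h : IsWD w f g) {R : ℝ}
    (hf : ∀ᵐ z, R < ‖z‖ → f z = 0) : ∀ᵐ z, R < ‖z‖ → g z = 0 := by
  have hopen : IsOpen {z : Phase n | R < ‖z‖} := isOpen_lt continuous_const continuous_norm
  refine hopen.ae_eq_zero_of_integral_contDiff_smul_eq_zero
    (h.2.1.locallyIntegrableOn _) fun ψ hψ hψc hψs => ?_
  rw [← h.2.2 ψ ⟨hψ, hψc⟩]
  refine integral_eq_zero_of_ae ?_
  filter_upwards [hf] with z hz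
  by_cases h0 : pd (dir n) w ψ z = 0
  · simp [h0]
  · have : R < ‖z‖ := hψs (tsupport_pd_subset _ w ψ (subset_tsupport _ h0))
    simp [hz this]

theorem memLp_smul_of_supp {c : Phase n → ℝ} (hc : Continuous c) {G : Phase n → ℂ}
    (hG : MemLp G 2 volume) {R : ℝ} (hR : ∀ᵐ z, R < ‖z‖ → G z = 0) :
    MemLp (fun z => c z • G z) 2 volume := by
  obtain ⟨M, hM⟩ := (isCompact_closedBall (0 : Phase n) R).exists_bound_of_continuousOn
    hc.continuousOn
  refine hG.of_le_mul (c := M) (hc.aestronglyMeasurable.smul hG.1) ?_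
  filter_upwards [hR] with z hz
  rw [norm_smul]
  rcases le_or_gt ‖z‖ R with h | h
  · exact mul_le_mul_of_nonneg_right (hM z (by simpa using h)) (norm_nonneg _)
  · simp [hz h]

theorem exists_flow_bound {V : Conf n → ℝ} (hflow : CompleteFlow V)
    (hL : LipOnBalls (gradient V)) {T : ℝ} {ρ₀ : PhaseL2 n} {ρ : ℝ → PhaseL2 n}
    (hρ : IsSolution V T ρ₀ ρ) (hsupp : CompactlySupported ρ₀) :
    ∃ R, ∀ t ∈ Set.Icc 0 T, ∀ᵐ z, R < ‖z‖ → ρ t z = 0 := by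
  choose Γ h0 hΓ using hflow
  have hX := lipOnBalls_field hL
  obtain ⟨K, hK, hKz⟩ := hsupp
  obtain ⟨R₀, hR₀⟩ := hK.isBounded.exists_norm_le
  obtain ⟨R, hR⟩ := exists_reach_bound hX (fun z => ⟨Γ z, h0 z, hΓ z⟩) R₀ T
  refine ⟨R, fun t ht => (hρ.isWeakSolution ht.2).ae_eq_zero hX h0 hΓ ht.1 (R₀ := R₀) ?_
    fun z hz => hR _ (hΓ z) (by rwa [h0]) t ht.1 ht.2⟩
  rw [hρ.initial]
  filter_upwards [hKz] with z hz hzR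
  exact hz fun h => absurd (hR₀ z h) (not_le.2 hzR)

theorem IsWeakSolution.congr_field {V V' : Conf n → ℝ} {t R : ℝ} {u : ℝ → PhaseL2 n}
    (hu : IsWeakSolution (field V) 0 t u) (hR : ∀ s ∈ Set.Icc 0 t, ∀ᵐ z, R < ‖z‖ → u s z = 0)
    (hV : ∀ x, ‖x‖ ≤ R → gradient V' x = gradient V x) : IsWeakSolution (field V') 0 t u := by
  refine ⟨hu.continuousOn, fun φ hφ s hs => (hu.weak φ hφ s hs).trans
    (intervalIntegral.integral_congr fun r hr => ?_)⟩
  rw [Set.uIcc_of_le hs.1] at hr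
  refine congr_arg (· + _) (integral_congr_ae ?_)
  filter_upwards [hR r ⟨hr.1, hr.2.trans hs.2⟩] with z hz
  rcases le_or_gt ‖z‖ R with h | h
  · rw [field, field, hV _ ((norm_fst_le z).trans h)]
  · simp [hz h]

theorem pairingsFinite_of_completeFlow {V : Conf n → ℝ} (hV : ContDiff ℝ 1 V) {m : ℕ}
    (hflow : CompleteFlow V) (h : DerivsLocallyBounded V (m + 2)) {T : ℝ} {ρ₀ : PhaseL2 n}
    {ρ : ℝ → PhaseL2 n} (hρ : IsSolution V T ρ₀ ρ) (hsupp : CompactlySupported ρ₀)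
    (hm : sobolevNorm (m + 1) ρ₀ < ⊤) : PairingsFinite V m T ρ := by
  obtain ⟨R, hR⟩ := exists_flow_bound hflow
    (lipOnBalls_gradient hV fun i j => h.exists_isWDC [i, j] (by simp)) hρ hsupp
  let χ : ContDiffBump (0 : Conf n) := ⟨|R| + 1, |R| + 2, by positivity, by linarith⟩
  obtain ⟨W, hW⟩ := exists_isSmoothApprox_mul hV h.exists_isWDC
    ⟨χ.contDiff, χ.hasCompactSupport⟩
  have hV' : ContDiff ℝ 1 fun x => χ x * V x := χ.contDiff.mul hV
  have hgrad : ∀ x, ‖x‖ ≤ R → gradient (fun x => χ x * V x) x = gradient V x := by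
    intro x hx
    refine Filter.EventuallyEq.gradient_eq ?_
    filter_upwards [χ.eventuallyEq_one_of_mem_ball (x := x) (by
      rw [mem_ball_zero_iff]
      linarith [le_abs_self R])] with y hy
    rw [hy, Pi.one_apply, one_mul]
  intro t ht A B hAB
  have hu := (hρ.isWeakSolution ht.2).congr_field
    (fun s hs => hR s ⟨hs.1, hs.2.trans ht.2⟩) hgrad
  obtain ⟨C, -, hC⟩ := hW.exists_sobolevNorm_le hV'
  have hfin : sobolevNorm (m + 1) (ρ t) < ⊤ := by
    refine (hC t ht.1 0 ρ hu).trans_lt (ENNReal.mul_lt_top ENNReal.ofReal_lt_top ?_)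
    rwa [sobolevNorm_zero, mul_zero, add_zero, hρ.initial]
  obtain ⟨F, hF⟩ := exists_isJet hfin
  have hlen : (canon₂ A B).length ≤ m := by rwa [length_canon₂]
  obtain ⟨h1, h2⟩ := hF.pairing hV hlen
  have hw := (hF (canon₂ A B) (by omega)).2
  have hFi : ∀ σ (c : Phase n → ℝ), Continuous c →
      MemLp (fun z => c z • F (σ :: canon₂ A B) z) 2 volume := by
    intro σ c hc
    have hσ := hF (σ :: canon₂ A B) (by simp; omega)
    exact memLp_smul_of_supp hc hσ.2 (hσ.1.ae_eq_zero (hR t ht))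
  refine ⟨F (canon₂ A B), (isWeakDeriv_iff_isWD _ _ _ _).2 (hF _ (by omega)).1, hw,
    ⟨_, h1, integrable_conj_mul hw (memLp_finsetSum _ fun i _ => hFi _ _ ?_)⟩,
    ⟨_, h2, integrable_conj_mul hw (memLp_finsetSum _ fun i _ => hFi _ _ ?_)⟩⟩
  · exact (contDiff_coord (Sum.inr i)).continuous
  · exact (continuous_gradient_apply hV i).comp continuous_fst

end Liouville

end

/-- `H^m` regularity for the Liouville equation, with the two sufficient conditions for the
finiteness of the pairings. The potential `V` is `C¹`, so that the force `∂ₓV` is defined. -/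
theorem theorem2p3 (n m : ℕ) (V : Liouville.Conf n → ℝ) (hV : ContDiff ℝ 1 V) :
    -- the estimate; the constant depends on `n`, `m`, `V` only
    (∀ Vhat : Liouville.Conf n → ℂ, Liouville.IsFourierOf V Vhat →
      Integrable (fun S => ((‖S‖ ^ (m + 1) : ℝ) : ℂ) * Vhat S) →
      (m = 0 → LocallyLipschitz (gradient V)) →
      ∃ C : ℝ, 0 < C ∧ ∀ T : ℝ, 0 < T →
        ∀ (ρ₀ : Lp ℂ 2 (volume : Measure (Liouville.Phase n)))
          (ρ : ℝ → Lp ℂ 2 (volume : Measure (Liouville.Phase n))),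
          Liouville.IsSolution V T ρ₀ ρ → Liouville.PairingsFinite V m T ρ →
          ∀ t ∈ Set.Icc 0 T,
            Liouville.sobolevNorm m (ρ t) ≤
              ENNReal.ofReal (Real.exp (t * C)) * Liouville.sobolevNorm m ρ₀) ∧
    -- first sufficient condition
    (Liouville.CompleteFlow V → Liouville.DerivsLocallyBounded V (m + 2) →
      ∀ T : ℝ, 0 < T →
        ∀ (ρ₀ : Lp ℂ 2 (volume : Measure (Liouville.Phase n)))
          (ρ : ℝ → Lp ℂ 2 (volume : Measure (Liouville.Phase n))),
          Liouville.IsSolution V T ρ₀ ρ → Liouville.CompactlySupported ρ₀ →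
          Liouville.sobolevNorm (m + 1) ρ₀ < ⊤ →
          Liouville.PairingsFinite V m T ρ) ∧
    -- second sufficient condition
    (Liouville.DerivsBounded V (m + 2) →
      ∀ T : ℝ, 0 < T →
        ∀ (ρ₀ : Lp ℂ 2 (volume : Measure (Liouville.Phase n)))
          (ρ : ℝ → Lp ℂ 2 (volume : Measure (Liouville.Phase n))),
          Liouville.IsSolution V T ρ₀ ρ →
          Liouville.sobolevNorm (m + 1) ρ₀ < ⊤ → Liouville.KdxDerivsL2 m ρ₀ →
          Liouville.PairingsFinite V m T ρ) := by
  refine ⟨fun Vhat hF hI hm => ?_, fun hflow hloc T _ ρ₀ ρ hρ hsupp hfin =>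
      Liouville.pairingsFinite_of_completeFlow hV hflow hloc hρ hsupp hfin,
    fun h T _ ρ₀ ρ hρ hfin hk => Liouville.pairingsFinite_of_derivsBounded hV h hρ hfin hk⟩
  obtain ⟨W, hW⟩ := hF.exists_isSmoothApprox hV hI hm
  obtain ⟨C, hC0, hC⟩ := hW.exists_isSolution_le hV
  exact ⟨C, hC0, fun T _ ρ₀ ρ hρ _ t ht => hC T ρ₀ ρ hρ t ht⟩
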